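/- Let $D\in\{2,4\}$ and let $M$ be a smooth oriented $D$-dimensional manifold (Hausdorff, $\sigma$-compact, without boundary). Let $\Theta$ be a real antisymmetric constant $m\times m$ matrix and $X_1,\dots,X_m$ smooth real vector fields on $M$ with $[X_\alpha,X_\beta]=0$. Everything below is formal in a real parameter $\lambda$: functions, forms and complex numbers are replaced by formal power series in $\lambda$ with such coefficients. For complex differential forms put $$\omega\wedge_\star\tau=\sum_{k\ge 0}\frac{1}{k!}\Big(\frac{i\lambda}{2}\Big)^k\Theta^{\alpha_1\beta_1}\cdots\Theta^{\alpha_k\beta_k}\,(\mathcal L_{X_{\alpha_1}}\cdots\mathcal L_{X_{\alpha_k}}\omega)\wedge(\mathcal L_{X_{\beta_1}}\cdots\mathcal L_{X_{\beta_k}}\tau),$$ written $\star$ if one of the factors is a function, and extended to matrix-valued forms by matrix multiplication. Gamma matrices. For $D=2$: $\gamma_0=\begin{pmatrix}0&1\\1&0\end{pmatrix}$, $\gamma_1=\begin{pmatrix}0&-1\\1&0\end{pmatrix}$, $\gamma_3=\gamma_0\gamma_1$. For $D=4$: $\gamma_0,\dots,\gamma_3$ are complex $4\times4$ matrices with $\gamma_a\gamma_b+\gamma_b\gamma_a=2\,\mathrm{diag}(1,-1,-1,-1)_{ab}$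 and $\gamma_a^\dagger=\gamma_0\gamma_a\gamma_0$; $\gamma_5=i\gamma_0\gamma_1\gamma_2\gamma_3$ and $\gamma_{ab}=\frac12[\gamma_a,\gamma_b]$. A noncommutative Cartan geometry is a pair $(V,\Omega)$ of matrix-valued smooth one-forms (formal power series in $\lambda$) with $V^\dagger=\gamma_0V\gamma_0$, $\Omega^\dagger=-\gamma_0\Omega\gamma_0$, of the form * $D=2$: $V=V^a\gamma_a$, $\Omega=\omega\gamma_3+\tilde\omega 1$, with $\tilde\omega|_{\lambda=0}=0$; * $D=4$: $V=V^a\gamma_a+\tilde V^a\gamma_a\gamma_5$, $\Omega=\frac14\omega^{ab}\gamma_{ab}+i\omega 1+\tilde\omega\gamma_5$, with $\tilde V^a|_{\lambda=0}=\omega|_{\lambda=0}=\tilde\omega|_{\lambda=0}=0$, such that the one-forms $V^a|_{\lambda=0}$ are linearly independent at every point of $M$. It is $\star$-torsion free if $\mathrm d_\Omega V:=\mathrm dV-\Omega\wedge_\star V-V\wedge_\star\Omega=0$. Dirac fields are $\psi\in C^\infty(M,\mathbb C^D)[[\lambda]]$, with $\overline\psi=\psi^\dagger\gamma_0$ and $\mathrm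 d_\Omega\psi=\mathrm d\psi-\Omega\star\psi$. (Compact support is meant for every coefficient of the power series; $\psi_1,\psi_2$ have compactly overlapping support if $\mathrm{supp}\,\psi_1^{(m)}\cap\mathrm{supp}\,\psi_2^{(n)}$ is compact for any two coefficients.) For $\psi_1,\psi_2$ with compactly overlapping support put $$\langle\psi_1,\psi_2\rangle=\int_M\mathrm{Tr}\big(\psi_2\star\overline{\psi_1}\star V\wedge_\star V\gamma_3\big)\ (D=2),\qquad \langle\psi_1,\psi_2\rangle=i\int_M\mathrm{Tr}\big(\psi_2\star\overline{\psi_1}\star V\wedge_\star V\wedge_\star V\wedge_\star V\gamma_5\big)\ (D=4).$$ Suppose $(V,\Omega)$ is $\star$-torsion free. Then there is exactly one operator $D^{\mathrm{AC}}$ on $C^\infty(M,\mathbb C^D)[[\lambda]]$ (the Aschieri–Castellani Dirac operator) such that for all $\psi_2$ and all compactly supported $\psi_1$ $$\langle\psi_1,D^{\mathrm{AC}}\psi_2\rangle=2i\int_M\mathrm{Tr}\big((\mathrm d_\Omega\psi_2)\star\overline{\psi_1}\wedge_\star V\gamma_3\big)\ (D=2),$$ $$\langle\psi_1,D^{\mathrm{AC}}\psi_2\rangle=-4\int_M\mathrm{Tr}\big((\mathrm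 d_\Omega\psi_2)\star\overline{\psi_1}\wedge_\star V\wedge_\star V\wedge_\star V\gamma_5\big)\ (D=4),$$ and it is formally self-adjoint: $\langle\psi_1,D^{\mathrm{AC}}\psi_2\rangle=\langle D^{\mathrm{AC}}\psi_1,\psi_2\rangle$ for all Dirac fields $\psi_1,\psi_2$ with compactly overlapping support. -/

import Mathlib

open scoped Manifold ContDiff Matrix ComplexConjugate

noncomputable section

namespace TwistedDirac

/-! ### Complex differential forms on a manifold modelled on `ℝ^D` -/

/-- The model space `ℝ^D`. -/
abbrev Eucl (D : ℕ) : Type := EuclideanSpace ℝ (Fin D)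

/-- Coordinate vector `∂_i` of `ℝ^D`. -/
abbrev coordVec (D : ℕ) (i : Fin D) : Eucl D := EuclideanSpace.single i 1

/-- The basis `dx^i` of the complex-valued covectors of `ℝ^D`. -/
def dx (D : ℕ) : Module.Basis (Fin D) ℂ (Eucl D →L[ℝ] ℂ) :=
  Module.Basis.ofEquivFun
    { toFun := fun ξ i => ξ (coordVec D i)
      map_add' := fun _ _ => rfl
      map_smul' := fun _ _ => rfl
      invFun := fun c => ∑ i, c i • Complex.ofRealCLM.comp (EuclideanSpace.proj i)
      left_inv := by
        intro ξ
        ext v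
        have hv : v = ∑ i, v i • coordVec D i := by
          ext j
          simp [Pi.single_apply]
        conv_rhs => rw [hv]
        simp [mul_comm]
      right_inv := by
        intro c
        ext j
        simp [apply_ite] }

/-- The basis `dx^S = dx^{i₁} ∧ ⋯ ∧ dx^{i_k}`, `S = {i₁ < ⋯ < i_k}`, of the exterior algebra. -/
def dxS (D : ℕ) : Module.Basis (Finset (Fin D)) ℂ (ExteriorAlgebra ℂ (Eucl D →L[ℝ] ℂ)) :=
  (dx D).ExteriorAlgebra

/-- Exterior derivative on `ℝ^D`: `d (∑_S g_S dx^S) = ∑_i ∑_S (∂_i g_S) dx^i ∧ dx^S`. -/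
def extD {D : ℕ} (g : Eucl D → ExteriorAlgebra ℂ (Eucl D →L[ℝ] ℂ)) (y : Eucl D) :
    ExteriorAlgebra ℂ (Eucl D →L[ℝ] ℂ) :=
  ∑ i : Fin D, ∑ S : Finset (Fin D),
    fderiv ℝ (fun z => (dxS D).repr (g z) S) y (coordVec D i) •
      (ExteriorAlgebra.ι ℂ (dx D i) * dxS D S)

/-- Coefficient of `dx^1 ∧ ⋯ ∧ dx^D`. -/
def topCoeff {D : ℕ} (η : ExteriorAlgebra ℂ (Eucl D →L[ℝ] ℂ)) : ℂ :=
  (dxS D).repr η Finset.univ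

/-- Transpose of a linear map, on complex-valued covectors. -/
def covPull {E F : Type*} [AddCommGroup E] [Module ℝ E] [TopologicalSpace E]
    [AddCommGroup F] [Module ℝ F] [TopologicalSpace F] (A : E →L[ℝ] F) :
    (F →L[ℝ] ℂ) →ₗ[ℂ] (E →L[ℝ] ℂ) where
  toFun ξ := ξ.comp A
  map_add' _ _ := rfl
  map_smul' _ _ := rfl

/-- Evaluation of complex-valued covectors at a vector. -/
def evalAt {E : Type*} [AddCommGroup E] [Module ℝ E] [TopologicalSpace E] (v : E) :
    Module.Dual ℂ (E →L[ℝ] ℂ) where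
  toFun ξ := ξ v
  map_add' _ _ := rfl
  map_smul' _ _ := rfl

section Forms

variable {D : ℕ} {M : Type*} [TopologicalSpace M] [ChartedSpace (Eucl D) M]

variable (D) in
/-- Complex-valued covectors at `p`. -/
abbrev Cov (p : M) : Type := TangentSpace (𝓡 D) p →L[ℝ] ℂ

variable (D M) in
/-- Complex one-forms. -/
abbrev OneForm : Type _ := (p : M) → Cov D p

variable (D M) in
/-- Complex differential forms of mixed degree, i.e. sections of the exterior algebra of the
complexified cotangent bundle.  The pointwise product is the wedge product. -/
abbrev Form : Type _ := (p : M) → ExteriorAlgebra ℂ (Cov D p)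

variable (D M) in
/-- Vector fields. -/
abbrev VField : Type _ := (p : M) → TangentSpace (𝓡 D) p

/-- A one-form is smooth if its expression in every preferred chart is. -/
def SmoothOneForm (ξ : OneForm D M) : Prop :=
  ∀ x : M, ContDiffOn ℝ ∞
    (fun y : Eucl D => ((ξ ((extChartAt (𝓡 D) x).symm y)).comp
      (mfderiv 𝓘(ℝ, Eucl D) (𝓡 D) (extChartAt (𝓡 D) x).symm y) : Eucl D →L[ℝ] ℂ))
    (extChartAt (𝓡 D) x).target

/-- Expression of a form in the preferred chart at `x`. -/
def localForm (x : M) (η : Form D M) (y : Eucl D) : ExteriorAlgebra ℂ (Eucl D →L[ℝ] ℂ) :=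
  ExteriorAlgebra.map
    (covPull (mfderiv 𝓘(ℝ, Eucl D) (𝓡 D) (extChartAt (𝓡 D) x).symm y))
    (η ((extChartAt (𝓡 D) x).symm y))

/-- Exterior derivative, computed at `p` in the preferred chart at `p`. -/
def dForm (η : Form D M) : Form D M := fun p =>
  ExteriorAlgebra.map
    (covPull (mfderiv (𝓡 D) 𝓘(ℝ, Eucl D) (extChartAt (𝓡 D) p) p))
    (extD (localForm p η) (extChartAt (𝓡 D) p p))

/-- Interior product. -/
def interior (X : VField D M) (η : Form D M) : Form D M := fun p =>
  CliffordAlgebra.contractLeft (evalAt (X p)) (η p)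

/-- Lie derivative of forms, by Cartan's formula. -/
def lieD (X : VField D M) (η : Form D M) : Form D M :=
  dForm (interior X η) + interior X (dForm η)

variable (D M) in
/-- The atlas of `M` is an oriented one: all its transition maps have positive Jacobian. -/
def OrientedAtlas : Prop :=
  ∀ φ ∈ atlas (Eucl D) M, ∀ φ' ∈ atlas (Eucl D) M, ∀ y ∈ (φ.symm.trans φ').source,
    0 < (fderiv ℝ (φ.symm.trans φ') y).det

section Integral

variable [IsManifold (𝓡 D) ∞ M] [T2Space M] [SigmaCompactSpace M]

variable (D M) in
/-- A smooth partition of unity subordinate to the cover of `M` by its preferred charts. -/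
def partOfUnity : SmoothPartitionOfUnity M (𝓡 D) M Set.univ :=
  (SmoothPartitionOfUnity.exists_isSubordinate_chartAt_source (𝓡 D) M).choose

/-- Integral over `M` (oriented by its atlas) of the degree `D` part of a compactly supported
form. -/
def integral (η : Form D M) : ℂ :=
  ∑ᶠ x : M, ∫ y in (extChartAt (𝓡 D) x).target,
    topCoeff (localForm x (fun p => ((partOfUnity D M x p : ℝ) : ℂ) • η p) y)

end Integral

end Forms

/-! ### Abelian twists and `⋆`-products of formal power series of forms -/

section Twist

variable (D : ℕ) (M : Type*) [TopologicalSpace M] [ChartedSpace (Eucl D) M]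
  [IsManifold (𝓡 D) ∞ M]

/-- The data of the twist `exp (-(iλ/2) Θ^{αβ} X_α ⊗ X_β)`. -/
structure AbelianTwist where
  /-- number of vector fields -/
  m : ℕ
  Θ : Matrix (Fin m) (Fin m) ℝ
  antisymm : Θᵀ = -Θ
  X : Fin m → VField D M
  smooth : ∀ α, ContMDiff (𝓡 D) (𝓡 D).tangent ∞
    (fun p => (⟨p, X α p⟩ : TangentBundle (𝓡 D) M))
  commute : ∀ α β, VectorField.mlieBracket (𝓡 D) (X α) (X β) = 0

/-- `Ω^•(M)[[λ]]`, as sequences of coefficients. -/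
abbrev FForm : Type _ := ℕ → Form D M

/-- `Ω^1(M)[[λ]]`. -/
abbrev FOneForm : Type _ := ℕ → OneForm D M

variable {D M}

/-- Coefficient of `λ^k` in `∧ (F⁻¹ η ⊗ τ)`, that is
`(1/k!) (i/2)^k Θ^{α₁β₁} ⋯ Θ^{α_kβ_k} (L_{α₁} ⋯ L_{α_k} η) ∧ (L_{β₁} ⋯ L_{β_k} τ)`. -/
def starTerm (T : AbelianTwist D M) : ℕ → Form D M → Form D M → Form D M
  | 0, η, τ => η * τ
  | k + 1, η, τ => ∑ α, ∑ β, (Complex.I / 2 * (T.Θ α β : ℂ) / ((k : ℂ) + 1)) •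
      starTerm T k (lieD (T.X α) η) (lieD (T.X β) τ)

/-- The product `η ∧_⋆ τ` of formal power series of forms. -/
def wedgeStar (T : AbelianTwist D M) (η τ : FForm D M) : FForm D M := fun n =>
  ∑ a ∈ Finset.HasAntidiagonal.antidiagonal n, ∑ b ∈ Finset.HasAntidiagonal.antidiagonal a.2,
    starTerm T a.1 (η b.1) (τ b.2)

/-- `⋆`-product of matrices of formal forms. -/
def starMul (T : AbelianTwist D M) {k l m : Type*} [Fintype l]
    (A : Matrix k l (FForm D M)) (B : Matrix l m (FForm D M)) : Matrix k m (FForm D M) :=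
  Matrix.of fun i j => ∑ s, wedgeStar T (A i s) (B s j)

/-- Entrywise exterior derivative. -/
def dMat {k l : Type*} (A : Matrix k l (FForm D M)) : Matrix k l (FForm D M) :=
  Matrix.of fun i j n => dForm (A i j n)

/-- Multiplication by a constant matrix from the left. -/
def cmulL {R : Type*} [AddCommMonoid R] [Module ℂ R] {k l m : Type*} [Fintype l]
    (g : Matrix k l ℂ) (A : Matrix l m R) : Matrix k m R :=
  Matrix.of fun i j => ∑ s, g i s • A s j

/-- Multiplication by a constant matrix from the right. -/
def cmulR {R : Type*} [AddCommMonoid R] [Module ℂ R] {k l m : Type*} [Fintype l]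
    (A : Matrix k l R) (g : Matrix l m ℂ) : Matrix k m R :=
  Matrix.of fun i j => ∑ s, g s j • A i s

/-- The matrix `ξ g` for a formal one-form `ξ` and a constant matrix `g`. -/
def tens {k l : Type*} (ξ : FOneForm D M) (g : Matrix k l ℂ) : Matrix k l (FOneForm D M) :=
  Matrix.of fun i j => g i j • ξ

/-- Complex conjugate of a formal one-form (`λ` is real). -/
def conjOne (ξ : FOneForm D M) : FOneForm D M := fun n p =>
  (Complex.conjCLE : ℂ →L[ℝ] ℂ).comp (ξ n p)

/-- Hermitian adjoint of a matrix of formal one-forms. -/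
def dagger {k l : Type*} (A : Matrix k l (FOneForm D M)) : Matrix l k (FOneForm D M) :=
  Matrix.of fun i j => conjOne (A j i)

/-- One-forms as forms. -/
def toForm {k l : Type*} (A : Matrix k l (FOneForm D M)) : Matrix k l (FForm D M) :=
  Matrix.of fun i j n p => ExteriorAlgebra.ι ℂ (A i j n p)

/-- `d_Ω V = dV - (Ω ∧_⋆ V + V ∧_⋆ Ω)`. -/
def starTorsion (T : AbelianTwist D M) {N : ℕ} (V Om : Matrix (Fin N) (Fin N) (FOneForm D M)) :
    Matrix (Fin N) (Fin N) (FForm D M) :=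
  dMat (toForm V) - (starMul T (toForm Om) (toForm V) + starMul T (toForm V) (toForm Om))

/-! ### Dirac fields -/

variable (D M) in
/-- Dirac fields: `C^∞(M, ℂ^N)[[λ]]`. -/
def DiracField (N : ℕ) : Type _ :=
  {ψ : ℕ → M → Fin N → ℂ // ∀ n, ContMDiff (𝓡 D) 𝓘(ℝ, Fin N → ℂ) ∞ (ψ n)}

/-- Compact support, for every coefficient of the power series. -/
def DiracField.HasCompactSupp {N : ℕ} (ψ : DiracField D M N) : Prop :=
  ∀ n, HasCompactSupport (ψ.1 n)

/-- Compact overlapping support, for all pairs of coefficients. -/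
def CompactOverlap {N : ℕ} (ψ₁ ψ₂ : DiracField D M N) : Prop :=
  ∀ m n, IsCompact (tsupport (ψ₁.1 m) ∩ tsupport (ψ₂.1 n))

/-- A Dirac field as a column of functions. -/
def DiracField.col {N : ℕ} (ψ : DiracField D M N) : Matrix (Fin N) Unit (FForm D M) :=
  Matrix.of fun i _ n p => algebraMap ℂ (ExteriorAlgebra ℂ (Cov D p)) (ψ.1 n p i)

/-- The Dirac adjoint `ψ† γ₀`, a row of functions. -/
def DiracField.bar {N : ℕ} (γ₀ : Matrix (Fin N) (Fin N) ℂ) (ψ : DiracField D M N) :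
    Matrix Unit (Fin N) (FForm D M) :=
  cmulR (Matrix.of fun _ i n p => algebraMap ℂ (ExteriorAlgebra ℂ (Cov D p)) (conj (ψ.1 n p i))) γ₀

/-- `d_Ω ψ = dψ - Ω ⋆ ψ`. -/
def covD (T : AbelianTwist D M) {N : ℕ} (Om : Matrix (Fin N) (Fin N) (FOneForm D M))
    (ψ : DiracField D M N) : Matrix (Fin N) Unit (FForm D M) :=
  dMat ψ.col - starMul T (toForm Om) ψ.col

section Trace

variable [T2Space M] [SigmaCompactSpace M]

/-- `∫_M Tr A`, a formal power series. -/
def intTr {N : ℕ} (A : Matrix (Fin N) (Fin N) (FForm D M)) : PowerSeries ℂ :=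
  PowerSeries.mk fun n => integral (A.trace n)

/-- `P` satisfies `⟨ψ₁, P ψ₂⟩ = S(ψ₁, ψ₂)` for all `ψ₂` and all compactly supported `ψ₁`. -/
def Represents {N : ℕ} (ip S : DiracField D M N → DiracField D M N → PowerSeries ℂ)
    (P : DiracField D M N → DiracField D M N) : Prop :=
  ∀ ψ₁ ψ₂, ψ₁.HasCompactSupp → ip ψ₁ (P ψ₂) = S ψ₁ ψ₂

/-- Formal self-adjointness with respect to an inner product. -/
def FormallySelfAdjoint {N : ℕ} (ip : DiracField D M N → DiracField D M N → PowerSeries ℂ)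
    (P : DiracField D M N → DiracField D M N) : Prop :=
  ∀ ψ₁ ψ₂, CompactOverlap ψ₁ ψ₂ → ip ψ₁ (P ψ₂) = ip (P ψ₁) ψ₂

end Trace

end Twist

/-! ### Dimension 2 -/

section Dim2

/-- Gamma matrices in dimension 2. -/
def gamma2 : Fin 2 → Matrix (Fin 2) (Fin 2) ℂ :=
  ![!![0, 1; 1, 0], !![0, -1; 1, 0]]

/-- `γ₃ = γ₀ γ₁`. -/
def gamma3 : Matrix (Fin 2) (Fin 2) ℂ := gamma2 0 * gamma2 1

variable (M : Type*) [TopologicalSpace M] [ChartedSpace (Eucl 2) M]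

/-- Components `V^a`, `ω`, `ω̃` of a noncommutative Cartan geometry in dimension 2. -/
structure Components2 where
  e : Fin 2 → FOneForm 2 M
  w : FOneForm 2 M
  wt : FOneForm 2 M

variable {M}

/-- `V = V^a γ_a`. -/
def Components2.V (g : Components2 M) : Matrix (Fin 2) (Fin 2) (FOneForm 2 M) :=
  ∑ a, tens (g.e a) (gamma2 a)

/-- `Ω = ω γ₃ + ω̃ 1`. -/
def Components2.Om (g : Components2 M) : Matrix (Fin 2) (Fin 2) (FOneForm 2 M) :=
  tens g.w gamma3 + tens g.wt 1

variable (M) in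
/-- Noncommutative Cartan geometries in dimension 2. -/
structure Cartan2 extends Components2 M where
  smooth_e : ∀ a n, SmoothOneForm (e a n)
  smooth_w : ∀ n, SmoothOneForm (w n)
  smooth_wt : ∀ n, SmoothOneForm (wt n)
  real_V : dagger toComponents2.V = cmulL (gamma2 0) (cmulR toComponents2.V (gamma2 0))
  real_Om : dagger toComponents2.Om = -cmulL (gamma2 0) (cmulR toComponents2.Om (gamma2 0))
  lim_wt : wt 0 = 0
  /-- the classical limit `V_(0)` is a vielbein -/
  nondeg : ∀ p, LinearIndependent ℂ (fun a => e a 0 p)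

variable [IsManifold (𝓡 2) ∞ M] [T2Space M] [SigmaCompactSpace M]

/-- `⟨ψ₁, ψ₂⟩ = ∫ Tr (ψ₂ ⋆ ψ̄₁ ⋆ V ∧_⋆ V γ₃)`. -/
def innerProd2 (T : AbelianTwist 2 M) (g : Cartan2 M) (ψ₁ ψ₂ : DiracField 2 M 2) :
    PowerSeries ℂ :=
  intTr (cmulR (starMul T (starMul T (starMul T ψ₂.col (ψ₁.bar (gamma2 0)))
    (toForm g.V)) (toForm g.V)) gamma3)

/-- `2i ∫ Tr ((d_Ω ψ₂) ⋆ ψ̄₁ ∧_⋆ V γ₃)`. -/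
def action2 (T : AbelianTwist 2 M) (g : Cartan2 M) (ψ₁ ψ₂ : DiracField 2 M 2) :
    PowerSeries ℂ :=
  (2 * Complex.I) • intTr (cmulR (starMul T (starMul T (covD T g.Om ψ₂) (ψ₁.bar (gamma2 0)))
    (toForm g.V)) gamma3)

/-- `P` is the Aschieri–Castellani Dirac operator in dimension 2. -/
def IsACDirac2 (T : AbelianTwist 2 M) (g : Cartan2 M)
    (P : DiracField 2 M 2 → DiracField 2 M 2) : Prop :=
  Represents (innerProd2 T g) (action2 T g) P

end Dim2

/-! ### Dimension 4 -/

section Dim4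

/-- The Minkowski metric `diag(1, -1, -1, -1)`. -/
def eta4 : Matrix (Fin 4) (Fin 4) ℂ := Matrix.diagonal ![1, -1, -1, -1]

/-- Gamma matrices in dimension 4. -/
structure Gamma4 where
  γ : Fin 4 → Matrix (Fin 4) (Fin 4) ℂ
  clifford : ∀ a b, γ a * γ b + γ b * γ a = (2 * eta4 a b) • (1 : Matrix (Fin 4) (Fin 4) ℂ)
  herm : ∀ a, (γ a)ᴴ = γ 0 * γ a * γ 0

/-- `γ₅ = i γ₀ γ₁ γ₂ γ₃`. -/
def Gamma4.γ5 (G : Gamma4) : Matrix (Fin 4) (Fin 4) ℂ :=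
  Complex.I • (G.γ 0 * G.γ 1 * G.γ 2 * G.γ 3)

/-- `γ_{ab} = [γ_a, γ_b] / 2`. -/
def Gamma4.γ2 (G : Gamma4) (a b : Fin 4) : Matrix (Fin 4) (Fin 4) ℂ :=
  (1 / 2 : ℂ) • (G.γ a * G.γ b - G.γ b * G.γ a)

variable (M : Type*) [TopologicalSpace M] [ChartedSpace (Eucl 4) M]

/-- Components `V^a`, `Ṽ^a`, `ω^{ab}`, `ω`, `ω̃` of a noncommutative Cartan geometry in
dimension 4. -/
structure Components4 where
  e : Fin 4 → FOneForm 4 M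
  et : Fin 4 → FOneForm 4 M
  wL : Fin 4 → Fin 4 → FOneForm 4 M
  w : FOneForm 4 M
  wt : FOneForm 4 M

variable {M}

/-- `V = V^a γ_a + Ṽ^a γ_a γ₅`. -/
def Components4.V (g : Components4 M) (G : Gamma4) : Matrix (Fin 4) (Fin 4) (FOneForm 4 M) :=
  ∑ a, (tens (g.e a) (G.γ a) + tens (g.et a) (G.γ a * G.γ5))

/-- `Ω = ω^{ab} γ_{ab} / 4 + i ω 1 + ω̃ γ₅`. -/
def Components4.Om (g : Components4 M) (G : Gamma4) : Matrix (Fin 4) (Fin 4) (FOneForm 4 M) :=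
  ∑ a, ∑ b, tens (g.wL a b) ((1 / 4 : ℂ) • G.γ2 a b)
    + tens g.w (Complex.I • (1 : Matrix (Fin 4) (Fin 4) ℂ)) + tens g.wt G.γ5

variable (M) in
/-- Noncommutative Cartan geometries in dimension 4. -/
structure Cartan4 (G : Gamma4) extends Components4 M where
  smooth_e : ∀ a n, SmoothOneForm (e a n)
  smooth_et : ∀ a n, SmoothOneForm (et a n)
  smooth_wL : ∀ a b n, SmoothOneForm (wL a b n)
  smooth_w : ∀ n, SmoothOneForm (w n)
  smooth_wt : ∀ n, SmoothOneForm (wt n)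
  real_V : dagger (toComponents4.V G) = cmulL (G.γ 0) (cmulR (toComponents4.V G) (G.γ 0))
  real_Om : dagger (toComponents4.Om G) = -cmulL (G.γ 0) (cmulR (toComponents4.Om G) (G.γ 0))
  lim_et : ∀ a, et a 0 = 0
  lim_w : w 0 = 0
  lim_wt : wt 0 = 0
  /-- the classical limit `V_(0)` is a vielbein -/
  nondeg : ∀ p, LinearIndependent ℂ (fun a => e a 0 p)

variable [IsManifold (𝓡 4) ∞ M] [T2Space M] [SigmaCompactSpace M]

/-- `⟨ψ₁, ψ₂⟩ = i ∫ Tr (ψ₂ ⋆ ψ̄₁ ⋆ V ∧_⋆ V ∧_⋆ V ∧_⋆ V γ₅)`. -/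
def innerProd4 (T : AbelianTwist 4 M) {G : Gamma4} (g : Cartan4 M G)
    (ψ₁ ψ₂ : DiracField 4 M 4) : PowerSeries ℂ :=
  Complex.I • intTr (cmulR (starMul T (starMul T (starMul T (starMul T
    (starMul T ψ₂.col (ψ₁.bar (G.γ 0))) (toForm (g.V G))) (toForm (g.V G)))
    (toForm (g.V G))) (toForm (g.V G))) G.γ5)

/-- `-4 ∫ Tr ((d_Ω ψ₂) ⋆ ψ̄₁ ∧_⋆ V ∧_⋆ V ∧_⋆ V γ₅)`. -/
def action4 (T : AbelianTwist 4 M) {G : Gamma4} (g : Cartan4 M G)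
    (ψ₁ ψ₂ : DiracField 4 M 4) : PowerSeries ℂ :=
  (-4 : ℂ) • intTr (cmulR (starMul T (starMul T (starMul T
    (starMul T (covD T (g.Om G) ψ₂) (ψ₁.bar (G.γ 0))) (toForm (g.V G))) (toForm (g.V G)))
    (toForm (g.V G))) G.γ5)

/-- `P` is the Aschieri–Castellani Dirac operator in dimension 4. -/
def IsACDirac4 (T : AbelianTwist 4 M) {G : Gamma4} (g : Cartan4 M G)
    (P : DiracField 4 M 4 → DiracField 4 M 4) : Prop :=
  Represents (innerProd4 T g) (action4 T g) P

end Dim4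

end TwistedDirac

end

open TwistedDirac

/-! Write `Q` for the `⋆`-power `V^D`, `W` for `V^(D-1)`, and `γ` for `γ₃` or `γ₅`. Three properties
of the twist carry the proof. The vector fields commute, so `⋆` is associative and Lie derivatives
and `d` are (graded) derivations of it. Complex conjugation combined with reversal of products is an
anti-automorphism of `⋆`, because the sign from conjugating `i` cancels the sign from transposing
the antisymmetric `Θ`. Finally, by antisymmetry again, every term of positive order in the twist is
a sum of Lie derivatives (`TwistData.term_succ_eq_L`); by Cartan's formula and Stokes it integrates
to zero when supports overlap compactly. Hence `∫ η ∧⋆ τ = ∫ η ∧ τ`, and integrated traces are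
graded cyclic (`J_trace_comm_of_even`, `J_trace_comm_of_odd`).

Existence and uniqueness. Cyclicity rewrites the two pairings as `a ∫ Tr ψ₁† γ₀ Qγ φ` and `-b ∫ Tr
ψ₁† γ₀ Wγ ∇ψ₂` (`ip_eq`, `action_eq`). So the operator is determined by the equation `Qγ ⋆ φ =
-(b/a) Wγ ⋆ ∇ψ₂` between columns of top-degree forms. At `λ = 0` the matrix `Qγ` is a nowhere
vanishing volume form times the identity, so the equation is solved order by order by division by
that form (`VolumeLike.exists_solution`), and the solution vanishes where the right side does.
Uniqueness is the fundamental lemma of the calculus of variations (`eq_zero_of_pairing`) together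
with `VolumeLike.injective`.

Self-adjointness. The reality conditions make `γ₀Qγ` antihermitian and `γ₀Wγ` hermitian. Reversal
multiplies the volume form by `ε = (-1)^(D(D-1)/2)`, and the prefactors `a`, `b` are such that the
inner product is hermitian. The action is hermitian up to `∫ d(ψ₁† γ₀ Wγ ψ₂) = 0`: vanishing torsion
gives `dW = ΩW + WΩ`, and this is exactly what cancels the connection terms (`action_conj`). Both
dimensions are instances of one abstract setting, `DiracGeom`.

The underlying Cartan calculus is checked on open subsets of `ℝ^D`, where `form_induction` reduces
an identity of (anti)derivations to functions and constant one-forms, and is then carried to the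
manifold by charts. -/

set_option linter.unusedSectionVars false

noncomputable section

namespace TwistedDirac

/-! ### Exterior algebras -/

section Ext

variable {V W : Type*} [AddCommGroup V] [Module ℂ V] [AddCommGroup W] [Module ℂ W]

/-- The automorphism of the exterior algebra that multiplies degree `k` elements by `t ^ k`. -/
def scal (t : ℂ) : ExteriorAlgebra ℂ V →ₐ[ℂ] ExteriorAlgebra ℂ V :=
  ExteriorAlgebra.map (t • LinearMap.id)

lemma scal_ι (t : ℂ) (v : V) :
    scal t (ExteriorAlgebra.ι ℂ v) = t • ExteriorAlgebra.ι ℂ v := by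
  simp [scal]

lemma scal_algebraMap (t c : ℂ) :
    scal t (algebraMap ℂ (ExteriorAlgebra ℂ V) c) = algebraMap ℂ _ c := by
  simp [scal]

lemma map_scal (f : V →ₗ[ℂ] W) (t : ℂ) (a : ExteriorAlgebra ℂ V) :
    ExteriorAlgebra.map f (scal t a) = scal t (ExteriorAlgebra.map f a) := by
  have : (ExteriorAlgebra.map f).comp (scal t) = (scal t).comp (ExteriorAlgebra.map f) := by
    simp only [scal, ExteriorAlgebra.map_comp_map]
    congr 1
    ext v
    simp
  exact DFunLike.congr_fun this a

/-- `scal (-1)` is the grading involution, so this is the sign rule for moving a covector past an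
arbitrary form. Only the case of two covectors carries content; both sides are multiplicative in
`a`. -/
lemma ι_mul_eq (v : V) (a : ExteriorAlgebra ℂ V) :
    ExteriorAlgebra.ι ℂ v * a = scal (-1) a * ExteriorAlgebra.ι ℂ v := by
  induction a using ExteriorAlgebra.induction with
  | algebraMap c => rw [scal_algebraMap, Algebra.commutes]
  | ι w =>
    rw [scal_ι, neg_smul, one_smul, neg_mul, eq_neg_iff_add_eq_zero]
    exact ExteriorAlgebra.ι_add_mul_swap v w
  | mul a b ha hb => rw [← mul_assoc, ha, mul_assoc, hb, map_mul, mul_assoc]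
  | add a b ha hb => rw [mul_add, ha, hb, map_add, add_mul]

lemma mul_comm_of_even {a : ExteriorAlgebra ℂ V} (ha : scal (-1) a = a)
    (b : ExteriorAlgebra ℂ V) : b * a = a * b := by
  induction b using ExteriorAlgebra.induction with
  | algebraMap c => rw [Algebra.commutes]
  | ι w => rw [ι_mul_eq, ha]
  | mul b c hb hc => rw [mul_assoc, hc, ← mul_assoc, hb, mul_assoc]
  | add b c hb hc => rw [add_mul, hb, hc, mul_add]

lemma mul_comm_of_odd {a : ExteriorAlgebra ℂ V} (ha : scal (-1) a = -a)
    (b : ExteriorAlgebra ℂ V) : b * a = a * scal (-1) b := by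
  induction b using ExteriorAlgebra.induction with
  | algebraMap c => rw [Algebra.commutes, scal_algebraMap]
  | ι w => rw [ι_mul_eq, ha, scal_ι]; simp
  | mul b c hb hc => rw [mul_assoc, hc, ← mul_assoc, hb, mul_assoc, map_mul]
  | add b c hb hc => rw [add_mul, hb, hc, map_add, mul_add]

/-- Contraction is an antiderivation. The rule for a single covector factor propagates by induction
on the left factor, since the involution is multiplicative. -/
lemma contractLeft_mul (θ : Module.Dual ℂ V) (a b : ExteriorAlgebra ℂ V) :
    CliffordAlgebra.contractLeft θ (a * b) =
      CliffordAlgebra.contractLeft θ a * b + scal (-1) a * CliffordAlgebra.contractLeft θ b := by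
  induction a using ExteriorAlgebra.induction generalizing b with
  | algebraMap c =>
    rw [CliffordAlgebra.contractLeft_algebraMap_mul, CliffordAlgebra.contractLeft_algebraMap,
      scal_algebraMap, zero_mul, zero_add]
  | ι w =>
    rw [scal_ι, CliffordAlgebra.contractLeft_ι_mul, CliffordAlgebra.contractLeft_ι]
    rw [neg_smul, one_smul, neg_mul, sub_eq_add_neg, Algebra.smul_def]
  | mul a c ha hc =>
    rw [mul_assoc, ha, hc, ha, map_mul]
    noncomm_ring
  | add a c ha hc => rw [add_mul, map_add, ha, hc, map_add, map_add]; noncomm_ring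

lemma contractLeft_map (f : V →ₗ[ℂ] W) (θ : Module.Dual ℂ W) (a : ExteriorAlgebra ℂ V) :
    CliffordAlgebra.contractLeft θ (ExteriorAlgebra.map f a) =
      ExteriorAlgebra.map f (CliffordAlgebra.contractLeft (θ.comp f) a) := by
  induction a using ExteriorAlgebra.induction with
  | algebraMap c =>
    rw [AlgHom.commutes, CliffordAlgebra.contractLeft_algebraMap,
      CliffordAlgebra.contractLeft_algebraMap, map_zero]
  | ι w =>
    rw [ExteriorAlgebra.map_apply_ι, CliffordAlgebra.contractLeft_ι,
      CliffordAlgebra.contractLeft_ι, AlgHom.commutes]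
    rfl
  | mul a b ha hb =>
    rw [map_mul, contractLeft_mul, ha, hb, contractLeft_mul, map_add, map_mul, map_mul, map_scal]
  | add a b ha hb => rw [map_add, map_add, ha, hb, map_add, map_add]

/-- Naturality of contraction for the map `t • id` on covectors, under which `θ` pulls back to `t •
θ`: contraction lowers the degree by one. -/
lemma contractLeft_scal (θ : Module.Dual ℂ V) (t : ℂ) (a : ExteriorAlgebra ℂ V) :
    CliffordAlgebra.contractLeft θ (scal t a) =
      t • scal t (CliffordAlgebra.contractLeft θ a) := by
  have h : θ.comp (t • LinearMap.id) = t • θ := by ext; simp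
  rw [scal, contractLeft_map, h, map_smul, LinearMap.smul_apply, map_smul]

lemma contractLeft_scal_neg (θ : Module.Dual ℂ V) (a : ExteriorAlgebra ℂ V) :
    CliffordAlgebra.contractLeft θ (scal (-1) a) =
      -scal (-1) (CliffordAlgebra.contractLeft θ a) := by
  rw [contractLeft_scal, neg_smul, one_smul]

variable (V) in
/-- The opposite exterior algebra with complex conjugated scalar multiplication. -/
def ConjOp : Type _ := (ExteriorAlgebra ℂ V)ᵐᵒᵖ

instance : Ring (ConjOp V) := inferInstanceAs (Ring (ExteriorAlgebra ℂ V)ᵐᵒᵖ)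

instance : Algebra ℂ (ConjOp V) :=
  RingHom.toAlgebra' ((algebraMap ℂ (ExteriorAlgebra ℂ V)ᵐᵒᵖ).comp (starRingEnd ℂ))
    fun c x => Algebra.commutes (A := (ExteriorAlgebra ℂ V)ᵐᵒᵖ) (conj c) x

/-- The conjugate linear anti-automorphism of the exterior algebra that extends a conjugation of
the module. -/
def extStar (c : V →ₛₗ[starRingEnd ℂ] V) (a : ExteriorAlgebra ℂ V) : ExteriorAlgebra ℂ V :=
  -- A conjugate-linear anti-homomorphism is an ordinary algebra homomorphism into the opposite
  -- algebra with conjugated scalars, so the universal property of the exterior algebra applies.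
  MulOpposite.unop (ExteriorAlgebra.lift ℂ (A := ConjOp V)
    ⟨{ toFun := fun v => (MulOpposite.op (ExteriorAlgebra.ι ℂ (c v)) : (ExteriorAlgebra ℂ V)ᵐᵒᵖ)
       map_add' := fun v w => by rw [map_add, map_add]; rfl
       map_smul' := fun z v => by
        change (MulOpposite.op (ExteriorAlgebra.ι ℂ (c (z • v))) : (ExteriorAlgebra ℂ V)ᵐᵒᵖ) =
          algebraMap ℂ (ExteriorAlgebra ℂ V)ᵐᵒᵖ (conj z) *
            MulOpposite.op (ExteriorAlgebra.ι ℂ (c v))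
        rw [map_smulₛₗ, map_smul, MulOpposite.op_smul, Algebra.smul_def] },
      fun v => by
        change (MulOpposite.op (ExteriorAlgebra.ι ℂ (c v)) *
          MulOpposite.op (ExteriorAlgebra.ι ℂ (c v)) : (ExteriorAlgebra ℂ V)ᵐᵒᵖ) = 0
        rw [← MulOpposite.op_mul, ExteriorAlgebra.ι_sq_zero, MulOpposite.op_zero]⟩ a)

variable (c : V →ₛₗ[starRingEnd ℂ] V)

lemma extStar_algebraMap (z : ℂ) :
    extStar c (algebraMap ℂ _ z) = algebraMap ℂ _ (conj z) := by
  unfold extStar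
  rw [AlgHom.commutes]
  rfl

lemma extStar_ι (v : V) :
    extStar c (ExteriorAlgebra.ι ℂ v) = ExteriorAlgebra.ι ℂ (c v) := by
  unfold extStar
  rw [ExteriorAlgebra.lift_ι_apply]
  rfl

lemma extStar_add (a b : ExteriorAlgebra ℂ V) :
    extStar c (a + b) = extStar c a + extStar c b := by
  unfold extStar
  rw [map_add]
  rfl

lemma extStar_mul (a b : ExteriorAlgebra ℂ V) :
    extStar c (a * b) = extStar c b * extStar c a := by
  unfold extStar
  rw [map_mul]
  rfl

lemma extStar_smul (z : ℂ) (a : ExteriorAlgebra ℂ V) :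
    extStar c (z • a) = conj z • extStar c a := by
  rw [Algebra.smul_def, extStar_mul, extStar_algebraMap, ← Algebra.commutes, Algebra.smul_def]

lemma extStar_extStar (hc : ∀ v, c (c v) = v) (a : ExteriorAlgebra ℂ V) :
    extStar c (extStar c a) = a := by
  induction a using ExteriorAlgebra.induction with
  | algebraMap z => rw [extStar_algebraMap, extStar_algebraMap, Complex.conj_conj]
  | ι w => rw [extStar_ι, extStar_ι, hc]
  | mul a b ha hb => rw [extStar_mul, extStar_mul, ha, hb]
  | add a b ha hb => rw [extStar_add, extStar_add, ha, hb]

lemma map_extStar (c' : W →ₛₗ[starRingEnd ℂ] W) (f : V →ₗ[ℂ] W) (h : ∀ v, f (c v) = c' (f v))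
    (a : ExteriorAlgebra ℂ V) :
    ExteriorAlgebra.map f (extStar c a) = extStar c' (ExteriorAlgebra.map f a) := by
  induction a using ExteriorAlgebra.induction with
  | algebraMap z => rw [extStar_algebraMap, AlgHom.commutes, AlgHom.commutes, extStar_algebraMap]
  | ι w => rw [extStar_ι, ExteriorAlgebra.map_apply_ι, ExteriorAlgebra.map_apply_ι, extStar_ι, h]
  | mul a b ha hb => rw [extStar_mul, map_mul, map_mul, extStar_mul, ha, hb]
  | add a b ha hb => rw [extStar_add, map_add, map_add, extStar_add, ha, hb]

end Ext

/-- Complex conjugation of complex-valued covectors. -/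
def covConj (E : Type*) [AddCommGroup E] [Module ℝ E] [TopologicalSpace E] :
    (E →L[ℝ] ℂ) →ₛₗ[starRingEnd ℂ] (E →L[ℝ] ℂ) where
  toFun ξ := (Complex.conjCLE : ℂ →L[ℝ] ℂ).comp ξ
  map_add' ξ ζ := by ext; simp
  map_smul' z ξ := by ext; simp

lemma covConj_covConj {E : Type*} [AddCommGroup E] [Module ℝ E] [TopologicalSpace E]
    (ξ : E →L[ℝ] ℂ) : covConj E (covConj E ξ) = ξ := by
  ext; simp [covConj]

lemma covPull_covConj {E F : Type*} [AddCommGroup E] [Module ℝ E] [TopologicalSpace E]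
    [AddCommGroup F] [Module ℝ F] [TopologicalSpace F] (A : E →L[ℝ] F) (ξ : F →L[ℝ] ℂ) :
    covPull A (covConj F ξ) = covConj E (covPull A ξ) := rfl

lemma covPull_comp {E F G : Type*} [AddCommGroup E] [Module ℝ E] [TopologicalSpace E]
    [AddCommGroup F] [Module ℝ F] [TopologicalSpace F] [AddCommGroup G] [Module ℝ G]
    [TopologicalSpace G] (A : E →L[ℝ] F) (B : F →L[ℝ] G) :
    (covPull A).comp (covPull B) = covPull (B.comp A) := rfl

lemma evalAt_comp_covPull {E F : Type*} [AddCommGroup E] [Module ℝ E] [TopologicalSpace E]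
    [AddCommGroup F] [Module ℝ F] [TopologicalSpace F] (A : E →L[ℝ] F) (v : E) :
    (evalAt v).comp (covPull A) = evalAt (A v) := rfl

/-! ### The exterior algebra of the covectors of `ℝ^D` -/

section Top

variable {D : ℕ}

/-- The exterior algebra of the complex-valued covectors of `ℝ^D`. -/
abbrev ExtCov (D : ℕ) : Type := ExteriorAlgebra ℂ (Eucl D →L[ℝ] ℂ)

/-- Degrees are detected as eigenvalues of `scal`: `dx^S` is an eigenvector, by multilinearity of
the wedge product. -/
lemma scal_dxS (t : ℂ) (S : Finset (Fin D)) : scal t (dxS D S) = t ^ S.card • dxS D S := by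
  rw [dxS, ExteriorAlgebra.basis_apply, scal,
    ExteriorAlgebra.map_apply_ιMulti]
  have := (ExteriorAlgebra.ιMulti ℂ S.card (M := Eucl D →L[ℝ] ℂ)).toMultilinearMap.map_smul_univ
    (fun _ => t)
  simp only [Finset.prod_const, Finset.card_univ, Fintype.card_fin] at this
  exact this _

lemma repr_scal (t : ℂ) (a : ExtCov D) (S : Finset (Fin D)) :
    (dxS D).repr (scal t a) S = t ^ S.card * (dxS D).repr a S := by
  conv_lhs => rw [← (dxS D).sum_repr a]
  simp only [map_sum, map_smul, scal_dxS, Finsupp.coe_finsetSum, Finset.sum_apply, Finsupp.smul_apply,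
    Module.Basis.repr_self, smul_eq_mul]
  rw [Finset.sum_eq_single S]
  · simp [mul_comm]
  · intro T _ hT
    simp [hT]
  · simp

lemma dxS_univ : dxS D Finset.univ = ExteriorAlgebra.ιMulti ℂ D (dx D) := by
  rw [dxS, ExteriorAlgebra.basis_apply_ofCard (dx D) (n := D) (by simp)]
  -- The only order embedding of `Fin D` into itself is the identity.
  suffices h : ∀ f : Fin D ↪o Fin D, (f : Fin D → Fin D) = id by
    rw [ExteriorAlgebra.ιMulti_family, h]
    rfl
  intro f
  rw [← StrictMono.range_inj f.strictMono strictMono_id]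
  rw [Set.range_id, (Finite.injective_iff_surjective.1 f.injective).range_eq]

/-- Being homogeneous of degree `k` is expressed through the single scalar `2`; its powers are
pairwise distinct, so one eigenvalue determines the degree. -/
lemma repr_eq_zero_of_scal {a : ExtCov D} {k : ℕ} (ha : scal 2 a = (2 : ℂ) ^ k • a)
    {S : Finset (Fin D)} (hS : S.card ≠ k) : (dxS D).repr a S = 0 := by
  have h := congrArg (fun b => (dxS D).repr b S) ha
  simp only [repr_scal, map_smul, Finsupp.smul_apply, smul_eq_mul] at h
  by_contra h0
  have h2 := mul_right_cancel₀ h0 h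
  have h3 : (2 : ℕ) ^ S.card = 2 ^ k := by exact_mod_cast h2
  exact hS (Nat.pow_right_injective le_rfl h3)

lemma eq_topCoeff_smul {a : ExtCov D} (ha : scal 2 a = (2 : ℂ) ^ D • a) :
    a = topCoeff a • dxS D Finset.univ := by
  conv_lhs => rw [← (dxS D).sum_repr a]
  rw [Finset.sum_eq_single Finset.univ]
  · rfl
  · intro S _ hS
    rw [repr_eq_zero_of_scal ha, zero_smul]
    intro h
    exact hS (Finset.card_eq_iff_eq_univ S |>.1 (by simpa using h))
  · simp

lemma topCoeff_eq_zero_of_scal {a : ExtCov D} {k : ℕ} (ha : scal 2 a = (2 : ℂ) ^ k • a)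
    (hk : D ≠ k) : topCoeff a = 0 :=
  repr_eq_zero_of_scal ha (by simpa using hk)

/-- `topCoeff` as a linear map. -/
def topCoeffL (D : ℕ) : ExtCov D →ₗ[ℂ] ℂ := (dxS D).coord Finset.univ

lemma topCoeffL_apply (a : ExtCov D) : topCoeffL D a = topCoeff a := rfl

lemma topCoeff_dxS_univ : topCoeff (dxS D Finset.univ) = 1 := by
  simp [topCoeff]

lemma card_ne_of_ne_univ {S : Finset (Fin D)} (hS : S ≠ Finset.univ) : D ≠ S.card := by
  intro h
  exact hS (Finset.card_eq_iff_eq_univ S |>.1 (by simpa using h.symm))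

lemma topCoeff_dxS {S : Finset (Fin D)} (hS : S ≠ Finset.univ) : topCoeff (dxS D S) = 0 :=
  topCoeff_eq_zero_of_scal (scal_dxS 2 S) (card_ne_of_ne_univ hS)

/-- Two linear maps to `ℂ` agree if they agree on the basis `dx^S`. -/
lemma linearMap_ext_dxS {f g : ExtCov D →ₗ[ℂ] ℂ} (h : ∀ S, f (dxS D S) = g (dxS D S))
    (a : ExtCov D) : f a = g a := by
  rw [(dxS D).ext h]

/-- On the top basis vector this is the description of an alternating `D`-form as a multiple of the
determinant. On the other `dx^S` both sides vanish, because induced maps preserve degrees. -/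
lemma topCoeff_map (f : (Eucl D →L[ℝ] ℂ) →ₗ[ℂ] (Eucl D →L[ℝ] ℂ)) (a : ExtCov D) :
    topCoeff (ExteriorAlgebra.map f a) = LinearMap.det f * topCoeff a := by
  refine linearMap_ext_dxS (f := (topCoeffL D).comp (ExteriorAlgebra.map f).toLinearMap)
    (g := LinearMap.det f • topCoeffL D) (fun S => ?_) a
  simp only [LinearMap.comp_apply, AlgHom.toLinearMap_apply, LinearMap.smul_apply,
    topCoeffL_apply, smul_eq_mul]
  by_cases hS : S = Finset.univ
  · subst hS
    rw [topCoeff_dxS_univ, mul_one, dxS_univ, ExteriorAlgebra.map_apply_ιMulti]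
    have h := ((topCoeffL D).compAlternatingMap
      (ExteriorAlgebra.ιMulti ℂ D)).eq_smul_basis_det (dx D)
    have h1 := congrArg (fun F => F (f ∘ dx D)) h
    simp only [LinearMap.compAlternatingMap_apply, AlternatingMap.smul_apply,
      Module.Basis.det_comp, Module.Basis.det_self, ← dxS_univ, topCoeffL_apply,
      topCoeff_dxS_univ, smul_eq_mul, mul_one, one_mul] at h1
    exact h1
  · rw [topCoeff_dxS hS, mul_zero]
    refine topCoeff_eq_zero_of_scal (k := S.card) ?_ (card_ne_of_ne_univ hS)
    rw [← map_scal, scal_dxS, map_smul]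

/-- The contraction of a form of degree at most `D` has degree less than `D`. Degree zero is treated
separately, as contraction kills it. -/
lemma topCoeff_contractLeft (θ : Module.Dual ℂ (Eucl D →L[ℝ] ℂ)) (a : ExtCov D) :
    topCoeff (CliffordAlgebra.contractLeft θ a) = 0 := by
  refine linearMap_ext_dxS (f := (topCoeffL D).comp (CliffordAlgebra.contractLeft θ))
    (g := 0) (fun S => ?_) a
  simp only [LinearMap.comp_apply, LinearMap.zero_apply, topCoeffL_apply]
  have h2 : scal 2 (CliffordAlgebra.contractLeft θ (dxS D S)) =
      ((2 : ℂ)⁻¹ * 2 ^ S.card) • CliffordAlgebra.contractLeft θ (dxS D S) := by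
    have h := contractLeft_scal θ 2 (dxS D S)
    rw [scal_dxS, map_smul] at h
    rw [mul_smul, h, smul_smul]
    norm_num
  rcases Nat.eq_zero_or_pos S.card with h0 | h0
  · rw [Finset.card_eq_zero] at h0
    subst h0
    have : dxS D ∅ = 1 := by
      rw [dxS, ExteriorAlgebra.basis_apply_ofCard (dx D) (n := 0) (by simp)]
      simp
    rw [this, CliffordAlgebra.contractLeft_one]
    simp [topCoeff]
  · obtain ⟨k, hk⟩ := Nat.exists_eq_succ_of_ne_zero h0.ne'
    rw [hk, pow_succ', inv_mul_cancel_left₀ two_ne_zero] at h2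
    refine topCoeff_eq_zero_of_scal h2 ?_
    have := S.card_le_univ
    simp only [Fintype.card_fin] at this
    omega

lemma dx_repr (ξ : Eucl D →L[ℝ] ℂ) (i : Fin D) : (dx D).repr ξ i = ξ (coordVec D i) := rfl

lemma dx_apply (i : Fin D) (v : Eucl D) : dx D i v = (v i : ℂ) := by
  have : (dx D i : Eucl D →L[ℝ] ℂ) = Complex.ofRealCLM.comp (EuclideanSpace.proj i) := by
    apply (dx D).repr.injective
    rw [Module.Basis.repr_self]
    ext j
    rw [dx_repr]
    simp [Finsupp.single_apply, apply_ite, eq_comm]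
  rw [this]
  simp

/-- In the basis `dx^i` the matrix of the pullback is the transpose of the matrix of `A`, with real
entries read as complex ones. -/
lemma det_covPull (A : Eucl D →L[ℝ] Eucl D) :
    LinearMap.det (covPull A) = ((A.det : ℝ) : ℂ) := by
  rw [← LinearMap.det_toMatrix (dx D), ContinuousLinearMap.det,
    ← LinearMap.det_toMatrix (EuclideanSpace.basisFun (Fin D) ℝ).toBasis]
  rw [← Matrix.det_transpose]
  refine Eq.trans ?_ (RingHom.map_det Complex.ofRealHom _).symm
  congr 1
  ext i j
  simp only [Matrix.transpose_apply, LinearMap.toMatrix_apply, dx_repr]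
  exact dx_apply i _

lemma covConj_dx (i : Fin D) : covConj _ (dx D i) = dx D i := by
  ext v
  simp [covConj, dx_apply]

lemma extStar_scal {V : Type*} [AddCommGroup V] [Module ℂ V] (c : V →ₛₗ[starRingEnd ℂ] V) (t : ℂ)
    (a : ExteriorAlgebra ℂ V) : extStar c (scal t a) = scal (conj t) (extStar c a) := by
  induction a using ExteriorAlgebra.induction with
  | algebraMap z => rw [scal_algebraMap, extStar_algebraMap, scal_algebraMap]
  | ι w => rw [scal_ι, extStar_smul, extStar_ι, scal_ι]
  | mul a b ha hb => rw [map_mul, extStar_mul, extStar_mul, map_mul, ha, hb]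
  | add a b ha hb => rw [map_add, extStar_add, extStar_add, map_add, ha, hb]

/-- `extStar` is conjugate-linear and preserves degrees, so only the top basis vector contributes,
through its own sign `ε`. -/
lemma topCoeff_extStar {ε : ℂ}
    (hε : extStar (covConj (Eucl D)) (dxS D Finset.univ) = ε • dxS D Finset.univ)
    (a : ExtCov D) : topCoeff (extStar (covConj _) a) = ε * conj (topCoeff a) := by
  have h1 : ∀ a : ExtCov D, extStar (covConj _) a =
      ∑ S, conj ((dxS D).repr a S) • extStar (covConj _) (dxS D S) := by
    intro a
    let F : ExtCov D →+ ExtCov D := ⟨⟨extStar (covConj _), by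
      rw [← zero_smul ℂ (0 : ExtCov D), extStar_smul]; simp⟩, extStar_add _⟩
    change F a = _
    conv_lhs => rw [← (dxS D).sum_repr a, map_sum]
    exact Finset.sum_congr rfl fun S _ => extStar_smul _ _ _
  rw [h1, ← topCoeffL_apply, map_sum, Finset.sum_eq_single Finset.univ]
  · rw [hε, map_smul, map_smul, topCoeffL_apply, topCoeff_dxS_univ, smul_eq_mul, smul_eq_mul,
      mul_one, mul_comm]
    rfl
  · intro S _ hS
    rw [map_smul, topCoeffL_apply, topCoeff_eq_zero_of_scal (k := S.card) _
      (card_ne_of_ne_univ hS), smul_zero]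
    have := extStar_scal (covConj (Eucl D)) 2 (dxS D S)
    rw [scal_dxS, extStar_smul] at this
    rw [map_pow, map_ofNat] at this
    exact this.symm
  · simp

/-- Reversing `D` real covectors gives the sign `(-1)^(D(D-1)/2)`: minus for `D = 2`, and plus for
`D = 4` in the next lemma. -/
lemma extStar_dxS_two : extStar (covConj (Eucl 2)) (dxS 2 Finset.univ) =
    (-1 : ℂ) • dxS 2 Finset.univ := by
  rw [dxS_univ]
  simp only [ExteriorAlgebra.ιMulti_succ_apply, ExteriorAlgebra.ιMulti_zero_apply, mul_one,
    extStar_mul, extStar_ι, Matrix.vecTail, Function.comp, covConj_dx]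
  rw [ι_mul_eq, scal_ι]
  simp

lemma extStar_dxS_four : extStar (covConj (Eucl 4)) (dxS 4 Finset.univ) =
    (1 : ℂ) • dxS 4 Finset.univ := by
  rw [dxS_univ]
  simp only [ExteriorAlgebra.ιMulti_succ_apply, ExteriorAlgebra.ιMulti_zero_apply, mul_one,
    extStar_mul, extStar_ι, Matrix.vecTail, Function.comp, covConj_dx]
  have hswap : ∀ i j, ExteriorAlgebra.ι ℂ (dx 4 i) * ExteriorAlgebra.ι ℂ (dx 4 j) =
      -(ExteriorAlgebra.ι ℂ (dx 4 j) * ExteriorAlgebra.ι ℂ (dx 4 i)) := fun i j => by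
    rw [ι_mul_eq, scal_ι]; simp
  have hev : ∀ i j, scal (-1) (ExteriorAlgebra.ι ℂ (dx 4 i) * ExteriorAlgebra.ι ℂ (dx 4 j)) =
      ExteriorAlgebra.ι ℂ (dx 4 i) * ExteriorAlgebra.ι ℂ (dx 4 j) := fun i j => by
    rw [map_mul, scal_ι, scal_ι]; simp
  rw [one_smul]
  change ExteriorAlgebra.ι ℂ (dx 4 3) * ExteriorAlgebra.ι ℂ (dx 4 2) * ExteriorAlgebra.ι ℂ (dx 4 1)
    * ExteriorAlgebra.ι ℂ (dx 4 0) = ExteriorAlgebra.ι ℂ (dx 4 0) * (ExteriorAlgebra.ι ℂ (dx 4 1) *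
      (ExteriorAlgebra.ι ℂ (dx 4 2) * ExteriorAlgebra.ι ℂ (dx 4 3)))
  rw [mul_assoc _ (ExteriorAlgebra.ι ℂ (dx 4 1)), hswap 3 2, hswap 1 0, neg_mul_neg,
    ← mul_comm_of_even (hev 2 3), mul_assoc]

end Top

/-! ### Calculus of forms on open subsets of `ℝ^D` -/

section LocalCalculus

variable {D : ℕ}

/-- The norm on the exterior algebra induced by the left regular representation. -/
instance : NormedRing (ExtCov D) :=
  -- The operator norm on matrices is submultiplicative, so the product rule for derivatives of maps
  -- into a normed ring becomes available for wedge products.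
  letI : NormedRing (Matrix (Finset (Fin D)) (Finset (Fin D)) ℂ) := Matrix.linftyOpNormedRing
  NormedRing.induced _ _ (Algebra.leftMulMatrix (dxS D)) (Algebra.leftMulMatrix_injective _)

instance : NormedAlgebra ℂ (ExtCov D) :=
  letI : NormedRing (Matrix (Finset (Fin D)) (Finset (Fin D)) ℂ) := Matrix.linftyOpNormedRing
  letI : NormedAlgebra ℂ (Matrix (Finset (Fin D)) (Finset (Fin D)) ℂ) :=
    Matrix.linftyOpNormedAlgebra
  NormedAlgebra.induced ℂ _ _ (Algebra.leftMulMatrix (dxS D))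

instance : FiniteDimensional ℂ (ExtCov D) := Module.Finite.of_basis (dxS D)

instance : FiniteDimensional ℂ (Eucl D →L[ℝ] ℂ) := Module.Finite.of_basis (dx D)

/-- Linear maps out of the exterior algebra are continuous. -/
def toCLMR {F : Type*} [NormedAddCommGroup F] [NormedSpace ℂ F] (f : ExtCov D →ₗ[ℂ] F) :
    ExtCov D →L[ℝ] F :=
  (LinearMap.toContinuousLinearMap f).restrictScalars ℝ

/-- `ι` as a continuous real linear map. -/
def ιCLM (D : ℕ) : (Eucl D →L[ℝ] ℂ) →L[ℝ] ExtCov D :=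
  (LinearMap.toContinuousLinearMap
    (ExteriorAlgebra.ι ℂ : (Eucl D →L[ℝ] ℂ) →ₗ[ℂ] ExtCov D)).restrictScalars ℝ

lemma ιCLM_apply (ξ : Eucl D →L[ℝ] ℂ) : ιCLM D ξ = ExteriorAlgebra.ι ℂ ξ := rfl

/-- `algebraMap` as a continuous real linear map. -/
def constCLM (D : ℕ) : ℂ →L[ℝ] ExtCov D :=
  (LinearMap.toContinuousLinearMap (Algebra.linearMap ℂ (ExtCov D))).restrictScalars ℝ

lemma constCLM_apply (z : ℂ) : constCLM D z = algebraMap ℂ _ z := rfl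

/-- Replaces the coordinatewise definition by the derivative of the algebra-valued function, so that
`d` can be differentiated through products and linear maps. -/
lemma extD_eq {g : Eucl D → ExtCov D} {y : Eucl D} (hg : DifferentiableAt ℝ g y) :
    extD g y = ∑ i, ExteriorAlgebra.ι ℂ (dx D i) * fderiv ℝ g y (coordVec D i) := by
  unfold extD
  refine Finset.sum_congr rfl fun i _ => ?_
  have h : ∀ S, fderiv ℝ (fun z => (dxS D).repr (g z) S) y (coordVec D i) =
      (dxS D).repr (fderiv ℝ g y (coordVec D i)) S := by
    intro S
    have := ((toCLMR ((dxS D).coord S)).hasFDerivAt.comp y hg.hasFDerivAt).fderiv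
    have h2 := congrArg (fun F => F (coordVec D i)) this
    exact h2
  simp only [h]
  conv_rhs => rw [← (dxS D).sum_repr (fderiv ℝ g y (coordVec D i)), Finset.mul_sum]
  simp only [mul_smul_comm]

lemma extD_congr {g h : Eucl D → ExtCov D} {y : Eucl D} (hgh : g =ᶠ[nhds y] h) :
    extD g y = extD h y := by
  unfold extD
  refine Finset.sum_congr rfl fun i _ => Finset.sum_congr rfl fun S _ => ?_
  have : (fun z => (dxS D).repr (g z) S) =ᶠ[nhds y] fun z => (dxS D).repr (h z) S :=
    hgh.mono fun z hz => by simp only [hz]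
  rw [this.fderiv_eq]

lemma extD_add {g h : Eucl D → ExtCov D} {y : Eucl D} (hg : DifferentiableAt ℝ g y)
    (hh : DifferentiableAt ℝ h y) : extD (g + h) y = extD g y + extD h y := by
  rw [extD_eq (hg.add hh), extD_eq hg, extD_eq hh, fderiv_add hg hh, ← Finset.sum_add_distrib]
  simp [mul_add]

/-- The sign of the graded Leibniz rule appears when `dx^i` is moved past `g` to reach the
derivative of `h`. -/
lemma extD_mul {g h : Eucl D → ExtCov D} {y : Eucl D} (hg : DifferentiableAt ℝ g y)
    (hh : DifferentiableAt ℝ h y) :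
    extD (g * h) y = extD g y * h y + scal (-1) (g y) * extD h y := by
  rw [extD_eq (hg.mul hh), extD_eq hg, extD_eq hh, fderiv_mul' hg hh, Finset.sum_mul,
    Finset.mul_sum, ← Finset.sum_add_distrib]
  refine Finset.sum_congr rfl fun i _ => ?_
  simp only [add_apply, smul_apply, smul_eq_mul,
    MulOpposite.smul_eq_mul_unop, MulOpposite.unop_op, mul_add]
  rw [← mul_assoc, ι_mul_eq, mul_assoc, mul_assoc, add_comm]

lemma extD_linear {g : Eucl D → ExtCov D} {y : Eucl D} (hg : DifferentiableAt ℝ g y)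
    (f : ExtCov D →ₗ[ℂ] ExtCov D) :
    extD (fun z => f (g z)) y =
      ∑ i, ExteriorAlgebra.ι ℂ (dx D i) * f (fderiv ℝ g y (coordVec D i)) := by
  have h : HasFDerivAt (fun z => f (g z)) ((toCLMR f).comp (fderiv ℝ g y)) y :=
    (toCLMR f).hasFDerivAt.comp y hg.hasFDerivAt
  rw [extD_eq h.differentiableAt, h.fderiv]
  rfl

lemma extD_smul {g : Eucl D → ExtCov D} {y : Eucl D} (hg : DifferentiableAt ℝ g y) (c : ℂ) :
    extD (fun z => c • g z) y = c • extD g y := by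
  have := extD_linear hg (c • LinearMap.id)
  simp only [LinearMap.smul_apply, LinearMap.id_apply, mul_smul_comm] at this
  rw [this, extD_eq hg, Finset.smul_sum]

lemma extD_scal {g : Eucl D → ExtCov D} {y : Eucl D} (hg : DifferentiableAt ℝ g y) (t : ℂ) :
    scal t (extD g y) = t • extD (fun z => scal t (g z)) y := by
  have := extD_linear hg (scal t).toLinearMap
  simp only [AlgHom.toLinearMap_apply] at this
  rw [this, extD_eq hg, Finset.smul_sum, map_sum]
  simp [scal_ι]

lemma sum_dx (ξ : Eucl D →L[ℝ] ℂ) : ∑ i, ξ (coordVec D i) • dx D i = ξ :=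
  (dx D).sum_repr ξ

lemma extD_function {f : Eucl D → ℂ} {y : Eucl D} (hf : DifferentiableAt ℝ f y) :
    extD (fun z => algebraMap ℂ (ExtCov D) (f z)) y = ExteriorAlgebra.ι ℂ (fderiv ℝ f y) := by
  have h : HasFDerivAt (fun z => algebraMap ℂ (ExtCov D) (f z))
      ((constCLM D).comp (fderiv ℝ f y)) y :=
    (constCLM D).hasFDerivAt.comp y hf.hasFDerivAt
  rw [extD_eq h.differentiableAt, h.fderiv]
  conv_rhs => rw [← sum_dx (fderiv ℝ f y), map_sum]
  refine Finset.sum_congr rfl fun i _ => ?_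
  rw [ContinuousLinearMap.comp_apply, constCLM_apply, ← Algebra.commutes, ← Algebra.smul_def,
    map_smul]

lemma extD_const (a : ExtCov D) (y : Eucl D) : extD (fun _ => a) y = 0 := by
  rw [extD_eq (differentiableAt_const _)]
  simp

/-- Exact one-forms are closed. -/
lemma extD_ι_fderiv {f : Eucl D → ℂ} {y : Eucl D} (hf : ContDiffAt ℝ 2 f y) :
    extD (fun z => ExteriorAlgebra.ι ℂ (fderiv ℝ f z)) y = 0 := by
  have hd : DifferentiableAt ℝ (fderiv ℝ f) y :=
    (hf.fderiv_right (m := 1) (by norm_num)).differentiableAt (by norm_num)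
  have h : HasFDerivAt (fun z => ExteriorAlgebra.ι ℂ (fderiv ℝ f z))
      ((ιCLM D).comp (fderiv ℝ (fderiv ℝ f) y)) y :=
    (ιCLM D).hasFDerivAt.comp y hd.hasFDerivAt
  have hs : IsSymmSndFDerivAt ℝ f y := hf.isSymmSndFDerivAt (by simp)
  rw [extD_eq h.differentiableAt, h.fderiv]
  have h1 : ∀ i, ExteriorAlgebra.ι ℂ (dx D i) *
      ((ιCLM D).comp (fderiv ℝ (fderiv ℝ f) y)) (coordVec D i) =
      ∑ j, fderiv ℝ (fderiv ℝ f) y (coordVec D i) (coordVec D j) •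
        (ExteriorAlgebra.ι ℂ (dx D i) * ExteriorAlgebra.ι ℂ (dx D j)) := by
    intro i
    rw [ContinuousLinearMap.comp_apply, ιCLM_apply,
      ← sum_dx (fderiv ℝ (fderiv ℝ f) y (coordVec D i)), map_sum, Finset.mul_sum]
    refine Finset.sum_congr rfl fun j _ => ?_
    rw [map_smul, mul_smul_comm, sum_dx]
  simp only [h1]
  set S := ∑ i, ∑ j, fderiv ℝ (fderiv ℝ f) y (coordVec D i) (coordVec D j) •
        (ExteriorAlgebra.ι ℂ (dx D i) * ExteriorAlgebra.ι ℂ (dx D j)) with hS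
  -- Second derivatives are symmetric in `i, j` while `dx^i ∧ dx^j` is antisymmetric; exchanging the
  -- two summation indices changes the sign.
  have h2 : S = -S := by
    conv_rhs => rw [hS, Finset.sum_comm]
    rw [hS, ← Finset.sum_neg_distrib]
    refine Finset.sum_congr rfl fun i _ => ?_
    rw [← Finset.sum_neg_distrib]
    refine Finset.sum_congr rfl fun j _ => ?_
    rw [hs, ι_mul_eq, scal_ι]
    simp
  have h3 : (2 : ℂ) • S = 0 := by
    rw [two_smul]
    nth_rewrite 1 [h2]
    exact neg_add_cancel S
  exact (smul_eq_zero.1 h3).resolve_left two_ne_zero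

variable {U : Set (Eucl D)}

lemma diffAt (hU : IsOpen U) {F : Type*} [NormedAddCommGroup F] [NormedSpace ℝ F]
    {g : Eucl D → F} (hg : ContDiffOn ℝ ∞ g U) {y : Eucl D} (hy : y ∈ U) :
    DifferentiableAt ℝ g y :=
  (hg.contDiffAt (hU.mem_nhds hy)).differentiableAt (by simp)

lemma contDiffOn_fderiv (hU : IsOpen U) {F : Type*} [NormedAddCommGroup F] [NormedSpace ℝ F]
    {g : Eucl D → F} (hg : ContDiffOn ℝ ∞ g U) : ContDiffOn ℝ ∞ (fderiv ℝ g) U :=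
  hg.fderiv_of_isOpen hU (by simp)

lemma contDiffOn_extD (hU : IsOpen U) {g : Eucl D → ExtCov D} (hg : ContDiffOn ℝ ∞ g U) :
    ContDiffOn ℝ ∞ (extD g) U := by
  have h : ContDiffOn ℝ ∞ (fun y => ∑ i, ExteriorAlgebra.ι ℂ (dx D i) *
      fderiv ℝ g y (coordVec D i)) U := by
    refine ContDiffOn.sum fun i _ => contDiffOn_const.mul ?_
    exact (contDiffOn_fderiv hU hg).clm_apply contDiffOn_const
  exact h.congr fun y hy => extD_eq (diffAt hU hg hy)

/-- Smooth forms are generated by smooth functions and constant one-forms. -/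
theorem form_induction {P : (Eucl D → ExtCov D) → Prop}
    (hfun : ∀ f : Eucl D → ℂ, ContDiffOn ℝ ∞ f U → P fun y => algebraMap ℂ _ (f y))
    (hι : ∀ ξ : Eucl D →L[ℝ] ℂ, P fun _ => ExteriorAlgebra.ι ℂ ξ)
    (hadd : ∀ g h, ContDiffOn ℝ ∞ g U → ContDiffOn ℝ ∞ h U → P g → P h → P (g + h))
    (hmul : ∀ g h, ContDiffOn ℝ ∞ g U → ContDiffOn ℝ ∞ h U → P g → P h → P (g * h))
    (g : Eucl D → ExtCov D) (hg : ContDiffOn ℝ ∞ g U) : P g := by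
  have hconst : ∀ a : ExtCov D, P fun _ => a := by
    intro a
    induction a using ExteriorAlgebra.induction with
    | algebraMap z => exact hfun _ contDiffOn_const
    | ι ξ => exact hι ξ
    | mul a b ha hb => exact hmul _ _ contDiffOn_const contDiffOn_const ha hb
    | add a b ha hb => exact hadd _ _ contDiffOn_const contDiffOn_const ha hb
  have hcoord : ∀ S, ContDiffOn ℝ ∞ (fun y => (dxS D).repr (g y) S) U := fun S =>
    (toCLMR ((dxS D).coord S)).contDiff.comp_contDiffOn hg
  have hterm : ∀ S, ContDiffOn ℝ ∞ (fun y => algebraMap ℂ (ExtCov D) ((dxS D).repr (g y) S)) U :=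
    fun S => (constCLM D).contDiff.comp_contDiffOn (hcoord S)
  have hsum : ∀ s : Finset (Finset (Fin D)),
      ContDiffOn ℝ ∞ (∑ S ∈ s, (fun y => algebraMap ℂ (ExtCov D) ((dxS D).repr (g y) S)) *
        fun _ => dxS D S) U ∧
      P (∑ S ∈ s, (fun y => algebraMap ℂ (ExtCov D) ((dxS D).repr (g y) S)) *
        fun _ => dxS D S) := by
    intro s
    induction s using Finset.induction_on with
    | empty =>
      rw [Finset.sum_empty]
      exact ⟨contDiffOn_const, hconst 0⟩
    | insert S s hS ih =>
      rw [Finset.sum_insert hS]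
      have h1 := (hterm S).mul (contDiffOn_const (c := dxS D S))
      exact ⟨h1.add ih.1, hadd _ _ h1 ih.1
        (hmul _ _ (hterm S) contDiffOn_const (hfun _ (hcoord S)) (hconst _)) ih.2⟩
  -- Constant forms are sums of products of constants and covectors, so the expansion of `g` in the
  -- basis `dx^S` with function coefficients exhibits it as generated.
  have hg' : g = ∑ S, (fun y => algebraMap ℂ (ExtCov D) ((dxS D).repr (g y) S)) *
      fun _ => dxS D S := by
    funext y
    conv_lhs => rw [← (dxS D).sum_repr (g y)]
    rw [Finset.sum_apply]
    refine Finset.sum_congr rfl fun S _ => ?_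
    rw [Pi.mul_apply, Algebra.smul_def]
  rw [hg']
  exact (hsum _).2

lemma contDiffOn_mul {g h : Eucl D → ExtCov D} (hg : ContDiffOn ℝ ∞ g U)
    (hh : ContDiffOn ℝ ∞ h U) : ContDiffOn ℝ ∞ (g * h) U := hg.mul hh

lemma contDiffOn_scal {g : Eucl D → ExtCov D} (hg : ContDiffOn ℝ ∞ g U) (t : ℂ) :
    ContDiffOn ℝ ∞ (fun y => scal t (g y)) U :=
  (toCLMR (scal t).toLinearMap).contDiff.comp_contDiffOn hg

lemma extD_congr_on (hU : IsOpen U) {g h : Eucl D → ExtCov D} (hgh : Set.EqOn g h U)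
    {y : Eucl D} (hy : y ∈ U) : extD g y = extD h y :=
  extD_congr (hgh.eventuallyEq_of_mem (hU.mem_nhds hy))

/-- The square of an antiderivation of odd degree is a derivation: the mixed terms for a product
cancel. It therefore suffices that `d(df) = 0` and that constant forms are closed. -/
lemma extD_extD (hU : IsOpen U) {g : Eucl D → ExtCov D} (hg : ContDiffOn ℝ ∞ g U) :
    ∀ y ∈ U, extD (extD g) y = 0 := by
  refine form_induction (P := fun g => ∀ y ∈ U, extD (extD g) y = 0) ?_ ?_ ?_ ?_ g hg
  · intro f hf y hy
    rw [extD_congr_on hU (h := fun z => ExteriorAlgebra.ι ℂ (fderiv ℝ f z))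
      (fun z hz => extD_function (diffAt hU hf hz)) hy]
    exact extD_ι_fderiv ((hf.contDiffAt (hU.mem_nhds hy)).of_le (by norm_cast))
  · intro ξ y _
    have : extD (fun _ => ExteriorAlgebra.ι ℂ ξ) = fun _ => (0 : ExtCov D) :=
      funext fun z => extD_const _ z
    rw [this, extD_const]
  · intro g h hg hh ihg ihh y hy
    have hdg := contDiffOn_extD hU hg
    have hdh := contDiffOn_extD hU hh
    rw [extD_congr_on hU (h := extD g + extD h)
      (fun z hz => extD_add (diffAt hU hg hz) (diffAt hU hh hz)) hy,
      extD_add (diffAt hU hdg hy) (diffAt hU hdh hy), ihg y hy, ihh y hy, add_zero]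
  · intro g h hg hh ihg ihh y hy
    have hdg := contDiffOn_extD hU hg
    have hdh := contDiffOn_extD hU hh
    have hsg := contDiffOn_scal hg (-1)
    rw [extD_congr_on hU (h := extD g * h + (fun z => scal (-1) (g z)) * extD h)
      (fun z hz => extD_mul (diffAt hU hg hz) (diffAt hU hh hz)) hy,
      extD_add (diffAt hU (contDiffOn_mul hdg hh) hy)
        (diffAt hU (contDiffOn_mul hsg hdh) hy),
      extD_mul (diffAt hU hdg hy) (diffAt hU hh hy), extD_mul (diffAt hU hsg hy)
        (diffAt hU hdh hy), ihg y hy, ihh y hy, extD_scal (diffAt hU hg hy)]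
    simp

/-- Pullback of a form on `ℝ^D` along a map. -/
def pull (φ : Eucl D → Eucl D) (g : Eucl D → ExtCov D) (y : Eucl D) : ExtCov D :=
  ExteriorAlgebra.map (covPull (fderiv ℝ φ y)) (g (φ y))

lemma pull_const_ι {φ : Eucl D → Eucl D} {y : Eucl D} (hφ : DifferentiableAt ℝ φ y)
    (ξ : Eucl D →L[ℝ] ℂ) :
    pull φ (fun _ => ExteriorAlgebra.ι ℂ ξ) y =
      ExteriorAlgebra.ι ℂ (fderiv ℝ (fun z => ξ (φ z)) y) := by
  rw [pull, ExteriorAlgebra.map_apply_ι]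
  congr 1
  exact (ξ.hasFDerivAt.comp y hφ.hasFDerivAt).fderiv.symm

lemma contDiffOn_pull (hU : IsOpen U) {U' : Set (Eucl D)} {φ : Eucl D → Eucl D}
    (hφ : ContDiffOn ℝ ∞ φ U) (hm : Set.MapsTo φ U U') {g : Eucl D → ExtCov D}
    (hg : ContDiffOn ℝ ∞ g U') : ContDiffOn ℝ ∞ (pull φ g) U := by
  refine form_induction (P := fun g => ContDiffOn ℝ ∞ (pull φ g) U) ?_ ?_ ?_ ?_ g hg
  · intro f hf
    refine ((constCLM D).contDiff.comp_contDiffOn (hf.comp hφ hm)).congr fun y _ => ?_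
    simp [pull, constCLM_apply]
  · intro ξ
    refine ((ιCLM D).contDiff.comp_contDiffOn (contDiffOn_fderiv hU
      (ξ.contDiff.comp_contDiffOn hφ))).congr fun y hy => ?_
    exact pull_const_ι (diffAt hU hφ hy) ξ
  · intro g h _ _ hg hh
    refine (hg.add hh).congr fun y _ => ?_
    simp [pull]
  · intro g h _ _ hg hh
    refine (hg.mul hh).congr fun y _ => ?_
    simp [pull]

/-- For functions this is the chain rule. The pullback of a constant covector `ξ` is the
differential of `ξ ∘ φ`, hence closed. Both sides obey the same graded Leibniz rule. -/
lemma extD_pull (hU : IsOpen U) {U' : Set (Eucl D)} (hU' : IsOpen U') {φ : Eucl D → Eucl D}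
    (hφ : ContDiffOn ℝ ∞ φ U) (hm : Set.MapsTo φ U U') {g : Eucl D → ExtCov D}
    (hg : ContDiffOn ℝ ∞ g U') {y : Eucl D} (hy : y ∈ U) :
    extD (pull φ g) y = pull φ (extD g) y := by
  have hφy := diffAt hU hφ hy
  refine form_induction (P := fun g => extD (pull φ g) y = pull φ (extD g) y) ?_ ?_ ?_ ?_ g hg
  · intro f hf
    have h1 : pull φ (fun y => algebraMap ℂ (ExtCov D) (f y)) =
        fun y => algebraMap ℂ (ExtCov D) (f (φ y)) := by
      funext z
      simp [pull]
    have hfy := diffAt hU' hf (hm hy)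
    rw [h1, extD_function (f := fun z => f (φ z)) (hfy.comp y hφy), pull, extD_function hfy, ExteriorAlgebra.map_apply_ι]
    congr 1
    exact (hfy.hasFDerivAt.comp y hφy.hasFDerivAt).fderiv
  · intro ξ
    rw [pull, extD_const, map_zero, extD_congr_on hU (fun z hz => pull_const_ι
      (diffAt hU hφ hz) ξ) hy]
    refine extD_ι_fderiv (((ξ.contDiff.comp_contDiffOn hφ).contDiffAt
      (hU.mem_nhds hy)).of_le ?_)
    norm_cast
  · intro g h hg hh ihg ihh
    have h1 : pull φ (g + h) = pull φ g + pull φ h := by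
      funext z
      simp [pull]
    rw [h1, extD_add (diffAt hU (contDiffOn_pull hU hφ hm hg) hy)
      (diffAt hU (contDiffOn_pull hU hφ hm hh) hy), ihg, ihh, pull, pull, pull,
      extD_add (diffAt hU' hg (hm hy)) (diffAt hU' hh (hm hy)), map_add]
  · intro g h hg hh ihg ihh
    have h1 : pull φ (g * h) = pull φ g * pull φ h := by
      funext z
      simp [pull]
    rw [h1, extD_mul (diffAt hU (contDiffOn_pull hU hφ hm hg) hy)
      (diffAt hU (contDiffOn_pull hU hφ hm hh) hy), ihg, ihh]
    simp only [pull]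
    rw [extD_mul (diffAt hU' hg (hm hy)) (diffAt hU' hh (hm hy)), map_add, map_mul, map_mul,
      map_scal]

/-- Interior product with a vector field. -/
def con (X : Eucl D → Eucl D) (g : Eucl D → ExtCov D) (y : Eucl D) : ExtCov D :=
  CliffordAlgebra.contractLeft (evalAt (X y)) (g y)

lemma con_add (X : Eucl D → Eucl D) (g h : Eucl D → ExtCov D) :
    con X (g + h) = con X g + con X h := by
  funext y
  simp [con]

lemma con_mul (X : Eucl D → Eucl D) (g h : Eucl D → ExtCov D) :
    con X (g * h) = con X g * h + (fun y => scal (-1) (g y)) * con X h := by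
  funext y
  exact contractLeft_mul _ _ _

lemma con_function (X : Eucl D → Eucl D) (f : Eucl D → ℂ) :
    con X (fun y => algebraMap ℂ (ExtCov D) (f y)) = fun _ => 0 := by
  funext y
  exact CliffordAlgebra.contractLeft_algebraMap _ (evalAt (X y)) (f y)

lemma con_ι (X : Eucl D → Eucl D) (ξ : Eucl D → Eucl D →L[ℝ] ℂ) :
    con X (fun y => ExteriorAlgebra.ι ℂ (ξ y)) = fun y => algebraMap ℂ _ (ξ y (X y)) := by
  funext y
  exact CliffordAlgebra.contractLeft_ι _ (evalAt (X y)) (ξ y)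

lemma contDiffOn_con {X : Eucl D → Eucl D} (hX : ContDiffOn ℝ ∞ X U) {g : Eucl D → ExtCov D}
    (hg : ContDiffOn ℝ ∞ g U) : ContDiffOn ℝ ∞ (con X g) U := by
  refine form_induction (P := fun g => ContDiffOn ℝ ∞ (con X g) U) ?_ ?_ ?_ ?_ g hg
  · intro f _
    rw [con_function]
    exact contDiffOn_const
  · intro ξ
    rw [con_ι]
    exact (constCLM D).contDiff.comp_contDiffOn (ξ.contDiff.comp_contDiffOn hX)
  · intro g h _ _ hg hh
    rw [con_add]
    exact hg.add hh
  · intro g h hg' hh' hg hh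
    rw [con_mul]
    exact (hg.mul hh').add ((contDiffOn_scal hg' _).mul hh)

/-- Lie derivative of forms on `ℝ^D`. -/
def lieL (X : Eucl D → Eucl D) (g : Eucl D → ExtCov D) : Eucl D → ExtCov D :=
  extD (con X g) + con X (extD g)

lemma contDiffOn_lieL (hU : IsOpen U) {X : Eucl D → Eucl D} (hX : ContDiffOn ℝ ∞ X U)
    {g : Eucl D → ExtCov D} (hg : ContDiffOn ℝ ∞ g U) : ContDiffOn ℝ ∞ (lieL X g) U :=
  (contDiffOn_extD hU (contDiffOn_con hX hg)).add (contDiffOn_con hX (contDiffOn_extD hU hg))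

lemma lieL_congr (hU : IsOpen U) (X : Eucl D → Eucl D) {g h : Eucl D → ExtCov D}
    (hgh : Set.EqOn g h U) {y : Eucl D} (hy : y ∈ U) : lieL X g y = lieL X h y := by
  have h1 : Set.EqOn (con X g) (con X h) U := fun z hz => by rw [con, con, hgh hz]
  rw [lieL, lieL, Pi.add_apply, Pi.add_apply, extD_congr_on hU h1 hy, con, con,
    extD_congr_on hU hgh hy]

lemma lieL_add (hU : IsOpen U) {X : Eucl D → Eucl D} (hX : ContDiffOn ℝ ∞ X U)
    {g h : Eucl D → ExtCov D} (hg : ContDiffOn ℝ ∞ g U) (hh : ContDiffOn ℝ ∞ h U)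
    {y : Eucl D} (hy : y ∈ U) :
    lieL X (g + h) y = lieL X g y + lieL X h y := by
  simp only [lieL, Pi.add_apply, con_add]
  rw [extD_add (diffAt hU (contDiffOn_con hX hg) hy) (diffAt hU (contDiffOn_con hX hh) hy)]
  simp only [con]
  rw [extD_add (diffAt hU hg hy) (diffAt hU hh hy), map_add]
  abel

/-- By Cartan's formula the Lie derivative is the anticommutator of two antiderivations. The terms
that contain one derivative of each factor cancel, since both `d` and contraction anticommute with
the grading involution up to degree. -/
lemma lieL_mul (hU : IsOpen U) {X : Eucl D → Eucl D} (hX : ContDiffOn ℝ ∞ X U)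
    {g h : Eucl D → ExtCov D} (hg : ContDiffOn ℝ ∞ g U) (hh : ContDiffOn ℝ ∞ h U)
    {y : Eucl D} (hy : y ∈ U) :
    lieL X (g * h) y = lieL X g y * h y + g y * lieL X h y := by
  have hcg := contDiffOn_con hX hg
  have hch := contDiffOn_con hX hh
  have hsg := contDiffOn_scal hg (-1)
  simp only [lieL, Pi.add_apply, con_mul]
  rw [extD_add (diffAt hU (contDiffOn_mul hcg hh) hy)
      (diffAt hU (contDiffOn_mul hsg hch) hy),
    extD_mul (diffAt hU hcg hy) (diffAt hU hh hy), extD_mul (diffAt hU hsg hy) (diffAt hU hch hy)]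
  have h1 : con X (extD (g * h)) y =
      con X (extD g * h + (fun z => scal (-1) (g z)) * extD h) y := by
    rw [con, con, extD_mul (diffAt hU hg hy) (diffAt hU hh hy)]
    rfl
  have h2 : extD (fun z => scal (-1) (g z)) y = -scal (-1) (extD g y) := by
    rw [extD_scal (diffAt hU hg hy)]
    simp
  have h3 : con X (fun z => scal (-1) (g z)) y = -scal (-1) (con X g y) :=
    contractLeft_scal_neg _ _
  have h4 : ∀ a : ExtCov D, scal (-1) (scal (-1) a) = a := fun a => by
    induction a using ExteriorAlgebra.induction with
    | algebraMap c => rw [scal_algebraMap, scal_algebraMap]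
    | ι w => simp [scal_ι]
    | mul a b ha hb => rw [map_mul, map_mul, ha, hb]
    | add a b ha hb => rw [map_add, map_add, ha, hb]
  rw [h1, h2, con_add, con_mul, con_mul, Pi.add_apply, Pi.add_apply, Pi.add_apply]
  simp only [Pi.mul_apply, h3, h4]
  noncomm_ring

/-- Cartan's formula with `d² = 0` leaves `d i_X d` on both sides. -/
lemma lieL_extD (hU : IsOpen U) {X : Eucl D → Eucl D} (hX : ContDiffOn ℝ ∞ X U)
    {g : Eucl D → ExtCov D} (hg : ContDiffOn ℝ ∞ g U)
    {y : Eucl D} (hy : y ∈ U) :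
    lieL X (extD g) y = extD (lieL X g) y := by
  have hcg := contDiffOn_con hX hg
  have hdg := contDiffOn_extD hU hg
  have h0 : con X (extD (extD g)) y = 0 := by rw [con, extD_extD hU hg y hy, map_zero]
  rw [lieL, Pi.add_apply, h0, add_zero, lieL,
    extD_add (diffAt hU (contDiffOn_extD hU hcg) hy) (diffAt hU (contDiffOn_con hX hdg) hy),
    extD_extD hU hcg y hy, zero_add]

lemma lieL_function (hU : IsOpen U) (X : Eucl D → Eucl D) {f : Eucl D → ℂ}
    (hf : ContDiffOn ℝ ∞ f U) {y : Eucl D} (hy : y ∈ U) :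
    lieL X (fun z => algebraMap ℂ (ExtCov D) (f z)) y = algebraMap ℂ _ (fderiv ℝ f y (X y)) := by
  rw [lieL, Pi.add_apply, con_function, extD_const, zero_add, con,
    extD_function (diffAt hU hf hy)]
  exact CliffordAlgebra.contractLeft_ι _ (evalAt (X y)) _

lemma lieL_const_ι (hU : IsOpen U) {X : Eucl D → Eucl D} (hX : ContDiffOn ℝ ∞ X U)
    (ξ : Eucl D →L[ℝ] ℂ) {y : Eucl D} (hy : y ∈ U) :
    lieL X (fun _ => ExteriorAlgebra.ι ℂ ξ) y =
      ExteriorAlgebra.ι ℂ (ξ.comp (fderiv ℝ X y)) := by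
  have h1 : con X (extD fun _ => ExteriorAlgebra.ι ℂ ξ) y = 0 := by
    rw [con, extD_const, map_zero]
  have h2 := diffAt hU hX hy
  rw [lieL, Pi.add_apply, h1, add_zero, con_ι, extD_function (f := fun z => ξ (X z))
    (ξ.differentiableAt.comp y h2)]
  congr 1
  exact (ξ.hasFDerivAt.comp y h2.hasFDerivAt).fderiv

lemma contDiffOn_fderiv_apply (hU : IsOpen U) {X : Eucl D → Eucl D} (hX : ContDiffOn ℝ ∞ X U)
    {f : Eucl D → ℂ} (hf : ContDiffOn ℝ ∞ f U) :
    ContDiffOn ℝ ∞ (fun y => fderiv ℝ f y (X y)) U :=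
  (contDiffOn_fderiv hU hf).clm_apply hX

/-- Lie derivatives along commuting vector fields commute. -/
lemma lieL_comm (hU : IsOpen U) {X Y : Eucl D → Eucl D} (hX : ContDiffOn ℝ ∞ X U)
    (hY : ContDiffOn ℝ ∞ Y U) (hXY : ∀ y ∈ U, fderiv ℝ Y y (X y) = fderiv ℝ X y (Y y))
    {g : Eucl D → ExtCov D} (hg : ContDiffOn ℝ ∞ g U) :
    ∀ y ∈ U, lieL X (lieL Y g) y = lieL Y (lieL X g) y := by
  have hfun : ∀ f : Eucl D → ℂ, ContDiffOn ℝ ∞ f U → ∀ y ∈ U,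
      lieL X (lieL Y fun z => algebraMap ℂ (ExtCov D) (f z)) y =
        lieL Y (lieL X fun z => algebraMap ℂ (ExtCov D) (f z)) y := by
    intro f hf y hy
    rw [lieL_congr hU X (fun z hz => lieL_function hU Y hf hz) hy,
      lieL_congr hU Y (fun z hz => lieL_function hU X hf hz) hy,
      lieL_function hU X (contDiffOn_fderiv_apply hU hY hf) hy,
      lieL_function hU Y (contDiffOn_fderiv_apply hU hX hf) hy]
    congr 1
    have hd := (diffAt hU (contDiffOn_fderiv hU hf) hy).hasFDerivAt
    have hs : IsSymmSndFDerivAt ℝ f y :=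
      ((hf.contDiffAt (hU.mem_nhds hy)).of_le (by norm_cast : (2 : WithTop ℕ∞) ≤ ∞)).isSymmSndFDerivAt
        (by simp)
    -- Each iterated derivative of `f` is a second derivative plus a first derivative along the
    -- derivative of a field. The former agree by symmetry, the latter because the bracket vanishes.
    rw [(hd.clm_apply (diffAt hU hY hy).hasFDerivAt).fderiv,
      (hd.clm_apply (diffAt hU hX hy).hasFDerivAt).fderiv]
    simp only [add_apply, ContinuousLinearMap.comp_apply, ContinuousLinearMap.flip_apply]
    rw [hXY y hy, hs]
  refine form_induction (P := fun g => ∀ y ∈ U, lieL X (lieL Y g) y = lieL Y (lieL X g) y)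
    hfun ?_ ?_ ?_ g hg
  · intro ξ y hy
    -- A constant covector is the differential of the linear function it defines. As Lie derivatives
    -- commute with `d`, this case reduces to functions.
    have h1 : (fun _ => ExteriorAlgebra.ι ℂ ξ) =
        extD (fun z => algebraMap ℂ (ExtCov D) (ξ z)) := by
      funext z
      rw [extD_function ξ.differentiableAt, ξ.fderiv]
    have hξ : ContDiffOn ℝ ∞ (fun z => algebraMap ℂ (ExtCov D) (ξ z)) U :=
      (constCLM D).contDiff.comp_contDiffOn ξ.contDiff.contDiffOn
    rw [h1, lieL_congr hU X (fun z hz => lieL_extD hU hY hξ hz) hy,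
      lieL_congr hU Y (fun z hz => lieL_extD hU hX hξ hz) hy,
      lieL_extD hU hX (contDiffOn_lieL hU hY hξ) hy,
      lieL_extD hU hY (contDiffOn_lieL hU hX hξ) hy]
    exact extD_congr_on hU (hfun _ ξ.contDiff.contDiffOn) hy
  · intro g h hg hh ihg ihh y hy
    rw [lieL_congr hU X (h := lieL Y g + lieL Y h) (fun z hz => lieL_add hU hY hg hh hz) hy,
      lieL_congr hU Y (h := lieL X g + lieL X h) (fun z hz => lieL_add hU hX hg hh hz) hy,
      lieL_add hU hX (contDiffOn_lieL hU hY hg) (contDiffOn_lieL hU hY hh) hy,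
      lieL_add hU hY (contDiffOn_lieL hU hX hg) (contDiffOn_lieL hU hX hh) hy, ihg y hy, ihh y hy]
  · intro g h hg hh ihg ihh y hy
    have hXg := contDiffOn_lieL hU hX hg
    have hYg := contDiffOn_lieL hU hY hg
    have hXh := contDiffOn_lieL hU hX hh
    have hYh := contDiffOn_lieL hU hY hh
    rw [lieL_congr hU X (h := lieL Y g * h + g * lieL Y h)
        (fun z hz => lieL_mul hU hY hg hh hz) hy,
      lieL_congr hU Y (h := lieL X g * h + g * lieL X h)
        (fun z hz => lieL_mul hU hX hg hh hz) hy,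
      lieL_add hU hX (contDiffOn_mul hYg hh) (contDiffOn_mul hg hYh) hy,
      lieL_add hU hY (contDiffOn_mul hXg hh) (contDiffOn_mul hg hXh) hy,
      lieL_mul hU hX hYg hh hy, lieL_mul hU hX hg hYh hy,
      lieL_mul hU hY hXg hh hy, lieL_mul hU hY hg hXh hy, ihg y hy, ihh y hy]
    abel

lemma lieL_scal (hU : IsOpen U) {X : Eucl D → Eucl D} (hX : ContDiffOn ℝ ∞ X U) (t : ℂ)
    {g : Eucl D → ExtCov D} (hg : ContDiffOn ℝ ∞ g U) {y : Eucl D} (hy : y ∈ U) :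
    lieL X (fun z => scal t (g z)) y = scal t (lieL X g y) := by
  refine form_induction (P := fun g => lieL X (fun z => scal t (g z)) y = scal t (lieL X g y))
    ?_ ?_ ?_ ?_ g hg
  · intro f hf
    simp only [scal_algebraMap]
    rw [lieL_function hU X hf hy, scal_algebraMap]
  · intro ξ
    simp only [scal_ι, ← map_smul]
    rw [lieL_const_ι hU hX _ hy, lieL_const_ι hU hX _ hy, scal_ι, ← map_smul]
    rfl
  · intro g h hg hh ihg ihh
    simp only [Pi.add_apply, map_add]
    rw [← Pi.add_def, lieL_add hU hX (contDiffOn_scal hg t) (contDiffOn_scal hh t) hy, ihg, ihh,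
      lieL_add hU hX hg hh hy, map_add]
  · intro g h hg hh ihg ihh
    simp only [Pi.mul_apply, map_mul]
    rw [← Pi.mul_def, lieL_mul hU hX (contDiffOn_scal hg t) (contDiffOn_scal hh t) hy, ihg, ihh,
      lieL_mul hU hX hg hh hy, map_add, map_mul, map_mul]

/-- The conjugate linear anti-automorphism `extStar` as a continuous real linear map. -/
def starCLM (D : ℕ) : ExtCov D →L[ℝ] ExtCov D :=
  LinearMap.toContinuousLinearMap
    { toFun := extStar (covConj (Eucl D))
      map_add' := extStar_add _
      map_smul' := fun r a => by
        rw [← Complex.coe_smul, extStar_smul, Complex.conj_ofReal, Complex.coe_smul]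
        rfl }

lemma contDiffOn_extStar {g : Eucl D → ExtCov D} (hg : ContDiffOn ℝ ∞ g U) :
    ContDiffOn ℝ ∞ (fun y => extStar (covConj _) (g y)) U :=
  (starCLM D).contDiff.comp_contDiffOn hg

lemma fderiv_conj {f : Eucl D → ℂ} {y : Eucl D} (hf : DifferentiableAt ℝ f y) :
    fderiv ℝ (fun z => conj (f z)) y = covConj _ (fderiv ℝ f y) :=
  ((Complex.conjCLE : ℂ →L[ℝ] ℂ).hasFDerivAt.comp y hf.hasFDerivAt).fderiv

lemma contDiffOn_conj {f : Eucl D → ℂ} (hf : ContDiffOn ℝ ∞ f U) :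
    ContDiffOn ℝ ∞ (fun z => conj (f z)) U :=
  (Complex.conjCLE : ℂ →L[ℝ] ℂ).contDiff.comp_contDiffOn hf

/-- The vector field is real, so conjugation passes through its action on functions and covectors;
the reversal of products is harmless because the Lie derivative is a derivation without signs. -/
lemma lieL_extStar (hU : IsOpen U) {X : Eucl D → Eucl D} (hX : ContDiffOn ℝ ∞ X U)
    {g : Eucl D → ExtCov D} (hg : ContDiffOn ℝ ∞ g U) {y : Eucl D} (hy : y ∈ U) :
    lieL X (fun z => extStar (covConj _) (g z)) y = extStar (covConj _) (lieL X g y) := by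
  refine form_induction (P := fun g => lieL X (fun z => extStar (covConj _) (g z)) y =
    extStar (covConj _) (lieL X g y)) ?_ ?_ ?_ ?_ g hg
  · intro f hf
    simp only [extStar_algebraMap]
    rw [lieL_function hU X (contDiffOn_conj hf) hy, lieL_function hU X hf hy, extStar_algebraMap,
      fderiv_conj (diffAt hU hf hy)]
    rfl
  · intro ξ
    simp only [extStar_ι]
    rw [lieL_const_ι hU hX _ hy, lieL_const_ι hU hX _ hy, extStar_ι]
    rfl
  · intro g h hg hh ihg ihh
    simp only [Pi.add_apply, extStar_add]
    rw [← Pi.add_def, lieL_add hU hX (contDiffOn_extStar hg) (contDiffOn_extStar hh) hy, ihg, ihh,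
      lieL_add hU hX hg hh hy, extStar_add]
  · intro g h hg hh ihg ihh
    simp only [Pi.mul_apply, extStar_mul]
    rw [← Pi.mul_def, lieL_mul hU hX (contDiffOn_extStar hh) (contDiffOn_extStar hg) hy, ihg, ihh,
      lieL_mul hU hX hg hh hy, extStar_add, extStar_mul, extStar_mul, add_comm]

end LocalCalculus

/-! ### Smooth forms on a manifold -/

section Charts

variable {D : ℕ} {M : Type*} [TopologicalSpace M] [ChartedSpace (Eucl D) M]

/-- Derivative of the inverse of the preferred chart at `x`. -/
def dsy (x : M) (y : Eucl D) : Eucl D →L[ℝ] Eucl D :=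
  mfderiv 𝓘(ℝ, Eucl D) (𝓡 D) (extChartAt (𝓡 D) x).symm y

/-- Derivative of the preferred chart at `x`. -/
def dch (x p : M) : Eucl D →L[ℝ] Eucl D :=
  mfderiv (𝓡 D) 𝓘(ℝ, Eucl D) (extChartAt (𝓡 D) x) p

/-- A form as a function, using the model space as the tangent space. -/
def ev (η : Form D M) : M → ExtCov D := η

/-- Transition map between preferred charts. -/
def chg (x x' : M) : Eucl D → Eucl D := extChartAt (𝓡 D) x' ∘ (extChartAt (𝓡 D) x).symm

variable (D) in
/-- Domain of the transition map between preferred charts. -/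
def ov (x x' : M) : Set (Eucl D) :=
  (extChartAt (𝓡 D) x).target ∩ (extChartAt (𝓡 D) x).symm ⁻¹' (extChartAt (𝓡 D) x').source

lemma localForm_eq (x : M) (η : Form D M) (y : Eucl D) :
    localForm x η y =
      ExteriorAlgebra.map (covPull (dsy x y)) (ev η ((extChartAt (𝓡 D) x).symm y)) := rfl

lemma isOpen_target (x : M) : IsOpen (extChartAt (𝓡 D) x).target := isOpen_extChartAt_target x

lemma isOpen_ov (x x' : M) : IsOpen (ov D x x') :=
  (continuousOn_extChartAt_symm x).isOpen_inter_preimage (isOpen_target x)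
    (isOpen_extChartAt_source x')

variable [IsManifold (𝓡 D) ∞ M]

instance : IsManifold (𝓡 D) 1 M := IsManifold.of_le (n := ∞) (by norm_cast)

lemma range_model : Set.range (𝓡 D) = Set.univ := by simp

lemma dsy_comp_dch {x p : M} (hp : p ∈ (extChartAt (𝓡 D) x).source) :
    (dsy x (extChartAt (𝓡 D) x p)).comp (dch x p) = ContinuousLinearMap.id ℝ _ := by
  have := mfderivWithin_extChartAt_symm_comp_mfderiv_extChartAt' (I := 𝓡 D) hp
  rw [range_model, mfderivWithin_univ] at this
  exact this

lemma mdifferentiableAt_symm {x : M} {y : Eucl D} (hy : y ∈ (extChartAt (𝓡 D) x).target) :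
    MDifferentiableAt 𝓘(ℝ, Eucl D) (𝓡 D) (extChartAt (𝓡 D) x).symm y := by
  have := mdifferentiableWithinAt_extChartAt_symm (I := 𝓡 D) hy
  rwa [range_model, mdifferentiableWithinAt_univ] at this

lemma contMDiffAt_symm {x : M} {y : Eucl D} (hy : y ∈ (extChartAt (𝓡 D) x).target) :
    ContMDiffAt 𝓘(ℝ, Eucl D) (𝓡 D) ∞ (extChartAt (𝓡 D) x).symm y :=
  (contMDiffOn_extChartAt_symm x).contMDiffAt ((isOpen_target x).mem_nhds hy)

lemma fderiv_chg {x x' : M} {y : Eucl D} (hy : y ∈ ov D x x') :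
    fderiv ℝ (chg x x') y = (dch x' ((extChartAt (𝓡 D) x).symm y)).comp (dsy x y) := by
  have h1 : (extChartAt (𝓡 D) x).symm y ∈ (chartAt (Eucl D) x').source := by
    rw [← extChartAt_source (𝓡 D)]
    exact hy.2
  have := mfderiv_comp y (mdifferentiableAt_extChartAt (I := 𝓡 D) h1)
    (mdifferentiableAt_symm hy.1)
  rw [← mfderiv_eq_fderiv]
  exact this

lemma dsy_chg {x x' : M} {y : Eucl D} (hy : y ∈ ov D x x') :
    dsy x y = (dsy x' (chg x x' y)).comp (fderiv ℝ (chg x x') y) := by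
  rw [fderiv_chg hy, ← ContinuousLinearMap.comp_assoc]
  have := dsy_comp_dch hy.2
  change _ = ((dsy x' (extChartAt (𝓡 D) x' ((extChartAt (𝓡 D) x).symm y))).comp _).comp _
  rw [this, ContinuousLinearMap.id_comp]

lemma contDiffOn_chg (x x' : M) : ContDiffOn ℝ ∞ (chg x x') (ov D x x') := by
  rw [← contMDiffOn_iff_contDiffOn]
  intro y hy
  have h1 : (extChartAt (𝓡 D) x).symm y ∈ (chartAt (Eucl D) x').source := by
    rw [← extChartAt_source (𝓡 D)]
    exact hy.2
  exact ((contMDiffAt_extChartAt' (I := 𝓡 D) h1).comp y (contMDiffAt_symm hy.1)).contMDiffWithinAt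

lemma mapsTo_chg (x x' : M) : Set.MapsTo (chg x x') (ov D x x') (extChartAt (𝓡 D) x').target :=
  fun _ hy => (extChartAt (𝓡 D) x').map_source hy.2

lemma symm_chg {x x' : M} {y : Eucl D} (hy : y ∈ ov D x x') :
    (extChartAt (𝓡 D) x').symm (chg x x' y) = (extChartAt (𝓡 D) x).symm y :=
  (extChartAt (𝓡 D) x').left_inv hy.2

lemma localForm_chg (η : Form D M) {x x' : M} {y : Eucl D} (hy : y ∈ ov D x x') :
    localForm x η y = pull (chg x x') (localForm x' η) y := by
  rw [pull, localForm_eq, localForm_eq, symm_chg hy, dsy_chg hy, ← covPull_comp,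
    ← ExteriorAlgebra.map_comp_map, AlgHom.comp_apply]

/-- Forms agree at `p` if their expressions in a chart around `p` do. -/
lemma eq_of_localForm_eq {η τ : Form D M} {x p : M} (hp : p ∈ (extChartAt (𝓡 D) x).source)
    (h : localForm x η (extChartAt (𝓡 D) x p) = localForm x τ (extChartAt (𝓡 D) x p)) :
    η p = τ p := by
  rw [localForm_eq, localForm_eq, (extChartAt (𝓡 D) x).left_inv hp] at h
  have h2 := congrArg (ExteriorAlgebra.map (covPull (dch x p))) h
  simp only [← AlgHom.comp_apply, ExteriorAlgebra.map_comp_map] at h2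
  rw [covPull_comp, dsy_comp_dch hp] at h2
  have h3 : covPull (ContinuousLinearMap.id ℝ (Eucl D)) = LinearMap.id := rfl
  rw [h3, ExteriorAlgebra.map_id] at h2
  exact h2

lemma form_ext {η τ : Form D M} (h : ∀ x, ∀ y ∈ (extChartAt (𝓡 D) x).target,
    localForm x η y = localForm x τ y) : η = τ :=
  funext fun p => eq_of_localForm_eq (mem_extChartAt_source p) (h p _ (mem_extChartAt_target p))

/-- A form is smooth if its expressions in the preferred charts are. -/
def SmoothForm (η : Form D M) : Prop :=
  ∀ x : M, ContDiffOn ℝ ∞ (localForm x η) (extChartAt (𝓡 D) x).target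

/-- `dForm` uses at each point only the preferred chart of that point. Independence of the chart
follows from naturality of `d` under the transition map, and it makes all local identities available
on `M`. -/
lemma localForm_dForm {η : Form D M} (hη : SmoothForm η) (x : M) {y : Eucl D}
    (hy : y ∈ (extChartAt (𝓡 D) x).target) :
    localForm x (dForm η) y = extD (localForm x η) y := by
  set q := (extChartAt (𝓡 D) x).symm y with hq
  have hyo : y ∈ ov D x q := ⟨hy, mem_extChartAt_source _⟩
  rw [extD_congr_on (isOpen_ov x q) (fun z hz => localForm_chg η hz) hyo,
    extD_pull (isOpen_ov x q) (isOpen_target q) (contDiffOn_chg x q) (mapsTo_chg x q) (hη q) hyo,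
    pull, fderiv_chg hyo, ← covPull_comp, ← ExteriorAlgebra.map_comp_map]
  rfl

lemma SmoothForm.dForm {η : Form D M} (hη : SmoothForm η) : SmoothForm (dForm η) := fun x =>
  (contDiffOn_extD (isOpen_target x) (hη x)).congr fun _ hy => localForm_dForm hη x hy

/-- A vector field in the preferred chart at `x`. -/
def locX (x : M) (X : VField D M) : Eucl D → Eucl D :=
  VectorField.mpullback 𝓘(ℝ, Eucl D) (𝓡 D) (extChartAt (𝓡 D) x).symm X

/-- Smooth vector fields. -/
def SmoothVField (X : VField D M) : Prop :=
  ContMDiff (𝓡 D) (𝓡 D).tangent ∞ (fun p => (⟨p, X p⟩ : TangentBundle (𝓡 D) M))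

lemma isInvertible_dsy {x : M} {y : Eucl D} (hy : y ∈ (extChartAt (𝓡 D) x).target) :
    (mfderiv 𝓘(ℝ, Eucl D) (𝓡 D) (extChartAt (𝓡 D) x).symm y).IsInvertible := by
  have := isInvertible_mfderivWithin_extChartAt_symm (I := 𝓡 D) hy
  rwa [range_model, mfderivWithin_univ] at this

lemma contDiffOn_locX {X : VField D M} (hX : SmoothVField X) (x : M) :
    ContDiffOn ℝ ∞ (locX x X) (extChartAt (𝓡 D) x).target := by
  intro y hy
  have h := ContMDiffAt.mpullback_vectorField_preimage (m := ∞) (n := ∞) (V := X) (hX _)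
    (contMDiffAt_symm hy) (isInvertible_dsy hy) (by simp)
  exact (contMDiffAt_vectorSpace_iff_contDiffAt.1 h).contDiffWithinAt

lemma dsy_locX (X : VField D M) {x : M} {y : Eucl D} (hy : y ∈ (extChartAt (𝓡 D) x).target) :
    dsy x y (locX x X y) = X ((extChartAt (𝓡 D) x).symm y) :=
  (isInvertible_dsy hy).self_apply_inverse _

lemma localForm_interior (X : VField D M) (η : Form D M) (x : M) {y : Eucl D}
    (hy : y ∈ (extChartAt (𝓡 D) x).target) :
    localForm x (interior X η) y = con (locX x X) (localForm x η) y := by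
  rw [con, localForm_eq, localForm_eq, contractLeft_map, evalAt_comp_covPull, dsy_locX X hy]
  rfl

lemma SmoothForm.interior {X : VField D M} (hX : SmoothVField X) {η : Form D M}
    (hη : SmoothForm η) : SmoothForm (interior X η) := fun x =>
  (contDiffOn_con (contDiffOn_locX hX x) (hη x)).congr fun _ hy => localForm_interior X η x hy

lemma localForm_add (η τ : Form D M) (x : M) :
    localForm x (η + τ) = localForm x η + localForm x τ :=
  funext fun _ => map_add _ _ _

lemma localForm_mul (η τ : Form D M) (x : M) :
    localForm x (η * τ) = localForm x η * localForm x τ :=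
  funext fun _ => map_mul _ _ _

lemma localForm_smul (c : ℂ) (η : Form D M) (x : M) :
    localForm x (c • η) = fun y => c • localForm x η y :=
  funext fun y => map_smul (ExteriorAlgebra.map (covPull (dsy x y))) c _

lemma localForm_smul_apply (c : ℂ) (η : Form D M) (x : M) (y : Eucl D) :
    localForm x (c • η) y = c • localForm x η y := by rw [localForm_smul]

lemma localForm_lieD {X : VField D M} (hX : SmoothVField X) {η : Form D M} (hη : SmoothForm η)
    (x : M) {y : Eucl D} (hy : y ∈ (extChartAt (𝓡 D) x).target) :
    localForm x (lieD X η) y = lieL (locX x X) (localForm x η) y := by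
  rw [lieD, localForm_add, Pi.add_apply, localForm_dForm (hη.interior hX) x hy,
    localForm_interior X _ x hy, lieL, Pi.add_apply, con, con, localForm_dForm hη x hy,
    extD_congr_on (isOpen_target x) (fun z hz => localForm_interior X η x hz) hy]

lemma SmoothForm.lieD {X : VField D M} (hX : SmoothVField X) {η : Form D M}
    (hη : SmoothForm η) : SmoothForm (lieD X η) := fun x =>
  (contDiffOn_lieL (isOpen_target x) (contDiffOn_locX hX x) (hη x)).congr
    fun _ hy => localForm_lieD hX hη x hy

/-- Pullback along the inverse chart respects brackets, and in a vector space a vanishing bracket is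
the equality of the two directional derivatives. -/
lemma locX_comm {X Y : VField D M} (hX : SmoothVField X) (hY : SmoothVField Y)
    (hXY : VectorField.mlieBracket (𝓡 D) X Y = 0) (x : M) {y : Eucl D}
    (hy : y ∈ (extChartAt (𝓡 D) x).target) :
    fderiv ℝ (locX x Y) y (locX x X y) = fderiv ℝ (locX x X) y (locX x Y y) := by
  have : IsManifold (𝓡 D) (minSmoothness ℝ 2) M := by
    rw [minSmoothness_of_isRCLikeNormedField]
    exact IsManifold.of_le (n := ∞) (by norm_cast)
  have h := VectorField.mpullback_mlieBracket (V := X) (W := Y) (n := ∞)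
    ((hX _).mdifferentiableAt (by simp)) ((hY _).mdifferentiableAt (by simp))
    (contMDiffAt_symm hy) (by simp; norm_cast)
  rw [hXY, ← VectorField.mlieBracketWithin_univ,
    VectorField.mlieBracketWithin_eq_lieBracketWithin, VectorField.mpullback_zero] at h
  have h2 : 0 = VectorField.lieBracketWithin ℝ (locX x X) (locX x Y) Set.univ y := h
  rw [VectorField.lieBracketWithin_univ] at h2
  exact sub_eq_zero.1 h2.symm

/-- The algebra of smooth forms. -/
def smoothForms (D : ℕ) (M : Type*) [TopologicalSpace M] [ChartedSpace (Eucl D) M]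
    [IsManifold (𝓡 D) ∞ M] : Subalgebra ℂ (Form D M) where
  carrier := {η | SmoothForm η}
  mul_mem' {η τ} hη hτ x := by
    rw [localForm_mul]
    exact contDiffOn_mul (hη x) (hτ x)
  add_mem' {η τ} hη hτ x := by
    rw [localForm_add]
    exact (hη x).add (hτ x)
  algebraMap_mem' c x := by
    refine (contDiffOn_const (c := algebraMap ℂ (ExtCov D) c)).congr fun y _ => ?_
    exact (ExteriorAlgebra.map (covPull (dsy x y))).commutes c

lemma dForm_add {η τ : Form D M} (hη : SmoothForm η) (hτ : SmoothForm τ) :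
    dForm (η + τ) = dForm η + dForm τ :=
  form_ext fun x y hy => by
    rw [localForm_dForm ((smoothForms D M).add_mem hη hτ) x hy, localForm_add, localForm_add,
      extD_add (diffAt (isOpen_target x) (hη x) hy) (diffAt (isOpen_target x) (hτ x) hy),
      Pi.add_apply, localForm_dForm hη x hy, localForm_dForm hτ x hy]

lemma dForm_smul (c : ℂ) {η : Form D M} (hη : SmoothForm η) :
    dForm (c • η) = c • dForm η :=
  form_ext fun x y hy => by
    rw [localForm_dForm ((smoothForms D M).smul_mem hη c) x hy, localForm_smul, localForm_smul_apply,
      extD_smul (diffAt (isOpen_target x) (hη x) hy), localForm_dForm hη x hy]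

lemma lieD_add {X : VField D M} (hX : SmoothVField X) {η τ : Form D M} (hη : SmoothForm η)
    (hτ : SmoothForm τ) : lieD X (η + τ) = lieD X η + lieD X τ :=
  form_ext fun x y hy => by
    rw [localForm_lieD hX ((smoothForms D M).add_mem hη hτ) x hy, localForm_add, localForm_add,
      lieL_add (isOpen_target x) (contDiffOn_locX hX x) (hη x) (hτ x) hy, Pi.add_apply,
      localForm_lieD hX hη x hy, localForm_lieD hX hτ x hy]

lemma lieD_mul {X : VField D M} (hX : SmoothVField X) {η τ : Form D M} (hη : SmoothForm η)
    (hτ : SmoothForm τ) : lieD X (η * τ) = lieD X η * τ + η * lieD X τ :=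
  form_ext fun x y hy => by
    rw [localForm_lieD hX ((smoothForms D M).mul_mem hη hτ) x hy, localForm_mul, localForm_add,
      localForm_mul, localForm_mul,
      lieL_mul (isOpen_target x) (contDiffOn_locX hX x) (hη x) (hτ x) hy, Pi.add_apply,
      Pi.mul_apply, Pi.mul_apply, localForm_lieD hX hη x hy, localForm_lieD hX hτ x hy]

lemma interior_smul (X : VField D M) (c : ℂ) (η : Form D M) :
    interior X (c • η) = c • interior X η :=
  funext fun p => map_smul (CliffordAlgebra.contractLeft (evalAt (X p))) c (η p)

lemma lieD_smul {X : VField D M} (hX : SmoothVField X) (c : ℂ) {η : Form D M}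
    (hη : SmoothForm η) : lieD X (c • η) = c • lieD X η := by
  rw [lieD, lieD, interior_smul, dForm_smul c (hη.interior hX), dForm_smul c hη, interior_smul,
    smul_add]

lemma lieD_comm {X Y : VField D M} (hX : SmoothVField X) (hY : SmoothVField Y)
    (hXY : VectorField.mlieBracket (𝓡 D) X Y = 0) {η : Form D M} (hη : SmoothForm η) :
    lieD X (lieD Y η) = lieD Y (lieD X η) :=
  form_ext fun x y hy => by
    have hU := isOpen_target (D := D) x
    rw [localForm_lieD hX (hη.lieD hY) x hy, localForm_lieD hY (hη.lieD hX) x hy,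
      lieL_congr hU _ (fun z hz => localForm_lieD hY hη x hz) hy,
      lieL_congr hU _ (fun z hz => localForm_lieD hX hη x hz) hy]
    exact lieL_comm hU (contDiffOn_locX hX x) (contDiffOn_locX hY x)
      (fun z hz => locX_comm hX hY hXY x hz) (hη x) y hy

lemma lieD_dForm {X : VField D M} (hX : SmoothVField X) {η : Form D M} (hη : SmoothForm η) :
    lieD X (dForm η) = dForm (lieD X η) :=
  form_ext fun x y hy => by
    have hU := isOpen_target (D := D) x
    rw [localForm_lieD hX hη.dForm x hy, localForm_dForm (hη.lieD hX) x hy,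
      lieL_congr hU _ (fun z hz => localForm_dForm hη x hz) hy,
      extD_congr_on hU (fun z hz => localForm_lieD hX hη x hz) hy]
    exact lieL_extD hU (contDiffOn_locX hX x) (hη x) hy

/-- The operator `scal` on forms. -/
def scalF (t : ℂ) (η : Form D M) : Form D M := fun p => scal t (η p)

lemma localForm_scalF (t : ℂ) (η : Form D M) (x : M) :
    localForm x (scalF t η) = fun y => scal t (localForm x η y) :=
  funext fun _ => map_scal _ _ _

lemma localForm_scalF_apply (t : ℂ) (η : Form D M) (x : M) (y : Eucl D) :
    localForm x (scalF t η) y = scal t (localForm x η y) := by rw [localForm_scalF]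

lemma SmoothForm.scalF {η : Form D M} (hη : SmoothForm η) (t : ℂ) : SmoothForm (scalF t η) :=
  fun x => by
    rw [localForm_scalF]
    exact contDiffOn_scal (hη x) t

lemma lieD_scalF {X : VField D M} (hX : SmoothVField X) (t : ℂ) {η : Form D M}
    (hη : SmoothForm η) : lieD X (scalF t η) = scalF t (lieD X η) :=
  form_ext fun x y hy => by
    rw [localForm_lieD hX (hη.scalF t) x hy, localForm_scalF, localForm_scalF_apply,
      lieL_scal (isOpen_target x) (contDiffOn_locX hX x) t (hη x) hy, localForm_lieD hX hη x hy]

lemma scalF_dForm (t : ℂ) {η : Form D M} (hη : SmoothForm η) :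
    scalF t (dForm η) = t • dForm (scalF t η) :=
  form_ext fun x y hy => by
    rw [localForm_scalF_apply, localForm_smul_apply, localForm_dForm (hη.scalF t) x hy, localForm_scalF,
      ← extD_scal (diffAt (isOpen_target x) (hη x) hy), localForm_dForm hη x hy]

lemma dForm_mul {η τ : Form D M} (hη : SmoothForm η) (hτ : SmoothForm τ) :
    dForm (η * τ) = dForm η * τ + scalF (-1) η * dForm τ :=
  form_ext fun x y hy => by
    rw [localForm_dForm ((smoothForms D M).mul_mem hη hτ) x hy, localForm_add, localForm_mul,
      localForm_mul, localForm_mul, localForm_scalF,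
      extD_mul (diffAt (isOpen_target x) (hη x) hy) (diffAt (isOpen_target x) (hτ x) hy),
      Pi.add_apply, Pi.mul_apply, Pi.mul_apply, localForm_dForm hη x hy, localForm_dForm hτ x hy]

/-- The conjugate linear anti-automorphism of the algebra of forms. -/
def starF (η : Form D M) : Form D M := fun p => extStar (covConj _) (η p)

lemma localForm_starF (η : Form D M) (x : M) :
    localForm x (starF η) = fun y => extStar (covConj _) (localForm x η y) :=
  funext fun y => map_extStar _ _ _ (covPull_covConj (dsy x y)) _

lemma localForm_starF_apply (η : Form D M) (x : M) (y : Eucl D) :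
    localForm x (starF η) y = extStar (covConj _) (localForm x η y) := by rw [localForm_starF]

lemma SmoothForm.starF {η : Form D M} (hη : SmoothForm η) : SmoothForm (starF η) :=
  fun x => by
    rw [localForm_starF]
    exact contDiffOn_extStar (hη x)

lemma lieD_starF {X : VField D M} (hX : SmoothVField X) {η : Form D M}
    (hη : SmoothForm η) : lieD X (starF η) = starF (lieD X η) :=
  form_ext fun x y hy => by
    rw [localForm_lieD hX hη.starF x hy, localForm_starF, localForm_starF_apply,
      lieL_extStar (isOpen_target x) (contDiffOn_locX hX x) (hη x) hy, localForm_lieD hX hη x hy]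

/-- Functions as forms. -/
def funForm (f : M → ℂ) : Form D M := fun p => algebraMap ℂ (ExteriorAlgebra ℂ (Cov D p)) (f p)

lemma localForm_funForm (f : M → ℂ) (x : M) :
    localForm x (funForm f : Form D M) =
      fun y => algebraMap ℂ _ (f ((extChartAt (𝓡 D) x).symm y)) :=
  funext fun y => (ExteriorAlgebra.map (covPull (dsy x y))).commutes _

lemma contDiffOn_comp_symm {F : Type*} [NormedAddCommGroup F] [NormedSpace ℝ F] {f : M → F}
    (hf : ContMDiff (𝓡 D) 𝓘(ℝ, F) ∞ f) (x : M) :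
    ContDiffOn ℝ ∞ (fun y => f ((extChartAt (𝓡 D) x).symm y)) (extChartAt (𝓡 D) x).target := by
  rw [← contMDiffOn_iff_contDiffOn]
  exact hf.comp_contMDiffOn (contMDiffOn_extChartAt_symm x)

lemma smoothForm_funForm {f : M → ℂ} (hf : ContMDiff (𝓡 D) 𝓘(ℝ, ℂ) ∞ f) :
    SmoothForm (funForm f : Form D M) := fun x => by
  rw [localForm_funForm]
  exact (constCLM D).contDiff.comp_contDiffOn (contDiffOn_comp_symm hf x)

lemma starF_funForm (f : M → ℂ) :
    starF (funForm f : Form D M) = funForm fun p => conj (f p) :=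
  funext fun _ => extStar_algebraMap _ _

/-- Stated for functions only: on `k`-forms the reversal of products introduces a sign `(-1)^k`
between the two sides. -/
lemma starF_dForm_funForm {f : M → ℂ} (hf : ContMDiff (𝓡 D) 𝓘(ℝ, ℂ) ∞ f) :
    starF (dForm (funForm f : Form D M)) = dForm (funForm fun p => conj (f p)) := by
  have hf' : SmoothForm (funForm (fun p => conj (f p)) : Form D M) := by
    rw [← starF_funForm]
    exact (smoothForm_funForm hf).starF
  refine form_ext fun x y hy => ?_
  have hd := diffAt (isOpen_target x) (contDiffOn_comp_symm hf x) hy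
  rw [localForm_starF_apply, localForm_dForm (smoothForm_funForm hf) x hy, localForm_dForm hf' x hy,
    localForm_funForm, localForm_funForm, extD_function hd, extStar_ι]
  rw [extD_function (f := fun y => conj (f ((extChartAt (𝓡 D) x).symm y)))
    ((Complex.conjCLE : ℂ →L[ℝ] ℂ).differentiableAt.comp y hd), fderiv_conj hd]

/-- One-forms as forms. -/
def oneForm (ξ : OneForm D M) : Form D M := fun p => ExteriorAlgebra.ι ℂ (ξ p)

lemma smoothForm_oneForm {ξ : OneForm D M} (hξ : SmoothOneForm ξ) : SmoothForm (oneForm ξ) :=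
  fun x => ((ιCLM D).contDiff.comp_contDiffOn (hξ x)).congr fun y _ =>
    ExteriorAlgebra.map_apply_ι (covPull (dsy x y)) (ξ _)

lemma starF_oneForm (ξ : OneForm D M) :
    starF (oneForm ξ) = oneForm fun p => covConj _ (ξ p) :=
  funext fun _ => extStar_ι _ _

end Charts

/-! ### Integration of forms -/

section Integration

open MeasureTheory

variable {D : ℕ} {M : Type*} [TopologicalSpace M] [ChartedSpace (Eucl D) M]

/-- The form `η` vanishes off the set `C`. -/
def VanishOff (C : Set M) (η : Form D M) : Prop := ∀ p ∉ C, η p = 0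

lemma VanishOff.mono {C C' : Set M} {η : Form D M} (h : VanishOff C η) (hC : C ⊆ C') :
    VanishOff C' η := fun p hp => h p fun hp' => hp (hC hp')

lemma VanishOff.add {C : Set M} {η τ : Form D M} (h : VanishOff C η) (h' : VanishOff C τ) :
    VanishOff C (η + τ) := fun p hp => by rw [Pi.add_apply, h p hp, h' p hp, add_zero]

lemma VanishOff.smul {C : Set M} {η : Form D M} (h : VanishOff C η) (c : ℂ) :
    VanishOff C (c • η) := fun p hp => by rw [Pi.smul_apply, h p hp, smul_zero]

lemma VanishOff.mul_left {C : Set M} {η : Form D M} (h : VanishOff C η) (τ : Form D M) :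
    VanishOff C (τ * η) := fun p hp => by rw [Pi.mul_apply, h p hp, mul_zero]

lemma VanishOff.mul_right {C : Set M} {η : Form D M} (h : VanishOff C η) (τ : Form D M) :
    VanishOff C (η * τ) := fun p hp => by rw [Pi.mul_apply, h p hp, zero_mul]

lemma VanishOff.localForm_eq_zero {C : Set M} {η : Form D M} (h : VanishOff C η) {x : M} {y : Eucl D}
    (hy : (extChartAt (𝓡 D) x).symm y ∉ C) : localForm x η y = 0 := by
  rw [localForm_eq, ev, h _ hy]
  exact map_zero (ExteriorAlgebra.map (covPull (dsy x y)))

lemma VanishOff.interior {C : Set M} {η : Form D M} (h : VanishOff C η) (X : VField D M) :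
    VanishOff C (interior X η) := fun p hp => by
  rw [TwistedDirac.interior, h p hp, map_zero]

lemma VanishOff.dForm {C : Set M} (hC : IsClosed C) {η : Form D M} (h : VanishOff C η) :
    VanishOff C (dForm η) := fun p hp => by
  have h1 : localForm p η =ᶠ[nhds (extChartAt (𝓡 D) p p)] fun _ => 0 := by
    have hc : ContinuousAt (extChartAt (𝓡 D) p).symm (extChartAt (𝓡 D) p p) :=
      continuousAt_extChartAt_symm p
    have hn : Cᶜ ∈ nhds ((extChartAt (𝓡 D) p).symm (extChartAt (𝓡 D) p p)) := by
      rw [(extChartAt (𝓡 D) p).left_inv (mem_extChartAt_source p)]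
      exact hC.isOpen_compl.mem_nhds hp
    filter_upwards [hc hn] with y hy
    exact h.localForm_eq_zero hy
  rw [TwistedDirac.dForm, extD_congr h1, extD_const]
  exact map_zero (ExteriorAlgebra.map (covPull (dch p p)))

lemma VanishOff.lieD {C : Set M} (hC : IsClosed C) {η : Form D M} (h : VanishOff C η)
    (X : VField D M) : VanishOff C (lieD X η) :=
  ((h.interior X).dForm hC).add ((h.dForm hC).interior X)

/-- Integral of a form over the preferred chart at `x`. -/
def chartInt (x : M) (η : Form D M) : ℂ :=
  ∫ y in (extChartAt (𝓡 D) x).target, topCoeff (localForm x η y)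

lemma det_chg_pos (hO : OrientedAtlas D M) {x x' : M} {y : Eucl D} (hy : y ∈ ov D x x') :
    0 < (fderiv ℝ (chg x x') y).det := by
  have h1 : y ∈ ((chartAt (Eucl D) x).symm.trans (chartAt (Eucl D) x')).source := by
    have := hy
    simp only [ov, mfld_simps] at this ⊢
    exact this
  have h2 := hO _ (chart_mem_atlas (Eucl D) x) _ (chart_mem_atlas (Eucl D) x') y h1
  have h3 : chg (D := D) x x' = (chartAt (Eucl D) x).symm.trans (chartAt (Eucl D) x') := by
    funext z
    simp only [chg, mfld_simps]
  rwa [h3]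

variable [IsManifold (𝓡 D) ∞ M]

lemma chg_image (x x' : M) : chg x x' '' ov D x x' = ov D x' x := by
  have h : ∀ x x' : M, chg x x' '' ov D x x' ⊆ ov D x' x := by
    rintro x x' _ ⟨y, hy, rfl⟩
    refine ⟨mapsTo_chg x x' hy, ?_⟩
    rw [Set.mem_preimage, symm_chg hy]
    exact (extChartAt (𝓡 D) x).map_target hy.1
  refine (h x x').antisymm fun z hz => ⟨chg x' x z, h x' x ⟨z, hz, rfl⟩, ?_⟩
  rw [chg, Function.comp_apply, symm_chg hz]
  exact (extChartAt (𝓡 D) x').right_inv hz.1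

lemma injOn_chg (x x' : M) : Set.InjOn (chg x x') (ov D x x') := by
  intro y hy z hz h
  have := congrArg (extChartAt (𝓡 D) x').symm h
  rw [symm_chg hy, symm_chg hz] at this
  exact (extChartAt (𝓡 D) x).symm.injOn hy.1 hz.1 this

lemma chartInt_eq_ov {C : Set M} {η : Form D M} (h : VanishOff C η) {x x' : M}
    (hC : C ⊆ (extChartAt (𝓡 D) x').source) :
    chartInt x η = ∫ y in ov D x x', topCoeff (localForm x η y) := by
  refine setIntegral_eq_of_subset_of_forall_sdiff_eq_zero (isOpen_target x).measurableSet
    Set.inter_subset_left fun y hy => ?_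
  rw [h.localForm_eq_zero fun hy' => hy.2 ⟨hy.1, hC hy'⟩]
  simp [topCoeff]

/-- The change of variables produces the absolute value of the Jacobian and the top coefficient
produces the Jacobian itself. They agree because the atlas is oriented. -/
lemma chartInt_chg (hO : OrientedAtlas D M) {C : Set M} {η : Form D M} (h : VanishOff C η)
    {x x' : M} (hx : C ⊆ (extChartAt (𝓡 D) x).source) (hx' : C ⊆ (extChartAt (𝓡 D) x').source) :
    chartInt x η = chartInt x' η := by
  rw [chartInt_eq_ov h hx', chartInt_eq_ov h hx, ← chg_image x x',
    integral_image_eq_integral_abs_det_fderiv_smul volume (isOpen_ov x x').measurableSet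
      (fun y hy => (diffAt (isOpen_ov x x') (contDiffOn_chg x x') hy).hasFDerivAt.hasFDerivWithinAt)
      (injOn_chg x x')]
  refine setIntegral_congr_fun (isOpen_ov x x').measurableSet fun y hy => ?_
  rw [localForm_chg η hy, pull, topCoeff_map, det_covPull, abs_of_pos (det_chg_pos hO hy),
    Complex.real_smul]

/-- Multiplication of a form by a function. -/
def mulF (f : M → ℂ) (η : Form D M) : Form D M := fun p => f p • η p

lemma mulF_eq (f : M → ℂ) (η : Form D M) : mulF f η = funForm f * η :=
  funext fun _ => Algebra.smul_def _ _

lemma localForm_mulF (f : M → ℂ) (η : Form D M) (x : M) (y : Eucl D) :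
    localForm x (mulF f η) y = f ((extChartAt (𝓡 D) x).symm y) • localForm x η y :=
  map_smul (ExteriorAlgebra.map (covPull (dsy x y))) _ _

lemma SmoothForm.mulF {f : M → ℂ} (hf : ContMDiff (𝓡 D) 𝓘(ℝ, ℂ) ∞ f) {η : Form D M}
    (hη : SmoothForm η) : SmoothForm (mulF f η) := by
  rw [mulF_eq]
  exact (smoothForms D M).mul_mem (smoothForm_funForm hf) hη

lemma contDiffOn_topCoeff {U : Set (Eucl D)} {g : Eucl D → ExtCov D} (hg : ContDiffOn ℝ ∞ g U) :
    ContDiffOn ℝ ∞ (fun y => topCoeff (g y)) U :=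
  (toCLMR (topCoeffL D)).contDiff.comp_contDiffOn hg

lemma integrableOn_of_vanish {U K : Set (Eucl D)} (hU : IsOpen U) (hK : IsCompact K) (hKU : K ⊆ U)
    {f : Eucl D → ℂ} (hf : ContinuousOn f U) (h0 : ∀ y ∈ U, y ∉ K → f y = 0) :
    IntegrableOn f U := by
  have h1 : IntegrableOn f K := (hf.mono hKU).integrableOn_compact hK
  refine h1.of_forall_sdiff_eq_zero hU.measurableSet fun y hy => h0 y hy.1 hy.2

lemma isCompact_image_chart {K : Set M} (hK : IsCompact K) {x : M}
    (hKx : K ⊆ (extChartAt (𝓡 D) x).source) :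
    IsCompact (extChartAt (𝓡 D) x '' K) :=
  hK.image_of_continuousOn ((continuousOn_extChartAt x).mono hKx)

lemma integrableOn_chart {K : Set M} (hK : IsCompact K) {x : M}
    (hKx : K ⊆ (extChartAt (𝓡 D) x).source) {η : Form D M} (hη : SmoothForm η)
    (h : VanishOff K η) :
    IntegrableOn (fun y => topCoeff (localForm x η y)) (extChartAt (𝓡 D) x).target := by
  refine integrableOn_of_vanish (isOpen_target x) (isCompact_image_chart hK hKx) ?_
    (contDiffOn_topCoeff (hη x)).continuousOn ?_
  · rintro _ ⟨p, hp, rfl⟩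
    exact (extChartAt (𝓡 D) x).map_source (hKx hp)
  · intro y hy hyK
    rw [h.localForm_eq_zero fun hp => hyK ⟨_, hp, (extChartAt (𝓡 D) x).right_inv hy⟩]
    simp [topCoeff]

lemma chartInt_add {K : Set M} (hK : IsCompact K) {x : M}
    (hKx : K ⊆ (extChartAt (𝓡 D) x).source) {η τ : Form D M} (hη : SmoothForm η)
    (h : VanishOff K η) (hτ : SmoothForm τ) (h' : VanishOff K τ) :
    chartInt x (η + τ) = chartInt x η + chartInt x τ := by
  rw [chartInt, chartInt, chartInt, ← integral_add (integrableOn_chart hK hKx hη h)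
    (integrableOn_chart hK hKx hτ h')]
  simp only [localForm_add, Pi.add_apply, ← topCoeffL_apply, map_add]

lemma chartInt_zero (x : M) : chartInt x (0 : Form D M) = 0 := by
  have : ∀ y, localForm x (0 : Form D M) y = 0 := fun y =>
    map_zero (ExteriorAlgebra.map (covPull (dsy x y)))
  simp [chartInt, this, topCoeff]

lemma chartInt_sum {ι : Type*} (s : Finset ι) {K : Set M} (hK : IsCompact K) {x : M}
    (hKx : K ⊆ (extChartAt (𝓡 D) x).source) {η : ι → Form D M} (hη : ∀ i, SmoothForm (η i))
    (h : ∀ i, VanishOff K (η i)) :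
    chartInt x (∑ i ∈ s, η i) = ∑ i ∈ s, chartInt x (η i) := by
  classical
  induction s using Finset.induction_on with
  | empty => simp [chartInt_zero]
  | insert i s hi ih =>
    rw [Finset.sum_insert hi, Finset.sum_insert hi, ← ih]
    refine chartInt_add hK hKx (hη i) (h i) ((smoothForms D M).sum_mem fun i _ => hη i)
      fun p hp => ?_
    rw [Finset.sum_apply]
    exact Finset.sum_eq_zero fun i _ => h i p hp

variable [T2Space M] [SigmaCompactSpace M]

/-- The functions of the partition of unity, complex-valued. -/
def rho (D : ℕ) {M : Type*} [TopologicalSpace M] [ChartedSpace (Eucl D) M]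
    [IsManifold (𝓡 D) ∞ M] [T2Space M] [SigmaCompactSpace M] (x p : M) : ℂ :=
  ((partOfUnity D M x p : ℝ) : ℂ)

lemma contMDiff_rho (x : M) : ContMDiff (𝓡 D) 𝓘(ℝ, ℂ) ∞ (rho D x) :=
  Complex.ofRealCLM.contDiff.contMDiff.comp (partOfUnity D M x).contMDiff

lemma tsupport_partOfUnity (x : M) :
    tsupport (partOfUnity D M x) ⊆ (extChartAt (𝓡 D) x).source := by
  rw [extChartAt_source]
  exact (SmoothPartitionOfUnity.exists_isSubordinate_chartAt_source (𝓡 D) M).choose_spec x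

lemma integral_eq (η : Form D M) : integral η = ∑ᶠ x : M, chartInt x (mulF (rho D x) η) := rfl

lemma vanishOff_mulF_rho {C : Set M} {η : Form D M} (h : VanishOff C η) (x : M) :
    VanishOff (tsupport (partOfUnity D M x) ∩ C) (mulF (rho D x) η) := fun p hp => by
  rw [mulF]
  by_cases hC : p ∈ C
  · have : partOfUnity D M x p = 0 := image_eq_zero_of_notMem_tsupport fun hp' => hp ⟨hp', hC⟩
    rw [rho, this, Complex.ofReal_zero, zero_smul]
  · rw [h p hC, smul_zero]

lemma finite_rho {K : Set M} (hK : IsCompact K) :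
    {x : M | (tsupport (partOfUnity D M x) ∩ K).Nonempty}.Finite :=
  (partOfUnity D M).locallyFinite.closure.finite_nonempty_inter_compact hK

/-- Finitely many charts whose functions in the partition of unity meet the compact set `K`. -/
def charts (D : ℕ) {M : Type*} [TopologicalSpace M] [ChartedSpace (Eucl D) M]
    [IsManifold (𝓡 D) ∞ M] [T2Space M] [SigmaCompactSpace M] {K : Set M} (hK : IsCompact K) :
    Finset M := (finite_rho (D := D) hK).toFinset

lemma mulF_rho_eq_zero {K : Set M} (hK : IsCompact K) {η : Form D M} (h : VanishOff K η) {x : M}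
    (hx : x ∉ charts D hK) : mulF (rho D x) η = 0 := by
  funext p
  refine vanishOff_mulF_rho h x p fun hp => hx ?_
  rw [charts, Set.Finite.mem_toFinset]
  exact ⟨p, hp⟩

lemma integral_eq_sum {K : Set M} (hK : IsCompact K) {η : Form D M} (h : VanishOff K η) :
    integral η = ∑ x ∈ charts D hK, chartInt x (mulF (rho D x) η) := by
  rw [integral_eq]
  refine finsum_eq_sum_of_support_subset _ fun x hx => ?_
  by_contra hx'
  refine hx ?_
  change chartInt x (mulF (rho D x) η) = 0
  rw [mulF_rho_eq_zero hK h hx', chartInt_zero]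

lemma sum_mulF_rho {K : Set M} (hK : IsCompact K) {η : Form D M} (h : VanishOff K η) :
    ∑ x ∈ charts D hK, mulF (rho D x) η = η := by
  funext p
  rw [Finset.sum_apply]
  by_cases hp : p ∈ K
  · have h1 : ∑ x ∈ charts D hK, rho D x p = 1 := by
      have := (partOfUnity D M).sum_eq_one (Set.mem_univ p)
      rw [finsum_eq_sum_of_support_subset (s := charts D hK)] at this
      · simp only [rho, ← Complex.ofReal_sum, this, Complex.ofReal_one]
      · intro x hx
        rw [charts, Set.Finite.coe_toFinset]
        exact ⟨p, subset_tsupport _ hx, hp⟩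
    simp only [mulF, ← Finset.sum_smul, h1, one_smul]
  · rw [h p hp]
    exact Finset.sum_eq_zero fun x _ => by rw [mulF, h p hp, smul_zero]

lemma isCompact_tsupport_inter {K : Set M} (hK : IsCompact K) (x : M) :
    IsCompact (tsupport (partOfUnity D M x) ∩ K) :=
  hK.inter_left (isClosed_tsupport _)

lemma integral_add {K : Set M} (hK : IsCompact K) {η τ : Form D M} (hη : SmoothForm η)
    (h : VanishOff K η) (hτ : SmoothForm τ) (h' : VanishOff K τ) :
    integral (η + τ) = integral η + integral τ := by
  rw [integral_eq_sum hK (h.add h'), integral_eq_sum hK h, integral_eq_sum hK h',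
    ← Finset.sum_add_distrib]
  refine Finset.sum_congr rfl fun x _ => ?_
  have h1 : mulF (rho D x) (η + τ) = mulF (rho D x) η + mulF (rho D x) τ :=
    funext fun p => smul_add _ _ _
  rw [h1, chartInt_add (isCompact_tsupport_inter (D := D) hK x)
    (Set.inter_subset_left.trans (tsupport_partOfUnity x)) (hη.mulF (contMDiff_rho x))
    (vanishOff_mulF_rho h x) (hτ.mulF (contMDiff_rho x)) (vanishOff_mulF_rho h' x)]

lemma integral_zero : integral (0 : Form D M) = 0 := by
  have h0 : VanishOff ∅ (0 : Form D M) := fun p _ => rfl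
  rw [integral_eq_sum isCompact_empty h0]
  have : ∀ x : M, mulF (rho D x) (0 : Form D M) = 0 := fun x => funext fun p => smul_zero _
  simp [this, chartInt_zero]

lemma integral_smul (c : ℂ) (η : Form D M) : integral (c • η) = c * integral η := by
  rw [integral_eq, integral_eq, ← smul_eq_mul, smul_finsum]
  refine finsum_congr fun x => ?_
  rw [chartInt, chartInt, smul_eq_mul, ← MeasureTheory.integral_const_mul]
  refine integral_congr_ae (Filter.Eventually.of_forall fun y => ?_)
  simp only
  rw [localForm_mulF, localForm_smul_apply, localForm_mulF, smul_comm, ← topCoeffL_apply, map_smul]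
  rfl

lemma integral_sum {ι : Type*} (s : Finset ι) {K : Set M} (hK : IsCompact K)
    {η : ι → Form D M} (hη : ∀ i, SmoothForm (η i)) (h : ∀ i, VanishOff K (η i)) :
    integral (∑ i ∈ s, η i) = ∑ i ∈ s, integral (η i) := by
  classical
  induction s using Finset.induction_on with
  | empty => simp [integral_zero]
  | insert i s hi ih =>
    rw [Finset.sum_insert hi, Finset.sum_insert hi, ← ih]
    refine integral_add hK (hη i) (h i) ((smoothForms D M).sum_mem fun i _ => hη i)
      fun p hp => ?_
    rw [Finset.sum_apply]
    exact Finset.sum_eq_zero fun i _ => h i p hp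

/-- The integral of a form supported in a chart is its integral over that chart. -/
lemma integral_eq_chartInt (hO : OrientedAtlas D M) {K : Set M} (hK : IsCompact K) {x : M}
    (hKx : K ⊆ (extChartAt (𝓡 D) x).source) {η : Form D M} (hη : SmoothForm η)
    (h : VanishOff K η) : integral η = chartInt x η := by
  rw [integral_eq_sum hK h]
  -- Each piece of the partition is supported in two charts at once, the one at `z` and the given
  -- one, where its integrals coincide.
  conv_rhs => rw [← sum_mulF_rho hK h]
  rw [chartInt_sum _ hK hKx (fun z => hη.mulF (contMDiff_rho z))
    fun z => (vanishOff_mulF_rho h z).mono Set.inter_subset_right]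
  refine Finset.sum_congr rfl fun z _ => ?_
  exact chartInt_chg hO (vanishOff_mulF_rho h z)
    (Set.inter_subset_left.trans (tsupport_partOfUnity z)) (Set.inter_subset_right.trans hKx)

/-- The integral of a derivative of a compactly supported function vanishes. -/
lemma integral_fderiv_eq_zero {f : Eucl D → ℂ} (hf : ContDiff ℝ ∞ f) (hc : HasCompactSupport f)
    (v : Eucl D) : ∫ y, fderiv ℝ f y v = 0 := by
  have h1 : Continuous fun y => fderiv ℝ f y v :=
    (hf.continuous_fderiv (by simp)).clm_apply continuous_const
  have h2 : HasCompactSupport fun y => fderiv ℝ f y v := hc.fderiv_apply ℝ v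
  -- Integration by parts against the constant function `1`.
  have h3 := integral_bilinear_fderiv_right_eq_neg_left_of_integrable (μ := volume)
    (f := fun _ : Eucl D => (1 : ℂ)) (g := f) (v := v) (B := ContinuousLinearMap.mul ℝ ℂ)
    (by simp) (by simpa using h1.integrable_of_hasCompactSupport h2)
    (by simpa using hf.continuous.integrable_of_hasCompactSupport hc)
    (fun _ _ => differentiableAt_const _) (fun x _ => hf.differentiable (by simp) x)
  simpa using h3

lemma chartInt_dForm {K : Set M} (hK : IsCompact K) {x : M}
    (hKx : K ⊆ (extChartAt (𝓡 D) x).source) {η : Form D M} (hη : SmoothForm η)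
    (h : VanishOff K η) : chartInt x (dForm η) = 0 := by
  set U := (extChartAt (𝓡 D) x).target with hUdef
  have hU : IsOpen U := isOpen_target x
  set K' := extChartAt (𝓡 D) x '' K with hK'
  have hK'c : IsCompact K' := isCompact_image_chart hK hKx
  have hK'U : K' ⊆ U := by
    rintro _ ⟨p, hp, rfl⟩
    exact (extChartAt (𝓡 D) x).map_source (hKx hp)
  -- Extension by zero is smooth on all of `ℝ^D`, since the form vanishes off a compact subset of
  -- the chart.
  set g : Eucl D → ExtCov D := U.indicator (localForm x η) with hg
  have hg0 : ∀ y ∉ K', g y = 0 := by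
    intro y hy
    by_cases hyU : y ∈ U
    · rw [hg, Set.indicator_of_mem hyU]
      exact h.localForm_eq_zero fun hp => hy ⟨_, hp, (extChartAt (𝓡 D) x).right_inv hyU⟩
    · rw [hg, Set.indicator_of_notMem hyU]
  have hgs : ContDiff ℝ ∞ g := by
    rw [contDiff_iff_contDiffAt]
    intro y
    by_cases hyU : y ∈ U
    · refine ((hη x).contDiffAt (hU.mem_nhds hyU)).congr_of_eventuallyEq ?_
      filter_upwards [hU.mem_nhds hyU] with z hz
      exact Set.indicator_of_mem hz _
    · refine (contDiffAt_const (c := (0 : ExtCov D))).congr_of_eventuallyEq ?_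
      filter_upwards [hK'c.isClosed.isOpen_compl.mem_nhds fun h => hyU (hK'U h)] with z hz
      exact hg0 z hz
  have h1 : chartInt x (TwistedDirac.dForm η) = ∫ y, topCoeff (extD g y) := by
    rw [chartInt, ← hUdef, setIntegral_congr_fun (g := fun y => topCoeff (extD g y))
      hU.measurableSet]
    · refine setIntegral_eq_integral_of_forall_compl_eq_zero fun y hy => ?_
      have : g =ᶠ[nhds y] fun _ => 0 := by
        filter_upwards [hK'c.isClosed.isOpen_compl.mem_nhds fun h => hy (hK'U h)] with z hz
        exact hg0 z hz
      rw [extD_congr this, extD_const]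
      simp [topCoeff]
    · intro y hy
      simp only
      rw [localForm_dForm hη x hy]
      congr 1
      exact extD_congr_on hU (fun z hz => (Set.indicator_of_mem hz _).symm) hy
  -- The functional `ℓ i` takes the top coefficient after multiplication by `dx^i`. With it the top
  -- coefficient of `dg` is a divergence, whose terms integrate to zero.
  let ℓ : Fin D → ExtCov D →ₗ[ℂ] ℂ := fun i =>
    (topCoeffL D).comp (LinearMap.mulLeft ℂ (ExteriorAlgebra.ι ℂ (dx D i)))
  have hℓ : ∀ i, ContDiff ℝ ∞ fun y => ℓ i (g y) := fun i => (toCLMR (ℓ i)).contDiff.comp hgs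
  have hℓc : ∀ i, HasCompactSupport fun y => ℓ i (g y) := fun i =>
    HasCompactSupport.intro hK'c fun y hy => by rw [hg0 y hy, map_zero]
  have h2 : ∀ y, topCoeff (extD g y) = ∑ i, fderiv ℝ (fun y => ℓ i (g y)) y (coordVec D i) := by
    intro y
    have hd : DifferentiableAt ℝ g y := hgs.differentiable (by simp) y
    rw [extD_eq hd, ← topCoeffL_apply, map_sum]
    refine Finset.sum_congr rfl fun i _ => ?_
    have : HasFDerivAt (fun y => ℓ i (g y)) ((toCLMR (ℓ i)).comp (fderiv ℝ g y)) y :=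
      (toCLMR (ℓ i)).hasFDerivAt.comp y hd.hasFDerivAt
    rw [this.fderiv]
    rfl
  rw [h1]
  simp only [h2]
  rw [integral_finsetSum]
  · exact Finset.sum_eq_zero fun i _ => integral_fderiv_eq_zero (hℓ i) (hℓc i) _
  · intro i _
    exact (((hℓ i).continuous_fderiv (by simp)).clm_apply
      continuous_const).integrable_of_hasCompactSupport ((hℓc i).fderiv_apply ℝ _)

/-- The theorem of Stokes for compactly supported forms. -/
theorem integral_dForm (hO : OrientedAtlas D M) {K : Set M} (hK : IsCompact K) {η : Form D M}
    (hη : SmoothForm η) (h : VanishOff K η) : integral (dForm η) = 0 := by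
  have hsm : ∀ x, SmoothForm (mulF (rho D x) η) := fun x => hη.mulF (contMDiff_rho x)
  have hd : ∀ s : Finset M, dForm (∑ x ∈ s, mulF (rho D x) η) =
      ∑ x ∈ s, dForm (mulF (rho D x) η) := by
    classical
    intro s
    induction s using Finset.induction_on with
    | empty =>
      rw [Finset.sum_empty, Finset.sum_empty]
      have := dForm_smul (D := D) (M := M) 0 (smoothForms D M).zero_mem
      simpa using this
    | insert i s hi ih =>
      rw [Finset.sum_insert hi, Finset.sum_insert hi, ← ih]
      exact dForm_add (hsm i) ((smoothForms D M).sum_mem fun i _ => hsm i)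
  have hv : ∀ x, VanishOff (tsupport (partOfUnity D M x) ∩ K) (mulF (rho D x) η) :=
    vanishOff_mulF_rho h
  have hKc : ∀ x, IsCompact (tsupport (partOfUnity D M x) ∩ K) := isCompact_tsupport_inter hK
  -- After the partition of unity each summand is the differential of a form compactly supported in
  -- one chart.
  rw [← sum_mulF_rho hK h, hd, integral_sum _ hK (fun x => (hsm x).dForm) fun x =>
    ((hv x).dForm (hKc x).isClosed).mono Set.inter_subset_right]
  refine Finset.sum_eq_zero fun x _ => ?_
  have hx : tsupport (partOfUnity D M x) ∩ K ⊆ (extChartAt (𝓡 D) x).source :=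
    Set.inter_subset_left.trans (tsupport_partOfUnity x)
  rw [integral_eq_chartInt hO (hKc x) hx (hsm x).dForm ((hv x).dForm (hKc x).isClosed),
    chartInt_dForm (hKc x) hx (hsm x) (hv x)]

lemma integral_interior (X : VField D M) (η : Form D M) : integral (interior X η) = 0 := by
  rw [integral_eq]
  refine finsum_eq_zero_of_forall_eq_zero fun x => ?_
  rw [chartInt]
  refine setIntegral_eq_zero_of_forall_eq_zero fun y hy => ?_
  rw [localForm_mulF, localForm_interior X η x hy, ← topCoeffL_apply, map_smul, topCoeffL_apply,
    con, topCoeff_contractLeft, smul_zero]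

/-- By Cartan's formula a Lie derivative is an exact form, treated by Stokes, plus a contraction,
which has no component of top degree. -/
lemma integral_lieD (hO : OrientedAtlas D M) {K : Set M} (hK : IsCompact K) {X : VField D M}
    (hX : SmoothVField X) {η : Form D M} (hη : SmoothForm η) (h : VanishOff K η) :
    integral (lieD X η) = 0 := by
  rw [lieD, integral_add hK (hη.interior hX).dForm ((h.interior X).dForm hK.isClosed)
    (hη.dForm.interior hX) ((h.dForm hK.isClosed).interior X),
    integral_dForm hO hK (hη.interior hX) (h.interior X), integral_interior, add_zero]

/-- The partition of unity is real, so conjugation acts on each chart integral only through the top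
coefficient. -/
lemma integral_starF {ε : ℂ}
    (hε : extStar (covConj (Eucl D)) (dxS D Finset.univ) = ε • dxS D Finset.univ)
    (η : Form D M) : integral (starF η) = ε * conj (integral η) := by
  have h1 : ∀ x : M, chartInt x (mulF (rho D x) (starF η)) =
      ε • conj (chartInt x (mulF (rho D x) η)) := by
    intro x
    rw [chartInt, chartInt, smul_eq_mul, ← integral_conj, ← MeasureTheory.integral_const_mul]
    refine integral_congr_ae (Filter.Eventually.of_forall fun y => ?_)
    simp only
    rw [← topCoeff_extStar hε, localForm_mulF, localForm_starF_apply, localForm_mulF, extStar_smul,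
      rho, Complex.conj_ofReal]
  rw [integral_eq, integral_eq, finsum_congr h1, ← smul_finsum, smul_eq_mul]
  congr 1
  -- Conjugation is injective, hence preserves the support of the summands and commutes with `∑ᶠ`
  -- without a finiteness hypothesis.
  exact ((starRingEnd ℂ : ℂ →+* ℂ).toAddMonoidHom.map_finsum_of_injective
    (starRingEnd ℂ).injective _).symm

/-- Fundamental lemma of the calculus of variations. -/
lemma topCoeff_eq_zero_of_integral (hO : OrientedAtlas D M) {η : Form D M} (hη : SmoothForm η)
    (h : ∀ f : M → ℝ, ContMDiff (𝓡 D) 𝓘(ℝ, ℝ) ∞ f → HasCompactSupport f →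
      integral (mulF (fun p => (f p : ℂ)) η) = 0) (x : M) :
    ∀ y ∈ (extChartAt (𝓡 D) x).target, topCoeff (localForm x η y) = 0 := by
  set U := (extChartAt (𝓡 D) x).target with hUdef
  have hU : IsOpen U := isOpen_target x
  have hcont : ContinuousOn (fun y => topCoeff (localForm x η y)) U :=
    (contDiffOn_topCoeff (hη x)).continuousOn
  have hae : ∀ᵐ y ∂(volume : Measure (Eucl D)), y ∈ U → topCoeff (localForm x η y) = 0 := by
    refine hU.ae_eq_zero_of_integral_contDiff_smul_eq_zero
      (hcont.locallyIntegrableOn hU.measurableSet) fun g hg hgc hgU => ?_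
    -- A bump function of the chart, extended by zero to `M`; it is smooth because its support is
    -- compact inside the chart domain.
    set f : M → ℝ := (extChartAt (𝓡 D) x).source.indicator (g ∘ extChartAt (𝓡 D) x) with hf
    set K : Set M := (extChartAt (𝓡 D) x).symm '' tsupport g with hKdef
    have hK : IsCompact K :=
      hgc.isCompact.image_of_continuousOn ((continuousOn_extChartAt_symm x).mono hgU)
    have hKx : K ⊆ (extChartAt (𝓡 D) x).source := by
      rintro _ ⟨y, hy, rfl⟩
      exact (extChartAt (𝓡 D) x).map_target (hgU hy)
    have hf0 : ∀ p ∉ K, f p = 0 := by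
      intro p hp
      by_cases hps : p ∈ (extChartAt (𝓡 D) x).source
      · rw [hf, Set.indicator_of_mem hps]
        exact image_eq_zero_of_notMem_tsupport (f := g) fun hp' =>
          hp ⟨_, hp', (extChartAt (𝓡 D) x).left_inv hps⟩
      · rw [hf, Set.indicator_of_notMem hps]
    have hfs : ContMDiff (𝓡 D) 𝓘(ℝ, ℝ) ∞ f := by
      intro p
      by_cases hps : p ∈ (extChartAt (𝓡 D) x).source
      · have h1 : ContMDiffAt (𝓡 D) 𝓘(ℝ, ℝ) ∞ (g ∘ extChartAt (𝓡 D) x) p :=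
          hg.contMDiff.contMDiffAt.comp p (contMDiffAt_extChartAt'
            (by rwa [← extChartAt_source (𝓡 D)]))
        refine h1.congr_of_eventuallyEq ?_
        filter_upwards [(isOpen_extChartAt_source x).mem_nhds hps] with q hq
        exact Set.indicator_of_mem hq _
      · refine (contMDiffAt_const (c := (0 : ℝ))).congr_of_eventuallyEq ?_
        filter_upwards [hK.isClosed.isOpen_compl.mem_nhds fun h => hps (hKx h)] with q hq
        exact hf0 q hq
    have h2 := h f hfs (HasCompactSupport.intro hK hf0)
    have hfs' : ContMDiff (𝓡 D) 𝓘(ℝ, ℂ) ∞ fun p => (f p : ℂ) :=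
      Complex.ofRealCLM.contDiff.contMDiff.comp hfs
    rw [integral_eq_chartInt hO hK hKx (hη.mulF hfs')
      (fun p hp => by rw [mulF, hf0 p hp, Complex.ofReal_zero, zero_smul])] at h2
    rw [← h2, chartInt, ← hUdef, ← setIntegral_eq_integral_of_forall_compl_eq_zero (s := U)]
    · refine setIntegral_congr_fun hU.measurableSet fun y hy => ?_
      rw [localForm_mulF, hf, Set.indicator_of_mem ((extChartAt (𝓡 D) x).map_target hy),
        Function.comp_apply, (extChartAt (𝓡 D) x).right_inv hy, ← topCoeffL_apply,
        ← topCoeffL_apply, map_smul]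
      rfl
    · intro y hy
      rw [image_eq_zero_of_notMem_tsupport fun hy' => hy (hgU hy'), zero_smul]
  have hae' : (fun y => topCoeff (localForm x η y)) =ᵐ[volume.restrict U] fun _ => 0 := by
    rwa [Filter.EventuallyEq, ae_restrict_iff' hU.measurableSet]
  -- Vanishing almost everywhere on an open set becomes vanishing everywhere by continuity.
  exact MeasureTheory.Measure.eqOn_open_of_ae_eq hae' hU hcont continuousOn_const

end Integration

/-! ### Star products of power series with coefficients in an algebra -/

open scoped TensorProduct
open Finset.HasAntidiagonal (antidiagonal)

/-- Commuting derivations of a complex star algebra and an antisymmetric matrix. -/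
structure TwistData (A : Type*) [Ring A] [Algebra ℂ A] [StarRing A] where
  m : ℕ
  Θ : Matrix (Fin m) (Fin m) ℝ
  antisymm : Θᵀ = -Θ
  L : Fin m → A →ₗ[ℂ] A
  leibniz : ∀ α a b, L α (a * b) = L α a * b + a * L α b
  comm : ∀ α β a, L α (L β a) = L β (L α a)
  star_L : ∀ α a, star (L α a) = L α (star a)

namespace TwistData

variable {A : Type*} [Ring A] [Algebra ℂ A] [StarRing A] (t : TwistData A)

/-- The bidifferential operator `(i/2) Θ^{αβ} L_α ⊗ L_β`. -/
def bidiff : Module.End ℂ (A ⊗[ℂ] A) :=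
  ∑ α, ∑ β, (Complex.I / 2 * (t.Θ α β : ℂ)) • TensorProduct.map (t.L α) (t.L β)

/-- The coefficient of `λ^k` in the star product. -/
def term (k : ℕ) (a b : A) : A :=
  ((k.factorial : ℂ)⁻¹) • LinearMap.mul' ℂ A ((t.bidiff ^ k) (a ⊗ₜ b))

lemma term_zero (a b : A) : t.term 0 a b = a * b := by simp [term]

/-- Peels one factor off the power of `bidiff`. This is the recursion that defines `starTerm`, with
the factorial distributed as `1/(k+1)` at each step. -/
lemma term_succ (k : ℕ) (a b : A) : t.term (k + 1) a b =
    ∑ α, ∑ β, (Complex.I / 2 * (t.Θ α β : ℂ) / ((k : ℂ) + 1)) •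
      t.term k (t.L α a) (t.L β b) := by
  have h : t.bidiff (a ⊗ₜ b) =
      ∑ α, ∑ β, (Complex.I / 2 * (t.Θ α β : ℂ)) • (t.L α a ⊗ₜ[ℂ] t.L β b) := by
    simp [bidiff, LinearMap.sum_apply]
  rw [term, pow_succ, Module.End.mul_apply, h]
  simp only [map_sum, map_smul, Finset.smul_sum, term]
  refine Finset.sum_congr rfl fun α _ => Finset.sum_congr rfl fun β _ => ?_
  rw [smul_smul, smul_smul, Nat.factorial_succ, Nat.cast_mul, mul_inv, Nat.cast_succ]
  congr 1
  ring

lemma term_add_left (k : ℕ) (a a' b : A) : t.term k (a + a') b = t.term k a b + t.term k a' b := by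
  simp [term, TensorProduct.add_tmul]

lemma term_add_right (k : ℕ) (a b b' : A) : t.term k a (b + b') = t.term k a b + t.term k a b' := by
  simp [term, TensorProduct.tmul_add]

lemma term_smul_left (k : ℕ) (c : ℂ) (a b : A) : t.term k (c • a) b = c • t.term k a b := by
  rw [term, term, ← TensorProduct.smul_tmul', map_smul, map_smul, smul_comm]

lemma term_smul_right (k : ℕ) (c : ℂ) (a b : A) : t.term k a (c • b) = c • t.term k a b := by
  rw [term, term, TensorProduct.tmul_smul, map_smul, map_smul, smul_comm]

lemma term_zero_left (k : ℕ) (b : A) : t.term k 0 b = 0 := by simp [term]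

lemma term_zero_right (k : ℕ) (a : A) : t.term k a 0 = 0 := by simp [term]

lemma term_sum_left {ι : Type*} (s : Finset ι) (k : ℕ) (a : ι → A) (b : A) :
    t.term k (∑ i ∈ s, a i) b = ∑ i ∈ s, t.term k (a i) b := by
  simp [term, TensorProduct.sum_tmul, Finset.smul_sum]

lemma term_sum_right {ι : Type*} (s : Finset ι) (k : ℕ) (a : A) (b : ι → A) :
    t.term k a (∑ i ∈ s, b i) = ∑ i ∈ s, t.term k a (b i) := by
  simp [term, TensorProduct.tmul_sum, Finset.smul_sum]

/-- The operator `(i/2) Θ^{αβ} L_α ⊗ L_β ⊗ 1`. -/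
def op12 : Module.End ℂ ((A ⊗[ℂ] A) ⊗[ℂ] A) :=
  ∑ α, ∑ β, (Complex.I / 2 * (t.Θ α β : ℂ)) •
    TensorProduct.map (TensorProduct.map (t.L α) (t.L β)) LinearMap.id

/-- The operator `(i/2) Θ^{αβ} L_α ⊗ 1 ⊗ L_β`. -/
def op13 : Module.End ℂ ((A ⊗[ℂ] A) ⊗[ℂ] A) :=
  ∑ α, ∑ β, (Complex.I / 2 * (t.Θ α β : ℂ)) •
    TensorProduct.map (TensorProduct.map (t.L α) LinearMap.id) (t.L β)

/-- The operator `(i/2) Θ^{αβ} 1 ⊗ L_α ⊗ L_β`. -/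
def op23 : Module.End ℂ ((A ⊗[ℂ] A) ⊗[ℂ] A) :=
  ∑ α, ∑ β, (Complex.I / 2 * (t.Θ α β : ℂ)) •
    TensorProduct.map (TensorProduct.map LinearMap.id (t.L α)) (t.L β)

variable (A) in
/-- Multiplication of the first two factors. -/
def mulFst : (A ⊗[ℂ] A) ⊗[ℂ] A →ₗ[ℂ] A ⊗[ℂ] A :=
  TensorProduct.map (LinearMap.mul' ℂ A) LinearMap.id

variable (A) in
/-- Multiplication of the last two factors. -/
def mulSnd : (A ⊗[ℂ] A) ⊗[ℂ] A →ₗ[ℂ] A ⊗[ℂ] A :=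
  (TensorProduct.map LinearMap.id (LinearMap.mul' ℂ A)).comp
    (TensorProduct.assoc ℂ A A A).toLinearMap

lemma commute_sum {E ι ι' : Type*} [Fintype ι] [Fintype ι'] [Ring E] [Algebra ℂ E]
    (c : ι → ι → ℂ) (f : ι → ι → E) (c' : ι' → ι' → ℂ) (g : ι' → ι' → E)
    (h : ∀ a b a' b', Commute (f a b) (g a' b')) :
    Commute (∑ a, ∑ b, c a b • f a b) (∑ a, ∑ b, c' a b • g a b) :=
  Commute.sum_left _ _ _ fun a _ => Commute.sum_left _ _ _ fun b _ =>
    Commute.sum_right _ _ _ fun a' _ => Commute.sum_right _ _ _ fun b' _ =>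
      ((h a b a' b').smul_left _).smul_right _

lemma commute_op12_op13 : Commute t.op12 t.op13 := by
  refine commute_sum (E := Module.End ℂ ((A ⊗[ℂ] A) ⊗[ℂ] A)) _ _ _ _ fun α β α' β' => ?_
  refine TensorProduct.ext_threefold fun a b c => ?_
  simp [t.comm α α']

lemma commute_op12_op23 : Commute t.op12 t.op23 := by
  refine commute_sum (E := Module.End ℂ ((A ⊗[ℂ] A) ⊗[ℂ] A)) _ _ _ _ fun α β α' β' => ?_
  refine TensorProduct.ext_threefold fun a b c => ?_
  simp [t.comm β α']

lemma commute_op13_op23 : Commute t.op13 t.op23 := by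
  refine commute_sum (E := Module.End ℂ ((A ⊗[ℂ] A) ⊗[ℂ] A)) _ _ _ _ fun α β α' β' => ?_
  refine TensorProduct.ext_threefold fun a b c => ?_
  simp [t.comm β β']

/-- The Leibniz rule: acting on a product in the first slot is acting on either of its factors. This
is the compatibility of the twist with multiplication on which associativity rests. -/
lemma bidiff_mulFst : t.bidiff.comp (mulFst A) = (mulFst A).comp (t.op13 + t.op23) := by
  refine TensorProduct.ext_threefold fun a b c => ?_
  simp [bidiff, op13, op23, mulFst, LinearMap.sum_apply, t.leibniz, TensorProduct.add_tmul,
    Finset.sum_add_distrib]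

lemma bidiff_mulSnd : t.bidiff.comp (mulSnd A) = (mulSnd A).comp (t.op12 + t.op13) := by
  refine TensorProduct.ext_threefold fun a b c => ?_
  simp [bidiff, op12, op13, mulSnd, LinearMap.sum_apply, t.leibniz, TensorProduct.tmul_add,
    Finset.sum_add_distrib]

lemma mul_mulFst : (LinearMap.mul' ℂ A).comp (mulFst A) = (LinearMap.mul' ℂ A).comp (mulSnd A) := by
  refine TensorProduct.ext_threefold fun a b c => ?_
  simp [mulFst, mulSnd, mul_assoc]

lemma pow_intertwine {E F : Type*} [AddCommGroup E] [Module ℂ E] [AddCommGroup F] [Module ℂ F]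
    {P : F →ₗ[ℂ] F} {Q : E →ₗ[ℂ] E} {f : E →ₗ[ℂ] F} (h : P.comp f = f.comp Q) (k : ℕ) (x : E) :
    (P ^ k) (f x) = f ((Q ^ k) x) := by
  induction k generalizing x with
  | zero => simp
  | succ k ih =>
    rw [pow_succ, pow_succ, Module.End.mul_apply, Module.End.mul_apply, ← ih]
    congr 1
    exact LinearMap.congr_fun h x

lemma op12_pow (k : ℕ) (a b c : A) :
    (t.op12 ^ k) ((a ⊗ₜ b) ⊗ₜ c) = ((t.bidiff ^ k) (a ⊗ₜ b)) ⊗ₜ[ℂ] c := by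
  have h : t.op12.comp ((TensorProduct.mk ℂ (A ⊗[ℂ] A) A).flip c) =
      ((TensorProduct.mk ℂ (A ⊗[ℂ] A) A).flip c).comp t.bidiff := by
    refine TensorProduct.ext' fun a b => ?_
    simp [op12, bidiff, TensorProduct.smul_tmul']
  exact pow_intertwine h k (a ⊗ₜ b)

lemma op23_pow (k : ℕ) (a b c : A) :
    (TensorProduct.assoc ℂ A A A) ((t.op23 ^ k) ((a ⊗ₜ b) ⊗ₜ c)) =
      a ⊗ₜ[ℂ] ((t.bidiff ^ k) (b ⊗ₜ c)) := by
  let f : A ⊗[ℂ] A →ₗ[ℂ] (A ⊗[ℂ] A) ⊗[ℂ] A :=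
    (TensorProduct.assoc ℂ A A A).symm.toLinearMap.comp (TensorProduct.mk ℂ A (A ⊗[ℂ] A) a)
  have h : t.op23.comp f = f.comp t.bidiff := by
    refine TensorProduct.ext' fun b c => ?_
    simp [f, op23, bidiff]
  have h2 := pow_intertwine h k (b ⊗ₜ c)
  simp only [f, LinearMap.comp_apply, TensorProduct.mk_apply, LinearEquiv.coe_coe,
    TensorProduct.assoc_symm_tmul] at h2
  rw [h2, LinearEquiv.apply_symm_apply]

/-- The coefficient of `λ^r` in the product of three factors. -/
def term3 (r : ℕ) (a b c : A) : A :=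
  LinearMap.mul' ℂ A (mulFst A (((r.factorial : ℂ)⁻¹ •
    (t.op12 + t.op13 + t.op23) ^ r) ((a ⊗ₜ b) ⊗ₜ c)))

/-- The order `r` part of `exp x · exp y = exp (x + y)` for commuting `x`, `y`. -/
lemma sum_pow_div_factorial {E : Type*} [Ring E] [Algebra ℂ E] {x y : E} (h : Commute x y)
    (r : ℕ) : ∑ k ∈ antidiagonal r,
      (((k.1.factorial : ℂ)⁻¹ • x ^ k.1) * ((k.2.factorial : ℂ)⁻¹ • y ^ k.2)) =
        (r.factorial : ℂ)⁻¹ • (x + y) ^ r := by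
  rw [h.add_pow', Finset.smul_sum]
  refine Finset.sum_congr rfl fun k hk => ?_
  have hk' : k.1 + k.2 = r := Finset.HasAntidiagonal.mem_antidiagonal.1 hk
  rw [smul_mul_smul_comm, ← Nat.cast_smul_eq_nsmul ℂ, smul_smul]
  congr 1
  have h1 := Nat.choose_mul_factorial_mul_factorial (Nat.le_add_right k.1 k.2)
  rw [Nat.add_sub_cancel_left, hk'] at h1
  have h2 : ∀ n : ℕ, (n.factorial : ℂ) ≠ 0 := fun n => by exact_mod_cast n.factorial_ne_zero
  have h3 : (r.choose k.1 : ℂ) * k.1.factorial * k.2.factorial = r.factorial := by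
    exact_mod_cast h1
  have := h2 k.1
  have := h2 k.2
  have := h2 r
  field_simp
  rw [← h3]
  ring

/-- By `bidiff_mulFst` the left bracketing applies `exp (P₁₃ + P₂₃) · exp P₁₂`, with `Pᵢⱼ` the twist
operator in slots `i, j`. The three operators commute because the derivations do, so this is `exp
(P₁₂ + P₁₃ + P₂₃)`, an expression that favours no bracketing; the next lemma reaches it from the
right. -/
lemma sum_term_term_left (r : ℕ) (a b c : A) :
    ∑ k ∈ antidiagonal r, t.term k.1 (t.term k.2 a b) c = t.term3 r a b c := by
  have hc : Commute (t.op13 + t.op23) t.op12 :=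
    (t.commute_op12_op13.symm.add_left t.commute_op12_op23.symm)
  have h1 := sum_pow_div_factorial (E := Module.End ℂ ((A ⊗[ℂ] A) ⊗[ℂ] A)) hc r
  rw [term3, add_assoc, add_comm t.op12, ← h1, LinearMap.sum_apply, map_sum, map_sum]
  refine Finset.sum_congr rfl fun k _ => ?_
  rw [Module.End.mul_apply, LinearMap.smul_apply, LinearMap.smul_apply, op12_pow, map_smul,
    ← pow_intertwine t.bidiff_mulFst]
  simp [term, mulFst, TensorProduct.smul_tmul']

lemma sum_term_term_right (r : ℕ) (a b c : A) :
    ∑ k ∈ antidiagonal r, t.term k.1 a (t.term k.2 b c) = t.term3 r a b c := by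
  have hc : Commute (t.op12 + t.op13) t.op23 :=
    (t.commute_op12_op23.add_left t.commute_op13_op23)
  have h1 := LinearMap.congr_fun (mul_mulFst (A := A)) (((r.factorial : ℂ)⁻¹ •
    (t.op12 + t.op13 + t.op23) ^ r) ((a ⊗ₜ b) ⊗ₜ c))
  rw [LinearMap.comp_apply, LinearMap.comp_apply] at h1
  have h2 := sum_pow_div_factorial (E := Module.End ℂ ((A ⊗[ℂ] A) ⊗[ℂ] A)) hc r
  rw [term3, h1, ← h2, LinearMap.sum_apply, map_sum, map_sum]
  refine Finset.sum_congr rfl fun k _ => ?_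
  rw [Module.End.mul_apply, LinearMap.smul_apply, LinearMap.smul_apply, map_smul,
    map_smul, map_smul, map_smul, ← pow_intertwine t.bidiff_mulSnd, mulSnd, LinearMap.comp_apply,
    LinearEquiv.coe_coe, op23_pow]
  simp [term, TensorProduct.tmul_smul]

/-- The derivations commute among themselves, so each of them passes through the bidifferential
operator and remains a derivation of the deformed product. -/
lemma L_term (α : Fin t.m) (k : ℕ) (a b : A) :
    t.L α (t.term k a b) = t.term k (t.L α a) b + t.term k a (t.L α b) := by
  induction k generalizing a b with
  | zero => simp only [term_zero, t.leibniz]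
  | succ k ih =>
    simp only [term_succ, map_sum, map_smul, ih, ← Finset.sum_add_distrib, ← smul_add]
    refine Finset.sum_congr rfl fun β _ => Finset.sum_congr rfl fun γ _ => ?_
    rw [t.comm α β, t.comm α γ]

/-- Algebra maps that commute with the derivations are compatible with star products. -/
lemma map_term (F : A →ₐ[ℂ] A) (hF : ∀ α a, F (t.L α a) = t.L α (F a)) (k : ℕ) (a b : A) :
    F (t.term k a b) = t.term k (F a) (F b) := by
  induction k generalizing a b with
  | zero => simp only [term_zero, map_mul]
  | succ k ih => simp only [term_succ, map_sum, map_smul, ih, hF]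

/-- Skew derivations that commute with the derivations are skew derivations of star products. -/
lemma deriv_term (d : A →ₗ[ℂ] A) (σ : A →ₐ[ℂ] A) (hσ : ∀ α a, σ (t.L α a) = t.L α (σ a))
    (hd : ∀ α a, d (t.L α a) = t.L α (d a)) (h : ∀ a b, d (a * b) = d a * b + σ a * d b)
    (k : ℕ) (a b : A) :
    d (t.term k a b) = t.term k (d a) b + t.term k (σ a) (d b) := by
  induction k generalizing a b with
  | zero => simp only [term_zero, h]
  | succ k ih =>
    simp only [term_succ, map_sum, map_smul, ih, ← Finset.sum_add_distrib, ← smul_add, hσ, hd]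

/-- Used for supports: forms vanishing off a closed set are stable under Lie derivatives and
multiplication, which is all that the recursion for `term` requires. -/
lemma term_mem_of_left {I : Submodule ℂ A} (hL : ∀ α, ∀ a ∈ I, t.L α a ∈ I)
    (hI : ∀ a ∈ I, ∀ b, a * b ∈ I) (k : ℕ) {a : A} (ha : a ∈ I) (b : A) : t.term k a b ∈ I := by
  induction k generalizing a b with
  | zero => rw [term_zero]; exact hI a ha b
  | succ k ih =>
    rw [term_succ]
    exact I.sum_mem fun α _ => I.sum_mem fun β _ => I.smul_mem _ (ih (hL α a ha) _)

lemma term_mem_of_right {I : Submodule ℂ A} (hL : ∀ α, ∀ a ∈ I, t.L α a ∈ I)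
    (hI : ∀ a ∈ I, ∀ b, b * a ∈ I) (k : ℕ) {a : A} (ha : a ∈ I) (b : A) : t.term k b a ∈ I := by
  induction k generalizing a b with
  | zero => rw [term_zero]; exact hI a ha b
  | succ k ih =>
    rw [term_succ]
    exact I.sum_mem fun α _ => I.sum_mem fun β _ => I.smul_mem _ (ih (hL β a ha) _)

lemma Θ_swap (α β : Fin t.m) : t.Θ β α = -t.Θ α β := by
  have := congrFun (congrFun t.antisymm α) β
  simpa using this

/-- The higher terms of the star product are derivatives. -/
lemma term_succ_eq_L (k : ℕ) (a b : A) : t.term (k + 1) a b =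
    ∑ α, t.L α (∑ β, (Complex.I / 2 * (t.Θ α β : ℂ) / ((k : ℂ) + 1)) •
      t.term k a (t.L β b)) := by
  -- Pulling `L α` out of both factors creates an error with `L α (L β b)` in the second one. It is
  -- symmetric in `α, β`, so contraction with the antisymmetric `Θ` kills it.
  have h0 : ∑ α, ∑ β, (Complex.I / 2 * (t.Θ α β : ℂ) / ((k : ℂ) + 1)) •
      t.term k a (t.L α (t.L β b)) = 0 := by
    set S := ∑ α, ∑ β, (Complex.I / 2 * (t.Θ α β : ℂ) / ((k : ℂ) + 1)) •
      t.term k a (t.L α (t.L β b)) with hS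
    have h : S = -S := by
      conv_rhs => rw [hS, Finset.sum_comm]
      rw [hS, ← Finset.sum_neg_distrib]
      refine Finset.sum_congr rfl fun α _ => ?_
      rw [← Finset.sum_neg_distrib]
      refine Finset.sum_congr rfl fun β _ => ?_
      rw [t.comm β α, t.Θ_swap α β, ← neg_smul]
      congr 1
      push_cast
      ring
    have h3 : (2 : ℂ) • S = 0 := by
      rw [two_smul]
      nth_rewrite 1 [h]
      exact neg_add_cancel S
    exact (smul_eq_zero.1 h3).resolve_left two_ne_zero
  simp only [map_sum, map_smul, L_term, smul_add, Finset.sum_add_distrib]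
  rw [h0, add_zero, term_succ]

/-- Conjugation sends `i` to `-i`; exchanging the factors transposes `Θ`, which is another sign. The
two cancel at each order. -/
lemma star_term [StarModule ℂ A] (k : ℕ) (a b : A) :
    star (t.term k a b) = t.term k (star b) (star a) := by
  induction k generalizing a b with
  | zero => simp only [term_zero, star_mul]
  | succ k ih =>
    simp only [term_succ, star_sum, star_smul, ih, t.star_L]
    rw [Finset.sum_comm]
    refine Finset.sum_congr rfl fun α _ => Finset.sum_congr rfl fun β _ => ?_
    rw [t.Θ_swap α β]
    congr 1
    simp
    ring

end TwistData

/-- Power series with coefficients in `A`, to be multiplied by the star product. -/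
def StarSeries {A : Type*} [Ring A] [Algebra ℂ A] [StarRing A] (_ : TwistData A) : Type _ := ℕ → A

/-! ### The ring of power series under the star product -/

namespace StarSeries

variable {A : Type*} [Ring A] [Algebra ℂ A] [StarRing A] {t : TwistData A}

instance : AddCommGroup (StarSeries t) := inferInstanceAs (AddCommGroup (ℕ → A))

instance : Module ℂ (StarSeries t) := inferInstanceAs (Module ℂ (ℕ → A))

/-- Coefficient of `λ^n`. -/
def coeff (n : ℕ) : StarSeries t →ₗ[ℂ] A := LinearMap.proj n

/-- The power series with given coefficients. -/
def mk (a : ℕ → A) : StarSeries t := a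

lemma coeff_mk (n : ℕ) (a : ℕ → A) : coeff n (mk a : StarSeries t) = a n := rfl

lemma ext {a b : StarSeries t} (h : ∀ n, coeff n a = coeff n b) : a = b := funext h

instance : Mul (StarSeries t) := ⟨fun a b => mk fun n =>
  ∑ p ∈ antidiagonal n, ∑ q ∈ antidiagonal p.2, t.term p.1 (coeff q.1 a) (coeff q.2 b)⟩

lemma coeff_mul (n : ℕ) (a b : StarSeries t) : coeff n (a * b) =
    ∑ p ∈ antidiagonal n, ∑ q ∈ antidiagonal p.2, t.term p.1 (coeff q.1 a) (coeff q.2 b) := rfl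

instance : One (StarSeries t) := ⟨mk fun n => if n = 0 then 1 else 0⟩

lemma coeff_one (n : ℕ) : coeff n (1 : StarSeries t) = if n = 0 then 1 else 0 := rfl

lemma sum_antidiagonal_assoc {B : Type*} [AddCommMonoid B] (f : ℕ → ℕ → ℕ → B) (n : ℕ) :
    ∑ p ∈ antidiagonal n, ∑ q ∈ antidiagonal p.1, f q.1 q.2 p.2 =
      ∑ p ∈ antidiagonal n, ∑ q ∈ antidiagonal p.2, f p.1 q.1 q.2 := by
  rw [Finset.sum_sigma', Finset.sum_sigma']
  refine Finset.sum_bij' (fun x _ => ⟨(x.2.1, x.2.2 + x.1.2), (x.2.2, x.1.2)⟩)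
    (fun x _ => ⟨(x.1.1 + x.2.1, x.2.2), (x.1.1, x.2.1)⟩) ?_ ?_ ?_ ?_ ?_
  · rintro ⟨⟨a, b⟩, ⟨c, d⟩⟩ h
    simp only [Finset.mem_sigma, Finset.HasAntidiagonal.mem_antidiagonal] at h ⊢
    obtain ⟨h1, h2⟩ := h
    exact ⟨by omega, trivial⟩
  · rintro ⟨⟨a, b⟩, ⟨c, d⟩⟩ h
    simp only [Finset.mem_sigma, Finset.HasAntidiagonal.mem_antidiagonal] at h ⊢
    obtain ⟨h1, h2⟩ := h
    exact ⟨by omega, trivial⟩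
  · rintro ⟨⟨a, b⟩, ⟨c, d⟩⟩ h
    simp only [Finset.mem_sigma, Finset.HasAntidiagonal.mem_antidiagonal] at h ⊢
    obtain ⟨_, rfl⟩ := h
    rfl
  · rintro ⟨⟨a, b⟩, ⟨c, d⟩⟩ h
    simp only [Finset.mem_sigma, Finset.HasAntidiagonal.mem_antidiagonal] at h ⊢
    obtain ⟨_, rfl⟩ := h
    rfl
  · rintro ⟨⟨a, b⟩, ⟨c, d⟩⟩ _
    rfl

lemma sum_antidiagonal_left_comm {B : Type*} [AddCommMonoid B] (f : ℕ → ℕ → ℕ → B) (n : ℕ) :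
    ∑ p ∈ antidiagonal n, ∑ q ∈ antidiagonal p.2, f p.1 q.1 q.2 =
      ∑ p ∈ antidiagonal n, ∑ q ∈ antidiagonal p.2, f q.1 p.1 q.2 := by
  rw [← sum_antidiagonal_assoc, ← sum_antidiagonal_assoc (fun a b c => f b a c)]
  refine Finset.sum_congr rfl fun p _ => ?_
  exact (Finset.Nat.sum_antidiagonal_swap (f := fun q => f q.1 q.2 p.2) (n := p.1)).symm

/-- Both sides are rearranged so that the orders of the two inner twists are summed first, at fixed
total twist order and fixed coefficients of the factors. Each inner sum is then the symmetric
`term3`. -/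
lemma star_mul_assoc (a b c : StarSeries t) : a * b * c = a * (b * c) := by
  refine ext fun n => ?_
  have hl : coeff n (a * b * c) = ∑ p ∈ antidiagonal n, ∑ q ∈ antidiagonal p.2,
      ∑ r ∈ antidiagonal q.1, t.term3 p.1 (coeff r.1 a) (coeff r.2 b) (coeff q.2 c) := by
    simp only [coeff_mul, TwistData.term_sum_left]
    have h1 : ∀ p ∈ antidiagonal n, ∑ q ∈ antidiagonal p.2, ∑ r ∈ antidiagonal q.1,
        ∑ s ∈ antidiagonal r.2,
          t.term p.1 (t.term r.1 (coeff s.1 a) (coeff s.2 b)) (coeff q.2 c) =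
        ∑ q ∈ antidiagonal p.2, ∑ r ∈ antidiagonal q.2, ∑ s ∈ antidiagonal r.1,
          t.term p.1 (t.term q.1 (coeff s.1 a) (coeff s.2 b)) (coeff r.2 c) := fun p _ =>
      sum_antidiagonal_assoc (fun l m j => ∑ s ∈ antidiagonal m,
        t.term p.1 (t.term l (coeff s.1 a) (coeff s.2 b)) (coeff j c)) p.2
    rw [Finset.sum_congr rfl h1, ← sum_antidiagonal_assoc (fun k l q => ∑ r ∈ antidiagonal q,
      ∑ s ∈ antidiagonal r.1, t.term k (t.term l (coeff s.1 a) (coeff s.2 b)) (coeff r.2 c))]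
    refine Finset.sum_congr rfl fun p _ => ?_
    rw [Finset.sum_comm]
    refine Finset.sum_congr rfl fun q _ => ?_
    rw [Finset.sum_comm]
    refine Finset.sum_congr rfl fun r _ => ?_
    exact t.sum_term_term_left p.1 _ _ _
  have hr : coeff n (a * (b * c)) = ∑ p ∈ antidiagonal n, ∑ q ∈ antidiagonal p.2,
      ∑ r ∈ antidiagonal q.2, t.term3 p.1 (coeff q.1 a) (coeff r.1 b) (coeff r.2 c) := by
    simp only [coeff_mul, TwistData.term_sum_right]
    have h1 : ∀ p ∈ antidiagonal n, ∑ q ∈ antidiagonal p.2, ∑ r ∈ antidiagonal q.2,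
        ∑ s ∈ antidiagonal r.2,
          t.term p.1 (coeff q.1 a) (t.term r.1 (coeff s.1 b) (coeff s.2 c)) =
        ∑ q ∈ antidiagonal p.2, ∑ r ∈ antidiagonal q.2, ∑ s ∈ antidiagonal r.2,
          t.term p.1 (coeff r.1 a) (t.term q.1 (coeff s.1 b) (coeff s.2 c)) := fun p _ =>
      sum_antidiagonal_left_comm (fun u l m => ∑ s ∈ antidiagonal m,
        t.term p.1 (coeff u a) (t.term l (coeff s.1 b) (coeff s.2 c))) p.2
    rw [Finset.sum_congr rfl h1, ← sum_antidiagonal_assoc (fun k l q => ∑ r ∈ antidiagonal q,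
      ∑ s ∈ antidiagonal r.2, t.term k (coeff r.1 a) (t.term l (coeff s.1 b) (coeff s.2 c)))]
    refine Finset.sum_congr rfl fun p _ => ?_
    rw [Finset.sum_comm]
    refine Finset.sum_congr rfl fun q _ => ?_
    rw [Finset.sum_comm]
    refine Finset.sum_congr rfl fun r _ => ?_
    exact t.sum_term_term_right p.1 _ _ _
  rw [hl, hr]
  refine Finset.sum_congr rfl fun p _ => ?_
  exact sum_antidiagonal_assoc (fun u v j => t.term3 p.1 (coeff u a) (coeff v b) (coeff j c)) p.2

lemma L_one (α : Fin t.m) : t.L α 1 = 0 := by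
  have := t.leibniz α 1 1
  simpa using this

lemma term_one_left (k : ℕ) (b : A) : t.term k 1 b = if k = 0 then b else 0 := by
  cases k with
  | zero => simp [TwistData.term_zero]
  | succ k => simp [TwistData.term_succ, L_one, TwistData.term_zero_left]

lemma term_one_right (k : ℕ) (b : A) : t.term k b 1 = if k = 0 then b else 0 := by
  cases k with
  | zero => simp [TwistData.term_zero]
  | succ k => simp [TwistData.term_succ, L_one, TwistData.term_zero_right]

lemma star_one_mul (a : StarSeries t) : 1 * a = a := by
  refine ext fun n => ?_
  rw [coeff_mul, Finset.sum_eq_single (0, n), Finset.sum_eq_single (0, n)]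
  · simp [coeff_one, TwistData.term_zero]
  · rintro ⟨i, j⟩ hij h
    rw [Finset.HasAntidiagonal.mem_antidiagonal] at hij
    have : i ≠ 0 := by rintro rfl; simp_all
    simp [coeff_one, this, TwistData.term_zero_left]
  · simp
  · rintro ⟨i, j⟩ hij h
    rw [Finset.HasAntidiagonal.mem_antidiagonal] at hij
    have : i ≠ 0 := by rintro rfl; simp_all
    refine Finset.sum_eq_zero fun q _ => ?_
    rw [coeff_one]
    split_ifs
    · simp [term_one_left, this]
    · rw [TwistData.term_zero_left]
  · simp

lemma star_mul_one (a : StarSeries t) : a * 1 = a := by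
  refine ext fun n => ?_
  rw [coeff_mul, Finset.sum_eq_single (0, n), Finset.sum_eq_single (n, 0)]
  · simp [coeff_one, TwistData.term_zero]
  · rintro ⟨i, j⟩ hij h
    rw [Finset.HasAntidiagonal.mem_antidiagonal] at hij
    have : j ≠ 0 := by rintro rfl; simp_all
    simp [coeff_one, this, TwistData.term_zero_right]
  · simp
  · rintro ⟨i, j⟩ hij h
    rw [Finset.HasAntidiagonal.mem_antidiagonal] at hij
    have : i ≠ 0 := by rintro rfl; simp_all
    refine Finset.sum_eq_zero fun q _ => ?_
    rw [coeff_one]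
    split_ifs
    · simp [term_one_right, this]
    · rw [TwistData.term_zero_right]
  · simp

instance : Ring (StarSeries t) :=
  { (inferInstance : AddCommGroup (StarSeries t)) with
    mul := (· * ·)
    one := 1
    left_distrib := fun a b c => ext fun n => by
      simp only [map_add, coeff_mul, TwistData.term_add_right, Finset.sum_add_distrib]
    right_distrib := fun a b c => ext fun n => by
      simp only [map_add, coeff_mul, TwistData.term_add_left, Finset.sum_add_distrib]
    zero_mul := fun a => ext fun n => by simp [coeff_mul, TwistData.term_zero_left]
    mul_zero := fun a => ext fun n => by simp [coeff_mul, TwistData.term_zero_right]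
    mul_assoc := star_mul_assoc
    one_mul := star_one_mul
    mul_one := star_mul_one }

instance : Algebra ℂ (StarSeries t) :=
  Algebra.ofModule
    (fun c a b => ext fun n => by
      simp only [map_smul, coeff_mul, TwistData.term_smul_left, Finset.smul_sum])
    (fun c a b => ext fun n => by
      simp only [map_smul, coeff_mul, TwistData.term_smul_right, Finset.smul_sum])

instance [StarModule ℂ A] : StarRing (StarSeries t) where
  star a := mk fun n => star (coeff n a)
  star_involutive a := ext fun n => star_star _
  star_mul a b := ext fun n => by
    simp only [coeff_mul, coeff_mk, star_sum, TwistData.star_term]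
    refine Finset.sum_congr rfl fun p _ => ?_
    exact (Finset.Nat.sum_antidiagonal_swap (n := p.2) (f := fun q => t.term p.1 (star (coeff q.1 b))
      (star (coeff q.2 a))))
  star_add a b := ext fun n => star_add _ _

lemma coeff_star [StarModule ℂ A] (n : ℕ) (a : StarSeries t) :
    coeff n (star a) = star (coeff n a) := rfl

instance [StarModule ℂ A] : StarModule ℂ (StarSeries t) :=
  ⟨fun c a => ext fun n => by simp only [coeff_star, map_smul, star_smul]⟩

/-- Coefficientwise application of a linear map. -/
def mapCoeff (F : A →ₗ[ℂ] A) : StarSeries t →ₗ[ℂ] StarSeries t where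
  toFun a := mk fun n => F (coeff n a)
  map_add' a b := ext fun n => by simp only [coeff_mk, map_add]
  map_smul' c a := ext fun n => by simp only [coeff_mk, map_smul, RingHom.id_apply]

lemma coeff_mapCoeff (F : A →ₗ[ℂ] A) (n : ℕ) (a : StarSeries t) :
    coeff n (mapCoeff F a) = F (coeff n a) := rfl

lemma mapCoeff_mul (F : A →ₐ[ℂ] A) (hF : ∀ α a, F (t.L α a) = t.L α (F a)) (a b : StarSeries t) :
    mapCoeff F.toLinearMap (a * b) = mapCoeff F.toLinearMap a * mapCoeff F.toLinearMap b :=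
  ext fun n => by
    simp only [coeff_mapCoeff, coeff_mul, AlgHom.toLinearMap_apply, map_sum, t.map_term F hF]

lemma mapCoeff_deriv (d : A →ₗ[ℂ] A) (σ : A →ₐ[ℂ] A) (hσ : ∀ α a, σ (t.L α a) = t.L α (σ a))
    (hd : ∀ α a, d (t.L α a) = t.L α (d a)) (h : ∀ a b, d (a * b) = d a * b + σ a * d b)
    (a b : StarSeries t) : mapCoeff d (a * b) =
      mapCoeff d a * b + mapCoeff σ.toLinearMap a * mapCoeff d b :=
  ext fun n => by
    simp only [map_add, coeff_mapCoeff, coeff_mul, AlgHom.toLinearMap_apply, map_sum,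
      t.deriv_term d σ hσ hd h, Finset.sum_add_distrib]

end StarSeries

/-! ### The star algebra of formal power series of smooth forms -/

section FormSeries

open Finset.HasAntidiagonal (antidiagonal)

variable {D : ℕ} {M : Type*} [TopologicalSpace M] [ChartedSpace (Eucl D) M]
  [IsManifold (𝓡 D) ∞ M]

variable (D M) in
/-- The algebra of smooth forms. -/
def SForm : Type _ := smoothForms D M

instance : Ring (SForm D M) := inferInstanceAs (Ring (smoothForms D M))

instance : Algebra ℂ (SForm D M) := inferInstanceAs (Algebra ℂ (smoothForms D M))

lemma SForm.coe_sum {ι : Type*} (s : Finset ι) (a : ι → SForm D M) :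
    (∑ i ∈ s, a i).1 = ∑ i ∈ s, (a i).1 := by
  classical
  induction s using Finset.induction_on with
  | empty => rfl
  | insert i s hi ih =>
    rw [Finset.sum_insert hi, Finset.sum_insert hi, ← ih]
    rfl

lemma SForm.coe_smul (c : ℂ) (a : SForm D M) : (c • a).1 = c • a.1 := rfl

lemma starF_smul (c : ℂ) (η : Form D M) : starF (c • η) = conj c • starF η :=
  funext fun p => extStar_smul (covConj _) c (η p)

instance : StarRing (SForm D M) where
  star a := ⟨starF a.1, SmoothForm.starF a.2⟩
  star_involutive a := Subtype.ext (funext fun p =>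
    extStar_extStar (covConj _) covConj_covConj (a.1 p))
  star_mul a b := Subtype.ext (funext fun p => extStar_mul (covConj _) (a.1 p) (b.1 p))
  star_add a b := Subtype.ext (funext fun p => extStar_add (covConj _) (a.1 p) (b.1 p))

instance : StarModule ℂ (SForm D M) := ⟨fun c a => Subtype.ext (starF_smul c a.1)⟩

/-- Exterior derivative of smooth forms. -/
def dS : SForm D M →ₗ[ℂ] SForm D M where
  toFun a := ⟨dForm a.1, SmoothForm.dForm a.2⟩
  map_add' a b := Subtype.ext (dForm_add a.2 b.2)
  map_smul' c a := Subtype.ext (dForm_smul c a.2)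

/-- Multiplication of `k`-forms by `t ^ k`. -/
def scalS (t : ℂ) : SForm D M →ₐ[ℂ] SForm D M :=
  AlgHom.ofLinearMap
    { toFun := fun a => ⟨scalF t a.1, SmoothForm.scalF a.2 t⟩
      map_add' := fun a b => Subtype.ext (funext fun p => map_add (scal t) (a.1 p) (b.1 p))
      map_smul' := fun c a => Subtype.ext (funext fun p => map_smul (scal t) c (a.1 p)) }
    (Subtype.ext (funext fun _ => map_one (scal t)))
    (fun a b => Subtype.ext (funext fun p => map_mul (scal t) (a.1 p) (b.1 p)))

/-- Lie derivative of smooth forms. -/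
def lieS {X : VField D M} (hX : SmoothVField X) : SForm D M →ₗ[ℂ] SForm D M where
  toFun a := ⟨lieD X a.1, SmoothForm.lieD hX a.2⟩
  map_add' a b := Subtype.ext (lieD_add hX a.2 b.2)
  map_smul' c a := Subtype.ext (lieD_smul hX c a.2)

/-- The derivations of the algebra of smooth forms given by a twist. -/
def AbelianTwist.data (T : AbelianTwist D M) : TwistData (SForm D M) where
  m := T.m
  Θ := T.Θ
  antisymm := T.antisymm
  L α := lieS (T.smooth α)
  leibniz α a b := Subtype.ext (lieD_mul (T.smooth α) a.2 b.2)
  comm α β a := Subtype.ext (lieD_comm (T.smooth α) (T.smooth β) (T.commute α β) a.2)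
  star_L α a := Subtype.ext (lieD_starF (T.smooth α) a.2).symm

/-- Formal power series of smooth forms, with the star product. -/
def FormSeries (T : AbelianTwist D M) : Type _ := StarSeries T.data

variable {T : AbelianTwist D M}

lemma coe_term (k : ℕ) (a b : SForm D M) :
    (T.data.term k a b).1 = starTerm T k a.1 b.1 := by
  induction k generalizing a b with
  | zero => rw [TwistData.term_zero]; rfl
  | succ k ih =>
    rw [TwistData.term_succ, starTerm, SForm.coe_sum]
    refine Finset.sum_congr rfl fun α _ => ?_
    rw [SForm.coe_sum]
    refine Finset.sum_congr rfl fun β _ => ?_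
    rw [SForm.coe_smul, ih]
    rfl

namespace FormSeries

instance : Ring (FormSeries T) := inferInstanceAs (Ring (StarSeries T.data))

instance : Algebra ℂ (FormSeries T) := inferInstanceAs (Algebra ℂ (StarSeries T.data))

instance : StarRing (FormSeries T) := inferInstanceAs (StarRing (StarSeries T.data))

instance : StarModule ℂ (FormSeries T) := inferInstanceAs (StarModule ℂ (StarSeries T.data))

/-- Coefficient of `λ^n`. -/
def coeff (n : ℕ) : FormSeries T →ₗ[ℂ] SForm D M := StarSeries.coeff (t := T.data) n

lemma ext {a b : FormSeries T} (h : ∀ n, coeff n a = coeff n b) : a = b := funext h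

lemma coeff_mul (n : ℕ) (a b : FormSeries T) : coeff n (a * b) =
    ∑ p ∈ antidiagonal n, ∑ q ∈ antidiagonal p.2, T.data.term p.1 (coeff q.1 a) (coeff q.2 b) :=
  rfl

lemma coeff_one (n : ℕ) : coeff n (1 : FormSeries T) = if n = 0 then 1 else 0 := rfl

lemma coeff_star (n : ℕ) (a : FormSeries T) : coeff n (star a) = star (coeff n a) := rfl

/-- The power series with given coefficients. -/
def mk (a : ℕ → SForm D M) : FormSeries T := a

/-- The underlying sequence of forms. -/
def val (a : FormSeries T) : FForm D M := fun n => (coeff n a).1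

lemma val_add (a b : FormSeries T) : (a + b).val = a.val + b.val := rfl

lemma val_smul (c : ℂ) (a : FormSeries T) : (c • a).val = c • a.val := rfl

lemma val_injective : Function.Injective (val : FormSeries T → FForm D M) := fun _ _ h =>
  ext fun n => Subtype.ext (congrFun h n)

lemma val_sum {ι : Type*} (s : Finset ι) (a : ι → FormSeries T) :
    (∑ i ∈ s, a i).val = ∑ i ∈ s, (a i).val := by
  classical
  induction s using Finset.induction_on with
  | empty => rfl
  | insert i s hi ih => rw [Finset.sum_insert hi, Finset.sum_insert hi, val_add, ih]

lemma val_mul (a b : FormSeries T) : (a * b).val = wedgeStar T a.val b.val := by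
  funext n
  change (coeff n (a * b)).1 = _
  rw [coeff_mul, wedgeStar, SForm.coe_sum]
  refine Finset.sum_congr rfl fun p _ => ?_
  rw [SForm.coe_sum]
  exact Finset.sum_congr rfl fun q _ => coe_term _ _ _

/-- Exterior derivative. -/
def d : FormSeries T →ₗ[ℂ] FormSeries T := StarSeries.mapCoeff (t := T.data) dS

lemma coeff_d (n : ℕ) (a : FormSeries T) : coeff n (d a) = dS (coeff n a) := rfl

/-- Multiplication of `k`-forms by `t ^ k`. -/
def scal (t : ℂ) : FormSeries T →ₗ[ℂ] FormSeries T :=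
  StarSeries.mapCoeff (t := T.data) (scalS t).toLinearMap

lemma coeff_scal (t : ℂ) (n : ℕ) (a : FormSeries T) : coeff n (scal t a) = scalS t (coeff n a) :=
  rfl

lemma scalS_lie (t : ℂ) (α : Fin T.data.m) (a : SForm D M) :
    scalS t (T.data.L α a) = T.data.L α (scalS t a) :=
  Subtype.ext (lieD_scalF (T.smooth α) t a.2).symm

lemma scal_mul (t : ℂ) (a b : FormSeries T) : scal t (a * b) = scal t a * scal t b :=
  StarSeries.mapCoeff_mul (scalS t) (scalS_lie t) a b

lemma d_mul (a b : FormSeries T) : d (a * b) = d a * b + scal (-1) a * d b :=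
  StarSeries.mapCoeff_deriv dS (scalS (-1)) (scalS_lie (-1))
    (fun α a => Subtype.ext (lieD_dForm (T.smooth α) a.2).symm)
    (fun a b => Subtype.ext (dForm_mul a.2 b.2)) a b

lemma scal_d (t : ℂ) (a : FormSeries T) : scal t (d a) = t • d (scal t a) :=
  ext fun n => by
    rw [coeff_scal, coeff_d, map_smul, coeff_d, coeff_scal]
    exact Subtype.ext (scalF_dForm t (coeff n a).2)

/-- Homogeneous elements. -/
def IsDeg (k : ℕ) (a : FormSeries T) : Prop := ∀ t, scal t a = t ^ k • a

lemma IsDeg.add {k : ℕ} {a b : FormSeries T} (ha : IsDeg k a) (hb : IsDeg k b) :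
    IsDeg k (a + b) := fun t => by rw [map_add, ha t, hb t, smul_add]

lemma IsDeg.sub {k : ℕ} {a b : FormSeries T} (ha : IsDeg k a) (hb : IsDeg k b) :
    IsDeg k (a - b) := fun t => by rw [map_sub, ha t, hb t, smul_sub]

lemma IsDeg.smul {k : ℕ} {a : FormSeries T} (ha : IsDeg k a) (c : ℂ) :
    IsDeg k (c • a) := fun t => by rw [map_smul, ha t, smul_comm]

lemma IsDeg.sum {ι : Type*} {s : Finset ι} {k : ℕ} {a : ι → FormSeries T}
    (ha : ∀ i ∈ s, IsDeg k (a i)) : IsDeg k (∑ i ∈ s, a i) := fun t => by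
  rw [map_sum, Finset.smul_sum]
  exact Finset.sum_congr rfl fun i hi => ha i hi t

lemma IsDeg.mul {k l : ℕ} {a b : FormSeries T} (ha : IsDeg k a) (hb : IsDeg l b) :
    IsDeg (k + l) (a * b) := fun t => by
  rw [scal_mul, ha t, hb t, smul_mul_smul_comm, pow_add]

lemma IsDeg.d {k : ℕ} {a : FormSeries T} (ha : IsDeg k a) : IsDeg (k + 1) (d a) := fun t => by
  rw [scal_d, ha t, map_smul, smul_smul, pow_succ']

lemma scal_one (t : ℂ) : scal t (1 : FormSeries T) = 1 := ext fun n => by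
  rw [coeff_scal, coeff_one]
  split_ifs <;> simp

lemma isDeg_algebraMap (c : ℂ) : IsDeg 0 (algebraMap ℂ (FormSeries T) c) := fun t => by
  rw [Algebra.algebraMap_eq_smul_one, map_smul, scal_one, pow_zero, one_smul]

/-! ### Supports -/

/-- Smooth forms that vanish off `C`. -/
def vanishS (C : Set M) : Submodule ℂ (SForm D M) where
  carrier := {a | VanishOff C a.1}
  add_mem' ha hb := VanishOff.add ha hb
  zero_mem' := fun _ _ => rfl
  smul_mem' c _ ha := VanishOff.smul ha c

lemma vanishS_mono {C C' : Set M} (h : C ⊆ C') : vanishS (D := D) C ≤ vanishS C' :=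
  fun _ ha => VanishOff.mono ha h

/-- Differential operators do not enlarge closed supports, so every term of the star product lives
on the intersection of the supports of its factors. -/
lemma term_mem_vanishS {C C' : Set M} (hC : IsClosed C) (hC' : IsClosed C') (k : ℕ)
    {a b : SForm D M} (ha : a ∈ vanishS C) (hb : b ∈ vanishS C') :
    T.data.term k a b ∈ vanishS (C ∩ C') := by
  have h1 : T.data.term k a b ∈ vanishS C := T.data.term_mem_of_left
    (fun α a ha => VanishOff.lieD hC ha (T.X α)) (fun a ha b => VanishOff.mul_right ha b.1) k ha b
  have h2 : T.data.term k a b ∈ vanishS C' := T.data.term_mem_of_right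
    (fun α a ha => VanishOff.lieD hC' ha (T.X α)) (fun a ha b => VanishOff.mul_left ha b.1) k hb a
  intro p hp
  by_cases h : p ∈ C
  · exact h2 p fun h' => hp ⟨h, h'⟩
  · exact h1 p h

/-- Increasing sequences of closed sets. -/
structure SuppSeq (M : Type*) [TopologicalSpace M] where
  set : ℕ → Set M
  closed : ∀ n, IsClosed (set n)
  mono : Monotone set

/-- Power series whose coefficients vanish off the members of a sequence of sets. -/
def suppIn (T : AbelianTwist D M) (C : SuppSeq M) : Submodule ℂ (FormSeries T) where
  carrier := {a | ∀ n, coeff n a ∈ vanishS (C.set n)}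
  add_mem' ha hb n := add_mem (ha n) (hb n)
  zero_mem' _ := zero_mem _
  smul_mem' c _ ha n := Submodule.smul_mem _ c (ha n)

/-- Order `n` of a product involves only the coefficients of `a` up to order `n`; this is why the
sequences of supports are taken increasing. -/
lemma mul_mem_suppIn_left {C : SuppSeq M} {a : FormSeries T} (ha : a ∈ suppIn T C)
    (b : FormSeries T) : a * b ∈ suppIn T C := fun n => by
  rw [coeff_mul]
  refine sum_mem fun p hp => sum_mem fun q hq => ?_
  rw [Finset.HasAntidiagonal.mem_antidiagonal] at hp hq
  have h : q.1 ≤ n := by omega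
  have hb : coeff q.2 b ∈ vanishS (Set.univ : Set M) := fun p hp => (hp trivial).elim
  exact vanishS_mono (Set.inter_subset_left.trans (C.mono h))
    (term_mem_vanishS (C.closed _) isClosed_univ _ (ha q.1) hb)

lemma mul_mem_suppIn_right {C : SuppSeq M} {a : FormSeries T} (ha : a ∈ suppIn T C)
    (b : FormSeries T) : b * a ∈ suppIn T C := fun n => by
  rw [coeff_mul]
  refine sum_mem fun p hp => sum_mem fun q hq => ?_
  rw [Finset.HasAntidiagonal.mem_antidiagonal] at hp hq
  have h : q.2 ≤ n := by omega
  have hb : coeff q.1 b ∈ vanishS (Set.univ : Set M) := fun p hp => (hp trivial).elim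
  exact vanishS_mono (Set.inter_subset_right.trans (C.mono h))
    (term_mem_vanishS isClosed_univ (C.closed _) _ hb (ha q.2))

lemma d_mem_suppIn {C : SuppSeq M} {a : FormSeries T} (ha : a ∈ suppIn T C) :
    d a ∈ suppIn T C := fun n => VanishOff.dForm (C.closed n) (ha n)

lemma star_mem_suppIn {C : SuppSeq M} {a : FormSeries T} (ha : a ∈ suppIn T C) :
    star a ∈ suppIn T C := fun n p hp => by
  change extStar (covConj _) ((coeff n a).1 p) = 0
  rw [ha n p hp]
  have := extStar_smul (covConj (TangentSpace (𝓡 D) p)) 0 0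
  rwa [zero_smul, map_zero, zero_smul] at this

/-- Sequences of sets whose members have compact intersections. -/
def SuppSeq.Overlap (C C' : SuppSeq M) : Prop := ∀ m n, IsCompact (C.set m ∩ C'.set n)

lemma SuppSeq.Overlap.symm {C C' : SuppSeq M} (h : C.Overlap C') : C'.Overlap C := fun m n => by
  rw [Set.inter_comm]
  exact h n m

variable [T2Space M]

variable (D M) in
/-- Compactly supported smooth forms. -/
def cptS : Submodule ℂ (SForm D M) where
  carrier := {a | ∃ K, IsCompact K ∧ a ∈ vanishS K}
  add_mem' := by
    rintro a b ⟨K, hK, ha⟩ ⟨K', hK', hb⟩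
    exact ⟨K ∪ K', hK.union hK', add_mem (vanishS_mono Set.subset_union_left ha)
      (vanishS_mono Set.subset_union_right hb)⟩
  zero_mem' := ⟨∅, isCompact_empty, zero_mem _⟩
  smul_mem' := by
    rintro c a ⟨K, hK, ha⟩
    exact ⟨K, hK, Submodule.smul_mem _ c ha⟩

/-- Power series with compactly supported coefficients. -/
def cpt (T : AbelianTwist D M) : Submodule ℂ (FormSeries T) where
  carrier := {a | ∀ n, coeff n a ∈ cptS D M}
  add_mem' ha hb n := add_mem (ha n) (hb n)
  zero_mem' _ := zero_mem _
  smul_mem' c _ ha n := Submodule.smul_mem _ c (ha n)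

lemma term_mem_cptS {C C' : SuppSeq M} (h : C.Overlap C') {a b : FormSeries T}
    (ha : a ∈ suppIn T C) (hb : b ∈ suppIn T C') (k m n : ℕ) :
    T.data.term k (coeff m a) (coeff n b) ∈ cptS D M :=
  ⟨_, h m n, term_mem_vanishS (C.closed m) (C'.closed n) k (ha m) (hb n)⟩

lemma mul_mem_cpt {C C' : SuppSeq M} (h : C.Overlap C') {a b : FormSeries T}
    (ha : a ∈ suppIn T C) (hb : b ∈ suppIn T C') : a * b ∈ cpt T := fun n => by
  rw [coeff_mul]
  exact sum_mem fun p _ => sum_mem fun q _ => term_mem_cptS h ha hb _ _ _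

/-! ### Integrals -/

variable [SigmaCompactSpace M]

lemma integral_add_cpt {a b : SForm D M} (ha : a ∈ cptS D M) (hb : b ∈ cptS D M) :
    integral (a + b).1 = integral a.1 + integral b.1 := by
  obtain ⟨K, hK, ha⟩ := ha
  obtain ⟨K', hK', hb⟩ := hb
  exact integral_add (hK.union hK') a.2 (vanishS_mono Set.subset_union_left ha) b.2
    (vanishS_mono Set.subset_union_right hb)

lemma integral_sum_cpt {ι : Type*} {s : Finset ι} {a : ι → SForm D M}
    (ha : ∀ i ∈ s, a i ∈ cptS D M) : integral (∑ i ∈ s, a i).1 = ∑ i ∈ s, integral (a i).1 := by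
  classical
  induction s using Finset.induction_on with
  | empty => exact integral_zero
  | insert i s hi ih =>
    have h1 := ha i (Finset.mem_insert_self i s)
    have h2 : ∀ j ∈ s, a j ∈ cptS D M := fun j hj => ha j (Finset.mem_insert_of_mem hj)
    rw [Finset.sum_insert hi, Finset.sum_insert hi, ← ih h2]
    exact integral_add_cpt h1 (sum_mem h2)

/-- Integral of a power series of forms. -/
def J (a : FormSeries T) : PowerSeries ℂ := PowerSeries.mk fun n => integral (coeff n a).1

lemma J_add {a b : FormSeries T} (ha : a ∈ cpt T) (hb : b ∈ cpt T) : J (a + b) = J a + J b :=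
  PowerSeries.ext fun n => by
    simp only [J, PowerSeries.coeff_mk, map_add]
    exact integral_add_cpt (ha n) (hb n)

lemma J_smul (c : ℂ) (a : FormSeries T) : J (c • a) = c • J a :=
  PowerSeries.ext fun n => by
    simp only [J, PowerSeries.coeff_mk, map_smul, smul_eq_mul]
    exact integral_smul c (coeff n a).1

lemma J_neg (a : FormSeries T) : J (-a) = -J a := by
  rw [← neg_one_smul ℂ, J_smul, neg_one_smul]

lemma J_sub {a b : FormSeries T} (ha : a ∈ cpt T) (hb : b ∈ cpt T) : J (a - b) = J a - J b := by
  rw [sub_eq_add_neg, J_add ha (neg_mem hb), J_neg, sub_eq_add_neg]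

lemma J_sum {ι : Type*} {s : Finset ι} {a : ι → FormSeries T} (ha : ∀ i ∈ s, a i ∈ cpt T) :
    J (∑ i ∈ s, a i) = ∑ i ∈ s, J (a i) :=
  PowerSeries.ext fun n => by
    simp only [J, PowerSeries.coeff_mk, map_sum]
    exact integral_sum_cpt fun i hi => ha i hi n

/-- By `TwistData.term_succ_eq_L` such a term is a sum of Lie derivatives of forms supported in the
compact intersection. -/
lemma integral_term_succ (hO : OrientedAtlas D M) {C C' : Set M} (hC : IsClosed C)
    (hC' : IsClosed C') (h : IsCompact (C ∩ C')) {a b : SForm D M} (ha : a ∈ vanishS C)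
    (hb : b ∈ vanishS C') (k : ℕ) : integral (T.data.term (k + 1) a b).1 = 0 := by
  have hL : ∀ α, ∀ c ∈ vanishS (C ∩ C'), T.data.L α c ∈ vanishS (C ∩ C') := fun α c hc =>
    VanishOff.lieD (hC.inter hC') hc (T.X α)
  have hs : ∀ α, (∑ β, (Complex.I / 2 * (T.data.Θ α β : ℂ) / ((k : ℂ) + 1)) •
      T.data.term k a (T.data.L β b)) ∈ vanishS (C ∩ C') := fun α =>
    sum_mem fun β _ => Submodule.smul_mem _ _
      (term_mem_vanishS hC hC' k ha (VanishOff.lieD hC' hb (T.X β)))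
  rw [TwistData.term_succ_eq_L, integral_sum_cpt fun α _ => ⟨_, h, hL α _ (hs α)⟩]
  exact Finset.sum_eq_zero fun α _ => integral_lieD hO h (T.smooth α) (Subtype.property _) (hs α)

/-- The integral of a star product is that of the ordinary product. -/
lemma coeff_J_mul (hO : OrientedAtlas D M) {C C' : SuppSeq M} (h : C.Overlap C')
    {a b : FormSeries T} (ha : a ∈ suppIn T C) (hb : b ∈ suppIn T C') (n : ℕ) :
    PowerSeries.coeff n (J (a * b)) =
      ∑ q ∈ antidiagonal n, integral (coeff q.1 a * coeff q.2 b).1 := by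
  rw [J, PowerSeries.coeff_mk, coeff_mul, integral_sum_cpt fun p _ => sum_mem fun q _ =>
    term_mem_cptS h ha hb _ _ _, Finset.sum_eq_single (0, n)]
  · rw [integral_sum_cpt fun q _ => term_mem_cptS h ha hb _ _ _]
    simp only [TwistData.term_zero]
  · rintro ⟨i, j⟩ hij hne
    rw [Finset.HasAntidiagonal.mem_antidiagonal] at hij
    rw [integral_sum_cpt fun q _ => term_mem_cptS h ha hb _ _ _]
    refine Finset.sum_eq_zero fun q _ => ?_
    obtain _ | i := i
    · simp_all
    · exact integral_term_succ hO (C.closed _) (C'.closed _) (h _ _) (ha _) (hb _) i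
  · simp

/-- Under the integral the star product may be replaced by the pointwise wedge product, for which
graded commutativity holds. -/
lemma J_mul_comm_of_even (hO : OrientedAtlas D M) {C C' : SuppSeq M} (h : C.Overlap C')
    {a b : FormSeries T} (ha : a ∈ suppIn T C) (hb : b ∈ suppIn T C') (he : scal (-1) a = a) :
    J (a * b) = J (b * a) := PowerSeries.ext fun n => by
  rw [coeff_J_mul hO h ha hb, coeff_J_mul hO h.symm hb ha, ← Finset.Nat.sum_antidiagonal_swap]
  refine Finset.sum_congr rfl fun q _ => ?_
  congr 1
  funext p
  refine (mul_comm_of_even ?_ _).symm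
  exact congrFun (congrArg (fun c : FormSeries T => (coeff q.2 c).1) he) p

lemma J_mul_comm_of_odd (hO : OrientedAtlas D M) {C C' : SuppSeq M} (h : C.Overlap C')
    {a b : FormSeries T} (ha : a ∈ suppIn T C) (hb : b ∈ suppIn T C') (hoa : scal (-1) a = -a)
    (hob : scal (-1) b = -b) : J (a * b) = -J (b * a) := PowerSeries.ext fun n => by
  rw [map_neg, coeff_J_mul hO h ha hb, coeff_J_mul hO h.symm hb ha,
    ← Finset.Nat.sum_antidiagonal_swap, ← Finset.sum_neg_distrib]
  refine Finset.sum_congr rfl fun q _ => ?_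
  rw [← neg_one_mul, ← integral_smul]
  congr 1
  funext p
  have h1 : TwistedDirac.scal (-1) ((coeff q.2 a).1 p) = -(coeff q.2 a).1 p :=
    congrFun (congrArg (fun c : FormSeries T => (coeff q.2 c).1) hoa) p
  have h2 : TwistedDirac.scal (-1) ((coeff q.1 b).1 p) = -(coeff q.1 b).1 p :=
    congrFun (congrArg (fun c : FormSeries T => (coeff q.1 c).1) hob) p
  have h3 := mul_comm_of_odd h1 ((coeff q.1 b).1 p)
  rw [h2, mul_neg] at h3
  change (coeff q.2 a).1 p * (coeff q.1 b).1 p = (-1 : ℂ) • ((coeff q.1 b).1 p * (coeff q.2 a).1 p)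
  rw [h3, smul_neg, neg_one_smul, neg_neg]

lemma J_d (hO : OrientedAtlas D M) {a : FormSeries T} (ha : a ∈ cpt T) : J (d a) = 0 :=
  PowerSeries.ext fun n => by
    obtain ⟨K, hK, h⟩ := ha n
    rw [J, PowerSeries.coeff_mk, map_zero]
    exact integral_dForm hO hK (coeff n a).2 h

lemma J_star {ε : ℂ}
    (hε : extStar (covConj (Eucl D)) (dxS D Finset.univ) = ε • dxS D Finset.univ)
    (a : FormSeries T) : J (star a) = ε • (J a).map (starRingEnd ℂ) :=
  PowerSeries.ext fun n => by
    rw [J, PowerSeries.coeff_mk, PowerSeries.coeff_smul, PowerSeries.coeff_map, J,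
      PowerSeries.coeff_mk, smul_eq_mul]
    exact integral_starF hε (coeff n a).1

end FormSeries

end FormSeries

/-! ### Division by a volume form -/

section Division

open Finset.HasAntidiagonal (antidiagonal)

variable {D : ℕ} {M : Type*} [TopologicalSpace M] [ChartedSpace (Eucl D) M]
  [IsManifold (𝓡 D) ∞ M]

lemma contMDiff_of_charts {F : Type*} [NormedAddCommGroup F] [NormedSpace ℝ F] {f : M → F}
    (h : ∀ x, ContDiffOn ℝ ∞ (fun y => f ((extChartAt (𝓡 D) x).symm y))
      (extChartAt (𝓡 D) x).target) : ContMDiff (𝓡 D) 𝓘(ℝ, F) ∞ f := by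
  intro p
  have h1 : ContMDiffOn 𝓘(ℝ, Eucl D) 𝓘(ℝ, F) ∞ (fun y => f ((extChartAt (𝓡 D) p).symm y))
      (extChartAt (𝓡 D) p).target := contMDiffOn_iff_contDiffOn.2 (h p)
  have h2 := h1.comp (contMDiffOn_extChartAt (I := 𝓡 D) (n := ∞) (x := p)) (fun q hq => by
    rw [← extChartAt_source (𝓡 D)] at hq
    exact (extChartAt (𝓡 D) p).map_source hq)
  have h3 : ContMDiffOn (𝓡 D) 𝓘(ℝ, F) ∞ f (chartAt (Eucl D) p).source := h2.congr fun q hq => by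
    rw [← extChartAt_source (𝓡 D)] at hq
    simp only [Function.comp_apply, (extChartAt (𝓡 D) p).left_inv hq]
  exact h3.contMDiffAt ((chartAt (Eucl D) p).open_source.mem_nhds (mem_chart_source _ p))

lemma topCoeff_smul (c : ℂ) (a : ExtCov D) : topCoeff (c • a) = c * topCoeff a := by
  rw [← topCoeffL_apply, map_smul, topCoeffL_apply, smul_eq_mul]

/-- Forms of top degree. -/
def IsTop (η : Form D M) : Prop := scalF 2 η = (2 : ℂ) ^ D • η

lemma IsTop.localForm_eq {η : Form D M} (h : IsTop η) (x : M) (y : Eucl D) :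
    localForm x η y = topCoeff (localForm x η y) • dxS D Finset.univ := by
  refine eq_topCoeff_smul ?_
  rw [← localForm_scalF_apply, h, localForm_smul_apply]

lemma IsTop.eq_zero {η : Form D M} (h : IsTop η) (h0 : ∀ x, ∀ y ∈ (extChartAt (𝓡 D) x).target,
    topCoeff (localForm x η y) = 0) : η = 0 :=
  form_ext fun x y hy => by
    rw [h.localForm_eq x y, h0 x y hy, zero_smul]
    exact (map_zero (ExteriorAlgebra.map (covPull (dsy x y)))).symm

lemma IsTop.topCoeff_ne_zero {η : Form D M} (h : IsTop η) {x : M} {y : Eucl D}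
    (hy : y ∈ (extChartAt (𝓡 D) x).target) (h0 : η ((extChartAt (𝓡 D) x).symm y) ≠ 0) :
    topCoeff (localForm x η y) ≠ 0 := by
  intro h1
  refine h0 (eq_of_localForm_eq (τ := 0) ((extChartAt (𝓡 D) x).map_target hy) ?_)
  rw [(extChartAt (𝓡 D) x).right_inv hy, h.localForm_eq, h1, zero_smul]
  exact (map_zero (ExteriorAlgebra.map (covPull (dsy x y)))).symm

/-- Forms of top degree are multiples of a volume form. -/
lemma exists_eq_mulF {v η : Form D M} (hv : SmoothForm v) (hvt : IsTop v) (hv0 : ∀ p, v p ≠ 0)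
    (hη : SmoothForm η) (hηt : IsTop η) :
    ∃ f : M → ℂ, ContMDiff (𝓡 D) 𝓘(ℝ, ℂ) ∞ f ∧ mulF f v = η := by
  set f : M → ℂ := fun p => topCoeff (localForm p η (extChartAt (𝓡 D) p p)) /
    topCoeff (localForm p v (extChartAt (𝓡 D) p p)) with hf
  have h1 : mulF f v = η := by
    funext p
    refine eq_of_localForm_eq (mem_extChartAt_source p) ?_
    rw [localForm_mulF, (extChartAt (𝓡 D) p).left_inv (mem_extChartAt_source p),
      hvt.localForm_eq p, hηt.localForm_eq p, smul_smul, hf]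
    congr 1
    refine div_mul_cancel₀ _ (hvt.topCoeff_ne_zero (mem_extChartAt_target p) ?_)
    exact hv0 _
  refine ⟨f, contMDiff_of_charts fun x => ?_, h1⟩
  -- The quotient `f` was formed in a chart varying with the point. Reading `mulF f v = η` in the
  -- fixed chart at `x` shows that the same quotient computes `f` throughout that chart.
  refine ((contDiffOn_topCoeff (hη x)).mul ((contDiffOn_topCoeff (hv x)).inv fun y hy =>
    hvt.topCoeff_ne_zero hy (hv0 _))).congr fun y hy => ?_
  rw [Pi.inv_apply, ← div_eq_mul_inv, eq_div_iff (hvt.topCoeff_ne_zero hy (hv0 _)), ← topCoeff_smul, ← localForm_mulF, h1]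

/-! ### Matrices of forms -/

variable {T : AbelianTwist D M}

namespace FormSeries

section Matrices

variable {k l m : Type*}

/-- The underlying matrix of sequences of forms. -/
def valM (A : Matrix k l (FormSeries T)) : Matrix k l (FForm D M) := A.map val

lemma valM_injective : Function.Injective (valM : Matrix k l (FormSeries T) → _) := fun _ _ h =>
  Matrix.ext fun i j => val_injective (congrFun (congrFun h i) j)

/-- Constant matrices. -/
def cst (T : AbelianTwist D M) (g : Matrix k l ℂ) : Matrix k l (FormSeries T) :=
  g.map (algebraMap ℂ (FormSeries T))

lemma valM_mul [Fintype l] (A : Matrix k l (FormSeries T)) (B : Matrix l m (FormSeries T)) :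
    valM (A * B) = starMul T (valM A) (valM B) := by
  ext1 i j
  simp only [valM, Matrix.map_apply, Matrix.mul_apply, starMul, Matrix.of_apply, val_sum, val_mul]

lemma valM_mul_cst [Fintype l] (A : Matrix k l (FormSeries T)) (g : Matrix l m ℂ) :
    valM (A * cst T g) = cmulR (valM A) g := by
  ext1 i j
  simp only [valM, Matrix.map_apply, Matrix.mul_apply, cmulR, Matrix.of_apply, val_sum, cst,
    ← Algebra.commutes, ← Algebra.smul_def, val_smul]

lemma valM_cst_mul [Fintype l] (A : Matrix l m (FormSeries T)) (g : Matrix k l ℂ) :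
    valM (cst T g * A) = cmulL g (valM A) := by
  ext1 i j
  simp only [valM, Matrix.map_apply, Matrix.mul_apply, cmulL, Matrix.of_apply, val_sum, cst,
    ← Algebra.smul_def, val_smul]

lemma valM_sub (A B : Matrix k l (FormSeries T)) : valM (A - B) = valM A - valM B := rfl

lemma valM_add (A B : Matrix k l (FormSeries T)) : valM (A + B) = valM A + valM B := rfl

lemma valM_d (A : Matrix k l (FormSeries T)) : valM (A.map d) = dMat (valM A) := rfl

lemma cst_mul [Fintype l] (g : Matrix k l ℂ) (h : Matrix l m ℂ) :
    cst T g * cst T h = cst T (g * h) := (Matrix.map_mul ..).symm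

lemma cst_one [DecidableEq k] : cst T (1 : Matrix k k ℂ) = 1 :=
  Matrix.map_one _ (map_zero _) (map_one _)

lemma cst_neg (g : Matrix k l ℂ) : cst T (-g) = -cst T g :=
  Matrix.ext fun i j => map_neg (algebraMap ℂ (FormSeries T)) (g i j)

lemma star_algebraMap' (c : ℂ) :
    star (algebraMap ℂ (FormSeries T) c) = algebraMap ℂ (FormSeries T) (conj c) := by
  rw [Algebra.algebraMap_eq_smul_one, star_smul, star_one, Algebra.algebraMap_eq_smul_one]
  rfl

lemma cst_conjTranspose (g : Matrix k l ℂ) : (cst T g)ᴴ = cst T gᴴ :=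
  Matrix.ext fun i j => star_algebraMap' (g j i)

/-- Homogeneous matrices. -/
def DegM (n : ℕ) (A : Matrix k l (FormSeries T)) : Prop := ∀ i j, IsDeg n (A i j)

lemma DegM.mul [Fintype l] {n n' : ℕ} {A : Matrix k l (FormSeries T)}
    {B : Matrix l m (FormSeries T)} (hA : DegM n A) (hB : DegM n' B) : DegM (n + n') (A * B) :=
  fun i j => by
    rw [Matrix.mul_apply]
    exact IsDeg.sum fun s _ => (hA i s).mul (hB s j)

lemma DegM.sub {n : ℕ} {A B : Matrix k l (FormSeries T)} (hA : DegM n A) (hB : DegM n B) :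
    DegM n (A - B) := fun i j => (hA i j).sub (hB i j)

lemma DegM.add {n : ℕ} {A B : Matrix k l (FormSeries T)} (hA : DegM n A) (hB : DegM n B) :
    DegM n (A + B) := fun i j => (hA i j).add (hB i j)

lemma DegM.d {n : ℕ} {A : Matrix k l (FormSeries T)} (hA : DegM n A) :
    DegM (n + 1) (A.map d) := fun i j => (hA i j).d

lemma DegM.smul {n : ℕ} {A : Matrix k l (FormSeries T)} (hA : DegM n A) (c : ℂ) :
    DegM n (c • A) := fun i j => (hA i j).smul c

lemma degM_cst (g : Matrix k l ℂ) : DegM 0 (cst T g) := fun i j => isDeg_algebraMap (g i j)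

lemma DegM.mul_cst [Fintype l] {n : ℕ} {A : Matrix k l (FormSeries T)} (hA : DegM n A)
    (g : Matrix l m ℂ) : DegM n (A * cst T g) := hA.mul (degM_cst g)

/-- `star` is conjugate-linear, so scaling by `t` outside is scaling by `conj t` inside, and the
second conjugation restores `t ^ n`. -/
lemma IsDeg.star {n : ℕ} {a : FormSeries T} (ha : IsDeg n a) : IsDeg n (star a) := fun t => by
  have h1 : scal t (Star.star a) = Star.star (scal (conj t) a) := ext fun i => by
    rw [coeff_scal, coeff_star, coeff_star, coeff_scal]
    refine Subtype.ext (funext fun p => ?_)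
    have := extStar_scal (covConj (TangentSpace (𝓡 D) p)) (conj t) ((coeff i a).1 p)
    rw [Complex.conj_conj] at this
    exact this.symm
  rw [h1, ha, star_smul, RCLike.star_def, map_pow, Complex.conj_conj]

lemma DegM.conjTranspose {n : ℕ} {A : Matrix k l (FormSeries T)} (hA : DegM n A) :
    DegM n Aᴴ := fun i j => (hA j i).star

lemma d_one : d (1 : FormSeries T) = 0 := by
  have h := d_mul (1 : FormSeries T) 1
  rw [mul_one, scal_one, mul_one, one_mul] at h
  simpa using h

lemma map_d_cst (g : Matrix k l ℂ) : (cst T g).map d = 0 :=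
  Matrix.ext fun i j => by
    rw [Matrix.map_apply, cst, Matrix.map_apply, Algebra.algebraMap_eq_smul_one, map_smul, d_one,
      smul_zero, Matrix.zero_apply]

lemma map_d_mul [Fintype l] {n : ℕ} {A : Matrix k l (FormSeries T)} (hA : DegM n A)
    (B : Matrix l m (FormSeries T)) :
    (A * B).map d = A.map d * B + (-1 : ℂ) ^ n • (A * B.map d) :=
  Matrix.ext fun i j => by
    simp only [Matrix.map_apply, Matrix.mul_apply, map_sum, d_mul, hA i _ (-1), Matrix.add_apply,
      Matrix.smul_apply, Finset.smul_sum, Finset.sum_add_distrib, smul_mul_assoc]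

lemma map_d_mul_cst [Fintype l] (A : Matrix k l (FormSeries T)) (g : Matrix l m ℂ) :
    (A * cst T g).map d = A.map d * cst T g :=
  Matrix.ext fun i j => by
    simp only [Matrix.map_apply, Matrix.mul_apply, map_sum, cst, ← Algebra.commutes,
      ← Algebra.smul_def, map_smul]

/-- Matrices whose entries have supports in a sequence of sets. -/
def SuppM (C : SuppSeq M) (A : Matrix k l (FormSeries T)) : Prop := ∀ i j, A i j ∈ suppIn T C

lemma SuppM.mul_left [Fintype l] {C : SuppSeq M} {B : Matrix l m (FormSeries T)} (hB : SuppM C B)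
    (A : Matrix k l (FormSeries T)) : SuppM C (A * B) := fun i j => by
  rw [Matrix.mul_apply]
  exact sum_mem fun s _ => mul_mem_suppIn_right (hB s j) _

lemma SuppM.mul_right [Fintype l] {C : SuppSeq M} {A : Matrix k l (FormSeries T)} (hA : SuppM C A)
    (B : Matrix l m (FormSeries T)) : SuppM C (A * B) := fun i j => by
  rw [Matrix.mul_apply]
  exact sum_mem fun s _ => mul_mem_suppIn_left (hA i s) _

lemma SuppM.sub {C : SuppSeq M} {A B : Matrix k l (FormSeries T)} (hA : SuppM C A)
    (hB : SuppM C B) : SuppM C (A - B) := fun i j => sub_mem (hA i j) (hB i j)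

lemma SuppM.smul {C : SuppSeq M} {A : Matrix k l (FormSeries T)} (hA : SuppM C A) (c : ℂ) :
    SuppM C (c • A) := fun i j => Submodule.smul_mem _ c (hA i j)

lemma SuppM.d {C : SuppSeq M} {A : Matrix k l (FormSeries T)} (hA : SuppM C A) :
    SuppM C (A.map d) := fun i j => d_mem_suppIn (hA i j)

lemma SuppM.conjTranspose {C : SuppSeq M} {A : Matrix k l (FormSeries T)} (hA : SuppM C A) :
    SuppM C Aᴴ := fun i j => star_mem_suppIn (hA j i)

end Matrices

/-! ### Graded cyclicity of integrated traces -/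

section Traces

variable [T2Space M] [SigmaCompactSpace M] {k l : Type*} [Fintype k] [Fintype l]

lemma SuppM.mul_cpt {m : Type*} {C C' : SuppSeq M} (h : C.Overlap C')
    {A : Matrix k l (FormSeries T)} {B : Matrix l m (FormSeries T)} (hA : SuppM C A)
    (hB : SuppM C' B) (i : k) (j : m) : (A * B) i j ∈ cpt T := by
  rw [Matrix.mul_apply]
  exact sum_mem fun s _ => mul_mem_cpt h (hA i s) (hB s j)

lemma J_trace_mul {C C' : SuppSeq M} (h : C.Overlap C')
    {A : Matrix k l (FormSeries T)} {B : Matrix l k (FormSeries T)} (hA : SuppM C A)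
    (hB : SuppM C' B) : J (A * B).trace = ∑ i, ∑ s, J (A i s * B s i) := by
  simp only [Matrix.trace, Matrix.diag, Matrix.mul_apply]
  rw [J_sum fun i _ => sum_mem fun s _ => mul_mem_cpt h (hA i s) (hB s i)]
  exact Finset.sum_congr rfl fun i _ => J_sum fun s _ => mul_mem_cpt h (hA i s) (hB s i)

/-- The trace exchanges the matrix indices and the integral exchanges the entries, without sign
since those of `A` are functions. In the odd case below each exchange of entries contributes a
minus. -/
lemma J_trace_comm_of_even (hO : OrientedAtlas D M) {C C' : SuppSeq M} (h : C.Overlap C')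
    {A : Matrix k l (FormSeries T)} {B : Matrix l k (FormSeries T)} (hA : SuppM C A)
    (hB : SuppM C' B) (hd : DegM 0 A) : J (A * B).trace = J (B * A).trace := by
  rw [J_trace_mul h hA hB, J_trace_mul h.symm hB hA, Finset.sum_comm]
  refine Finset.sum_congr rfl fun s _ => Finset.sum_congr rfl fun i _ => ?_
  refine J_mul_comm_of_even hO h (hA i s) (hB s i) ?_
  rw [hd i s (-1), pow_zero, one_smul]

lemma J_trace_comm_of_odd (hO : OrientedAtlas D M) {C C' : SuppSeq M} (h : C.Overlap C')
    {A : Matrix k l (FormSeries T)} {B : Matrix l k (FormSeries T)} (hA : SuppM C A)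
    (hB : SuppM C' B) {n n' : ℕ} (hn : Odd n) (hn' : Odd n') (hdA : DegM n A) (hdB : DegM n' B) :
    J (A * B).trace = -J (B * A).trace := by
  rw [J_trace_mul h hA hB, J_trace_mul h.symm hB hA, Finset.sum_comm, ← Finset.sum_neg_distrib]
  refine Finset.sum_congr rfl fun s _ => ?_
  rw [← Finset.sum_neg_distrib]
  refine Finset.sum_congr rfl fun i _ => ?_
  refine J_mul_comm_of_odd hO h (hA i s) (hB s i) ?_ ?_
  · rw [hdA i s (-1), hn.neg_one_pow, neg_one_smul]
  · rw [hdB s i (-1), hn'.neg_one_pow, neg_one_smul]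

lemma intTr_valM {N : ℕ} (A : Matrix (Fin N) (Fin N) (FormSeries T)) :
    intTr (valM A) = J A.trace := by
  refine PowerSeries.ext fun n => ?_
  rw [intTr, J, PowerSeries.coeff_mk, PowerSeries.coeff_mk]
  congr 1
  have : (valM A).trace = val A.trace := by
    rw [Matrix.trace, Matrix.trace, val_sum]
    rfl
  rw [this]
  rfl

end Traces

end FormSeries

end Division

/-! ### Dirac fields as columns of power series -/

section DiracFields

open Finset.HasAntidiagonal (antidiagonal)

variable {D : ℕ} {M : Type*} [TopologicalSpace M] [ChartedSpace (Eucl D) M]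
  [IsManifold (𝓡 D) ∞ M]

variable (D M) in
/-- Smooth functions. -/
def SFun : Type _ := {f : M → ℂ // ContMDiff (𝓡 D) 𝓘(ℝ, ℂ) ∞ f}

instance : Zero (SFun D M) := ⟨⟨fun _ => 0, contMDiff_const⟩⟩

/-- Smooth functions as forms. -/
def funS (f : SFun D M) : SForm D M := ⟨funForm f.1, smoothForm_funForm f.2⟩

lemma funS_zero : funS (0 : SFun D M) = 0 := Subtype.ext (funext fun _ => map_zero _)

lemma scalS_funS (t : ℂ) (f : SFun D M) : scalS t (funS f) = funS f :=
  Subtype.ext (funext fun p => scal_algebraMap t (f.1 p))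

lemma funForm_injective : Function.Injective (funForm : (M → ℂ) → Form D M) := fun _ _ h =>
  funext fun p => ExteriorAlgebra.algebraMap_leftInverse _ |>.injective (congrFun h p)

lemma mul_funS (v : SForm D M) (f : SFun D M) : (v * funS f).1 = mulF f.1 v.1 := by
  rw [mulF_eq]
  exact funext fun p => (Algebra.commutes (f.1 p) (v.1 p)).symm

variable {N : ℕ} {T : AbelianTwist D M}

/-- The Dirac field with given components. -/
def DiracField.ofFun (f : ℕ → Fin N → SFun D M) : DiracField D M N :=
  ⟨fun n p i => (f n i).1 p, fun n => contMDiff_pi_space.2 fun i => (f n i).2⟩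

/-- The components of a Dirac field. -/
def DiracField.comp (ψ : DiracField D M N) (n : ℕ) (i : Fin N) : SFun D M :=
  ⟨fun p => ψ.1 n p i, contMDiff_pi_space.1 (ψ.2 n) i⟩

open FormSeries

variable (T) in
/-- A Dirac field as a column of power series. -/
def DiracField.colS (ψ : DiracField D M N) : Matrix (Fin N) Unit (FormSeries T) :=
  Matrix.of fun i _ => FormSeries.mk fun n => funS (ψ.comp n i)

lemma coeff_colS (ψ : DiracField D M N) (n : ℕ) (i : Fin N) (j : Unit) :
    coeff n (ψ.colS T i j) = funS (ψ.comp n i) := rfl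

lemma valM_colS (ψ : DiracField D M N) : valM (ψ.colS T) = ψ.col := rfl

lemma valM_colS_bar (γ₀ : Matrix (Fin N) (Fin N) ℂ) (ψ : DiracField D M N) :
    valM ((ψ.colS T)ᴴ * cst T γ₀) = ψ.bar γ₀ := by
  rw [valM_mul_cst, DiracField.bar]
  congr 1
  ext1 i j
  exact funext fun n => starF_funForm _

lemma colS_injective : Function.Injective (DiracField.colS T (N := N)) := fun ψ φ h => by
  refine Subtype.ext (funext fun n => funext fun p => funext fun i => ?_)
  have h1 : funS (ψ.comp n i) = funS (φ.comp n i) := by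
    rw [← coeff_colS (T := T) ψ n i (), h, coeff_colS]
  exact congrFun (funForm_injective (congrArg Subtype.val h1)) p

lemma degM_colS (ψ : DiracField D M N) : DegM 0 (ψ.colS T) := fun i j t => by
  refine FormSeries.ext fun n => ?_
  rw [coeff_scal, map_smul, coeff_colS, scalS_funS, pow_zero, one_smul]

lemma map_d_conjTranspose_colS (ψ : DiracField D M N) :
    ((ψ.colS T).map d)ᴴ = (ψ.colS T)ᴴ.map d := by
  refine Matrix.ext fun i j => FormSeries.ext fun n => Subtype.ext ?_
  change starF (dForm (funForm (ψ.comp n j).1)) = dForm (starF (funForm (ψ.comp n j).1))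
  rw [starF_dForm_funForm (ψ.comp n j).2, starF_funForm]

/-- The supports of the partial sums of a Dirac field. -/
def DiracField.supp (ψ : DiracField D M N) : SuppSeq M where
  set n := ⋃ m ∈ Set.Iic n, tsupport (ψ.1 m)
  closed n := (Set.finite_Iic n).isClosed_biUnion fun _ _ => isClosed_tsupport _
  mono _ _ h := Set.biUnion_subset_biUnion_left (Set.Iic_subset_Iic.2 h)

lemma suppM_colS (ψ : DiracField D M N) : SuppM ψ.supp (ψ.colS T) := fun i j n p hp => by
  have h1 : p ∉ tsupport (ψ.1 n) := fun h =>
    hp (Set.mem_biUnion (x := n) (Set.mem_Iic.2 le_rfl) h)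
  have h2 : ψ.1 n p = 0 := image_eq_zero_of_notMem_tsupport h1
  change algebraMap ℂ _ (ψ.1 n p i) = 0
  rw [h2, Pi.zero_apply, map_zero]

lemma CompactOverlap.supp {ψ₁ ψ₂ : DiracField D M N} (h : CompactOverlap ψ₁ ψ₂) :
    ψ₁.supp.Overlap ψ₂.supp := fun m n => by
  change IsCompact ((⋃ i ∈ Set.Iic m, tsupport (ψ₁.1 i)) ∩ ⋃ j ∈ Set.Iic n, tsupport (ψ₂.1 j))
  simp only [Set.iUnion_inter, Set.inter_iUnion]
  exact (Set.finite_Iic n).isCompact_biUnion fun j _ =>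
    (Set.finite_Iic m).isCompact_biUnion fun i _ => h i j

lemma DiracField.HasCompactSupp.overlap {ψ₁ : DiracField D M N} (h : ψ₁.HasCompactSupp)
    (ψ₂ : DiracField D M N) : CompactOverlap ψ₁ ψ₂ := fun m _ =>
  (h m).isCompact.inter_right (isClosed_tsupport _)

/-! ### Linear equations with invertible leading coefficient -/

/-- Any contribution with a twist or a positive order in `a` uses a coefficient of `b` below `n`, so
the undeformed leading term is all that remains. -/
lemma coeff_mul_of_lt {n : ℕ} {a b : FormSeries T} (hb : ∀ m < n, coeff m b = 0) :
    coeff n (a * b) = coeff 0 a * coeff n b := by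
  rw [coeff_mul, Finset.sum_eq_single (0, n), Finset.sum_eq_single (0, n), TwistData.term_zero]
  · rintro ⟨i, j⟩ hij h
    rw [Finset.HasAntidiagonal.mem_antidiagonal] at hij
    have : j < n := by
      rcases Nat.eq_zero_or_pos i with rfl | hi
      · simp_all
      · simp only at hij; omega
    rw [hb j this, TwistData.term_zero_right]
  · simp
  · rintro ⟨i, j⟩ hij h
    rw [Finset.HasAntidiagonal.mem_antidiagonal] at hij
    refine Finset.sum_eq_zero fun q hq => ?_
    rw [Finset.HasAntidiagonal.mem_antidiagonal] at hq
    have : q.2 < n := by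
      rcases Nat.eq_zero_or_pos i with rfl | hi
      · simp_all
      · simp only at hij hq; omega
    rw [hb _ this, TwistData.term_zero_right]
  · simp

/-- The matrix `Z` is a volume form times the identity to lowest order. -/
structure VolumeLike (Z : Matrix (Fin N) (Fin N) (FormSeries T)) (v : SForm D M) : Prop where
  deg : DegM D Z
  coeff_zero : ∀ i j, coeff 0 (Z i j) = (1 : Matrix (Fin N) (Fin N) ℂ) i j • v
  isTop : IsTop v.1
  ne_zero : ∀ p, v.1 p ≠ 0

lemma IsDeg.isTop {a : FormSeries T} (ha : IsDeg D a) (n : ℕ) : IsTop (coeff n a).1 :=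
  congrArg (fun b => (coeff n b).1) (ha 2)

variable {Z : Matrix (Fin N) (Fin N) (FormSeries T)} {v : SForm D M}

lemma VolumeLike.coeff_mul (hZ : VolumeLike Z v) {n : ℕ} {φ : Matrix (Fin N) Unit (FormSeries T)}
    (hφ : ∀ m < n, ∀ i, coeff m (φ i ()) = 0) (i : Fin N) :
    coeff n ((Z * φ) i ()) = v * coeff n (φ i ()) := by
  rw [Matrix.mul_apply, map_sum, Finset.sum_eq_single i]
  · rw [coeff_mul_of_lt fun m hm => hφ m hm i, hZ.coeff_zero, Matrix.one_apply_eq, one_smul]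
  · intro j _ hj
    rw [coeff_mul_of_lt fun m hm => hφ m hm j, hZ.coeff_zero, Matrix.one_apply_ne hj.symm, zero_smul,
      zero_mul]
  · simp

lemma VolumeLike.mul_funS_eq_zero (hZ : VolumeLike Z v) {f : SFun D M} {p : M}
    (h : (v * funS f).1 p = 0) : f.1 p = 0 := by
  rw [mul_funS] at h
  exact (smul_eq_zero.1 h).resolve_right (hZ.ne_zero p)

/-- Truncation of a sequence. -/
def truncF (f : ℕ → Fin N → SFun D M) (n m : ℕ) : Fin N → SFun D M :=
  if m < n then f m else 0

lemma truncF_of_lt (f : ℕ → Fin N → SFun D M) {n m : ℕ} (h : m < n) : truncF f n m = f m :=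
  if_pos h

lemma truncF_of_not_lt (f : ℕ → Fin N → SFun D M) {n m : ℕ} (h : ¬m < n) : truncF f n m = 0 :=
  if_neg h

/-- Isolates the unknown of order `n`: the equation at that order is `v · f n` plus a quantity
determined by lower orders. -/
lemma VolumeLike.coeff_sub_trunc (hZ : VolumeLike Z v) (f : ℕ → Fin N → SFun D M) (n : ℕ)
    (i : Fin N) : coeff n ((Z * (DiracField.ofFun f).colS T) i ()) =
      coeff n ((Z * (DiracField.ofFun (truncF f n)).colS T) i ()) + v * funS (f n i) := by
  have h1 : ∀ m < n, ∀ i, coeff m (((DiracField.ofFun f).colS T -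
      (DiracField.ofFun (truncF f n)).colS T) i ()) = 0 := fun m hm i => by
    rw [Matrix.sub_apply, map_sub, coeff_colS, coeff_colS]
    change funS (f m i) - funS (truncF f n m i) = 0
    rw [truncF_of_lt f hm, sub_self]
  have h2 := hZ.coeff_mul h1 i
  have h3 : funS ((DiracField.ofFun (truncF f n)).comp n i) = 0 := by
    change funS (truncF f n n i) = 0
    rw [truncF_of_not_lt f (lt_irrefl n), Pi.zero_apply, funS_zero]
  rw [Matrix.mul_sub, Matrix.sub_apply, map_sub, Matrix.sub_apply, map_sub, coeff_colS, coeff_colS,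
    h3, sub_zero, sub_eq_iff_eq_add'] at h2
  exact h2

/-- Equations with a volume form as leading coefficient are solvable. -/
theorem VolumeLike.exists_solution (hZ : VolumeLike Z v) {b : Matrix (Fin N) Unit (FormSeries T)}
    (hb : DegM D b) : ∃ φ : DiracField D M N, Z * φ.colS T = b := by
  -- Placing the degree condition inside the conclusion makes division a total function, with
  -- default value zero. The recursion can then be defined before the remainders are known to have
  -- top degree.
  have hdiv : ∀ η : SForm D M, ∃ f : SFun D M, IsTop η.1 → v * funS f = η := fun η => by
    by_cases h : IsTop η.1
    · obtain ⟨f, hf, hη⟩ := exists_eq_mulF v.2 hZ.isTop hZ.ne_zero η.2 h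
      exact ⟨⟨f, hf⟩, fun _ => Subtype.ext ((mul_funS _ _).trans hη)⟩
    · exact ⟨0, fun h' => (h h').elim⟩
  choose div hdiv using hdiv
  let F : (n : ℕ) → ((m : ℕ) → m < n → Fin N → SFun D M) → Fin N → SFun D M := fun n ih i =>
    div (coeff n (b i ()) - coeff n ((Z * (DiracField.ofFun fun m =>
      if h : m < n then ih m h else 0).colS T) i ()))
  let f : ℕ → Fin N → SFun D M := WellFounded.fix Nat.lt_wfRel.wf F
  have hf : ∀ n i, f n i = div (coeff n (b i ()) -
      coeff n ((Z * (DiracField.ofFun (truncF f n)).colS T) i ())) := fun n i => by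
    -- The truncation written into `F` agrees definitionally with `truncF f n`.
    have h := congrFun (WellFounded.fix_eq Nat.lt_wfRel.wf F n) i
    exact h
  refine ⟨DiracField.ofFun f, Matrix.ext fun i j => FormSeries.ext fun n => ?_⟩
  obtain ⟨⟩ := j
  rw [hZ.coeff_sub_trunc, hf, hdiv, add_sub_cancel]
  -- The remainder has top degree, which discharges the condition in `hdiv`.
  have h1 : DegM D (b - Z * (DiracField.ofFun (truncF f n)).colS T) :=
    hb.sub (hZ.deg.mul (degM_colS _))
  have h2 := IsDeg.isTop (h1 i ()) n
  rwa [Matrix.sub_apply, map_sub] at h2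

/-- Supports of solutions. -/
theorem VolumeLike.suppM (hZ : VolumeLike Z v) {C : SuppSeq M} {φ : DiracField D M N}
    (h : SuppM C (Z * φ.colS T)) : SuppM C (φ.colS T) := by
  have key : ∀ n i, coeff n (φ.colS T i ()) ∈ vanishS (C.set n) := by
    intro n
    induction n using Nat.strong_induction_on with
    | _ n ih =>
      intro i p hp
      -- By induction the lower orders are supported in `C`, so the remainder `v · φ n` vanishes off
      -- `C.set n`; the volume form has no zeros and can be divided out.
      have h1 : SuppM C ((DiracField.ofFun (truncF φ.comp n)).colS T) := fun i j m => by
        rw [coeff_colS]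
        change funS (truncF φ.comp n m i) ∈ _
        by_cases hm : m < n
        · rw [truncF_of_lt _ hm]
          exact ih m hm i
        · rw [truncF_of_not_lt _ hm, Pi.zero_apply, funS_zero]
          exact zero_mem _
      have h2 := hZ.coeff_sub_trunc φ.comp n i
      have h3 : v * funS (φ.comp n i) ∈ vanishS (C.set n) := by
        have h4 := sub_mem (h i () n) (h1.mul_left Z i () n)
        change coeff n ((Z * (DiracField.ofFun φ.comp).colS T) i ()) - _ ∈ _ at h4
        rwa [h2, add_sub_cancel_left] at h4
      change algebraMap ℂ _ ((φ.comp n i).1 p) = 0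
      rw [hZ.mul_funS_eq_zero (h3 p hp), map_zero]
  exact fun i _ n => key n i

/-- Uniqueness of solutions. -/
theorem VolumeLike.injective (hZ : VolumeLike Z v) {φ φ' : DiracField D M N}
    (h : Z * φ.colS T = Z * φ'.colS T) : φ = φ' := by
  have key : ∀ n i, coeff n ((φ.colS T - φ'.colS T) i ()) = 0 := by
    intro n
    induction n using Nat.strong_induction_on with
    | _ n ih =>
      intro i
      have h1 := hZ.coeff_mul ih i
      rw [Matrix.mul_sub, h, sub_self, Matrix.zero_apply, map_zero, Matrix.sub_apply, map_sub,
        coeff_colS, coeff_colS, mul_sub] at h1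
      have h2 : v * funS (φ.comp n i) = v * funS (φ'.comp n i) := (sub_eq_zero.1 h1.symm)
      have h3 : mulF (φ.comp n i).1 v.1 = mulF (φ'.comp n i).1 v.1 := by
        rw [← mul_funS, h2, mul_funS]
      have h4 : φ.comp n i = φ'.comp n i := Subtype.ext (funext fun p =>
        smul_left_injective ℂ (hZ.ne_zero p) (congrFun h3 p))
      rw [Matrix.sub_apply, map_sub, coeff_colS, coeff_colS, h4, sub_self]
  refine colS_injective (T := T) (sub_eq_zero.1 (Matrix.ext fun i j => FormSeries.ext fun n => ?_))
  exact key n i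

end DiracFields

/-! ### The Dirac operator of a star geometry -/

section DiracOperator

open Finset.HasAntidiagonal (antidiagonal)
open FormSeries

variable {D : ℕ} {M : Type*} [TopologicalSpace M] [ChartedSpace (Eucl D) M]
  [IsManifold (𝓡 D) ∞ M] {N : ℕ}

/-- Data that define a Dirac operator: `Q` and `W` are powers of the vielbein, `Om` is the
connection. -/
structure DiracGeom (T : AbelianTwist D M) (N : ℕ) where
  (Q W Om : Matrix (Fin N) (Fin N) (FormSeries T))
  (γ₀ γ : Matrix (Fin N) (Fin N) ℂ)
  (a b ε : ℂ)
  v : SForm D M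
  degW : ℕ
  odd_degW : Odd degW
  degW_succ : degW + 1 = D
  deg_W : DegM degW W
  deg_Om : DegM 1 Om
  d_W : W.map d = Om * W + W * Om
  W_γ : W * cst T γ = -(cst T γ * W)
  Q_γ : Q * cst T γ = cst T γ * Q
  Om_γ : Om * cst T γ = cst T γ * Om
  γ₀_sq : γ₀ * γ₀ = 1
  γ₀_star : γ₀ᴴ = γ₀
  γ_star : γᴴ = γ
  γ_γ₀ : γ * γ₀ = -(γ₀ * γ)
  star_W : Wᴴ = cst T γ₀ * W * cst T γ₀
  star_Q : Qᴴ = cst T γ₀ * Q * cst T γ₀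
  star_Om : Omᴴ = -(cst T γ₀ * Om * cst T γ₀)
  ε_sq : ε * ε = 1
  star_vol : extStar (covConj (Eucl D)) (dxS D Finset.univ) = ε • dxS D Finset.univ
  -- The factor `ε` comes from conjugating an integral. The signs required of `a` and `b` are
  -- opposite because `γ₀Qγ` is antihermitian while `γ₀Wγ` is hermitian.
  conj_a : conj a * ε = -a
  conj_b : conj b * ε = b
  a_ne_zero : a ≠ 0
  vol : VolumeLike (Q * cst T γ) v

/-- The sequence of sets constantly equal to the whole space. -/
def FormSeries.SuppSeq.univ (M : Type*) [TopologicalSpace M] : SuppSeq M :=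
  ⟨fun _ => Set.univ, fun _ => isClosed_univ, fun _ _ _ => le_rfl⟩

lemma FormSeries.suppM_univ {T : AbelianTwist D M} {k l : Type*} (A : Matrix k l (FormSeries T)) :
    SuppM (SuppSeq.univ M) A := fun _ _ _ _ h => (h trivial).elim

lemma DiracField.HasCompactSupp.overlap_univ {ψ : DiracField D M N} (h : ψ.HasCompactSupp) :
    ψ.supp.Overlap (SuppSeq.univ M) := fun m n => by
  change IsCompact ((⋃ i ∈ Set.Iic m, tsupport (ψ.1 i)) ∩ Set.univ)
  rw [Set.inter_univ]
  exact (Set.finite_Iic m).isCompact_biUnion fun i _ => (h i).isCompact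

/-- The Dirac field `f e_i`. -/
def testField (f : SFun D M) (i : Fin N) : DiracField D M N :=
  DiracField.ofFun fun n j => if n = 0 ∧ j = i then f else 0

lemma hasCompactSupp_testField {f : SFun D M} (hf : HasCompactSupport f.1) (i : Fin N) :
    (testField f i).HasCompactSupp := fun n => by
  refine hf.mono' ?_
  intro p hp
  refine subset_tsupport f.1 fun h0 => hp (funext fun j => ?_)
  change (if n = 0 ∧ j = i then f else 0 : SFun D M).1 p = 0
  split_ifs
  · exact h0
  · rfl

section

variable [T2Space M] [SigmaCompactSpace M] {T : AbelianTwist D M}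

lemma trace_map_d {k : Type*} [Fintype k] (A : Matrix k k (FormSeries T)) :
    (A.map d).trace = d A.trace := by
  simp [Matrix.trace]

/-- A column of forms of top degree is zero if its pairings with all test fields vanish. -/
theorem eq_zero_of_pairing (hO : OrientedAtlas D M) {b : Matrix (Fin N) Unit (FormSeries T)}
    (hb : DegM D b) (h : ∀ ψ : DiracField D M N, ψ.HasCompactSupp →
      J ((ψ.colS T)ᴴ * b).trace = 0) : b = 0 := by
  refine Matrix.ext fun i j => FormSeries.ext fun n => Subtype.ext ?_
  obtain ⟨⟩ := j
  refine (IsDeg.isTop (hb i ()) n).eq_zero fun x => topCoeff_eq_zero_of_integral hO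
    (coeff n (b i ())).2 (fun f hf hc => ?_) x
  -- A test field that is constant in `λ` with a single nonzero real component: at order `n` it
  -- pairs only with the order `n` coefficient of entry `i`.
  let F : SFun D M := ⟨fun p => (f p : ℂ), Complex.ofRealCLM.contDiff.contMDiff.comp hf⟩
  have hF : HasCompactSupport F.1 := hc.comp_left (g := fun r : ℝ => (r : ℂ)) Complex.ofReal_zero
  have hψ := hasCompactSupp_testField hF i
  have h1 := congrArg (PowerSeries.coeff n) (h _ hψ)
  have hcoeff : ∀ m, coeff m ((testField F i).colS T i ()) = if m = 0 then funS F else 0 := by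
    intro m
    rw [coeff_colS]
    change funS (if m = 0 ∧ i = i then F else 0) = _
    by_cases hm : m = 0
    · rw [if_pos ⟨hm, rfl⟩, if_pos hm]
    · rw [if_neg fun h => hm h.1, if_neg hm, funS_zero]
  have h2 : ((testField F i).colS T)ᴴ * b =
      Matrix.of fun _ _ => star ((testField F i).colS T i ()) * b i () := by
    refine Matrix.ext fun j k => ?_
    rw [Matrix.mul_apply, Finset.sum_eq_single i]
    · rfl
    · intro s _ hs
      have : (testField F i).colS T s j = 0 := FormSeries.ext fun m => by
        rw [coeff_colS, map_zero]
        change funS (if m = 0 ∧ s = i then F else 0) = _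
        rw [if_neg fun h => hs h.2, funS_zero]
      rw [Matrix.conjTranspose_apply, this, star_zero, zero_mul]
    · simp
  have hs : star (funS F) = funS F := Subtype.ext ((starF_funForm _).trans
    (congrArg funForm (funext fun p => Complex.conj_ofReal (f p))))
  rw [h2, Matrix.trace, Fintype.sum_unique, Matrix.diag_apply, Matrix.of_apply,
    coeff_J_mul hO hψ.overlap_univ (star_mem_suppIn (suppM_colS _ i ()))
      (suppM_univ b i ()), Finset.sum_eq_single (0, n), coeff_star, hcoeff, if_pos rfl, hs,
    map_zero] at h1
  · rw [mulF_eq]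
    exact h1
  · rintro ⟨q, r⟩ hq hne
    rw [Finset.HasAntidiagonal.mem_antidiagonal] at hq
    have : q ≠ 0 := by rintro rfl; simp_all
    rw [coeff_star, hcoeff, if_neg this, star_zero, zero_mul]
    exact integral_zero
  · simp

/-! ### The operator equation and hermiticity -/

namespace DiracGeom

variable (G : DiracGeom T N)

/-- The inner product. -/
def ip (ψ₁ ψ₂ : DiracField D M N) : PowerSeries ℂ :=
  G.a • J (ψ₂.colS T * ((ψ₁.colS T)ᴴ * cst T G.γ₀) * (G.Q * cst T G.γ)).trace

/-- The covariant derivative of a Dirac field. -/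
def nabla (ψ : DiracField D M N) : Matrix (Fin N) Unit (FormSeries T) :=
  (ψ.colS T).map d - G.Om * ψ.colS T

/-- The Dirac action. -/
def action (ψ₁ ψ₂ : DiracField D M N) : PowerSeries ℂ :=
  G.b • J (G.nabla ψ₂ * ((ψ₁.colS T)ᴴ * cst T G.γ₀) * (G.W * cst T G.γ)).trace

lemma suppM_nabla (ψ : DiracField D M N) : SuppM ψ.supp (G.nabla ψ) :=
  (suppM_colS ψ).d.sub ((suppM_colS ψ).mul_left _)

lemma degM_nabla (ψ : DiracField D M N) : DegM 1 (G.nabla ψ) :=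
  (degM_colS ψ).d.sub (G.deg_Om.mul (degM_colS ψ))

/-- The column `φ` consists of functions, so cyclicity moves it to the end without sign. The
dependence on `φ` is then left multiplication by `Qγ`, followed by the invertible `γ₀`. Supports are
arbitrary here because `φ` will be a Dirac operator applied to a field, or an unknown candidate for
it. -/
lemma ip_eq (hO : OrientedAtlas D M) {C C' : SuppSeq M} (h : C.Overlap C') {ψ φ : DiracField D M N}
    (hψ : SuppM C (ψ.colS T)) (hφ : SuppM C' (φ.colS T)) :
    G.ip ψ φ = G.a • J ((ψ.colS T)ᴴ * (cst T G.γ₀ * (G.Q * cst T G.γ * φ.colS T))).trace := by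
  rw [ip, Matrix.mul_assoc, J_trace_comm_of_even hO h.symm hφ
    ((hψ.conjTranspose.mul_right _).mul_right _) (degM_colS φ)]
  simp only [Matrix.mul_assoc]

/-- Here the factor moved is a one-form and the rest has odd degree `D - 1`, which costs a sign. -/
lemma action_eq (hO : OrientedAtlas D M) {ψ₁ ψ₂ : DiracField D M N}
    (h : ψ₁.supp.Overlap ψ₂.supp) : G.action ψ₁ ψ₂ =
      -(G.b • J ((ψ₁.colS T)ᴴ * (cst T G.γ₀ * (G.W * cst T G.γ * G.nabla ψ₂))).trace) := by
  have h1 : DegM (0 + 0 + (G.degW + 0)) ((ψ₁.colS T)ᴴ * cst T G.γ₀ * (G.W * cst T G.γ)) :=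
    ((degM_colS ψ₁).conjTranspose.mul (degM_cst _)).mul (G.deg_W.mul (degM_cst _))
  rw [action, Matrix.mul_assoc, J_trace_comm_of_odd hO h.symm (G.suppM_nabla ψ₂)
    (((suppM_colS ψ₁).conjTranspose.mul_right _).mul_right _) odd_one
    (by simpa using G.odd_degW) (G.degM_nabla ψ₂) h1, smul_neg]
  simp only [Matrix.mul_assoc]

/-- Existence of the Dirac operator. -/
theorem exists_dirac (ψ : DiracField D M N) : ∃ φ : DiracField D M N,
    G.Q * cst T G.γ * φ.colS T = (-(G.b / G.a)) • (G.W * cst T G.γ * G.nabla ψ) := by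
  -- The right side has degree `degW + 1 = D`. Its factor `-(b/a)` accounts for the sign in
  -- `action_eq` and the two prefactors.
  refine G.vol.exists_solution (DegM.smul ?_ _)
  have := (G.deg_W.mul_cst G.γ).mul (G.degM_nabla ψ)
  rwa [G.degW_succ] at this

/-- The Dirac operator. -/
def dirac (ψ : DiracField D M N) : DiracField D M N := (G.exists_dirac ψ).choose

lemma dirac_spec (ψ : DiracField D M N) :
    G.Q * cst T G.γ * (G.dirac ψ).colS T = (-(G.b / G.a)) • (G.W * cst T G.γ * G.nabla ψ) :=
  (G.exists_dirac ψ).choose_spec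

/-- The operator does not enlarge supports. This keeps all integrals compactly supported when only
the overlap of the two fields is compact. -/
lemma suppM_dirac (ψ : DiracField D M N) : SuppM ψ.supp ((G.dirac ψ).colS T) := by
  refine G.vol.suppM ?_
  rw [G.dirac_spec]
  exact ((G.suppM_nabla ψ).mul_left _).smul _

/-- The defining identity extends from compactly supported `ψ₁` to compactly overlapping pairs, as
formal self-adjointness demands. -/
lemma ip_dirac (hO : OrientedAtlas D M) {ψ₁ ψ₂ : DiracField D M N}
    (h : ψ₁.supp.Overlap ψ₂.supp) : G.ip ψ₁ (G.dirac ψ₂) = G.action ψ₁ ψ₂ := by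
  rw [G.ip_eq hO h (suppM_colS ψ₁) (G.suppM_dirac ψ₂), G.action_eq hO h, G.dirac_spec,
    Matrix.mul_smul, Matrix.mul_smul, Matrix.trace_smul, J_smul, smul_smul, ← neg_smul]
  congr 1
  have := G.a_ne_zero
  field_simp

lemma represents_dirac (hO : OrientedAtlas D M) : Represents G.ip G.action G.dirac :=
  fun _ ψ₂ h => G.ip_dirac hO (h.overlap ψ₂).supp

/-- Uniqueness of the Dirac operator. -/
theorem eq_dirac (hO : OrientedAtlas D M) {P : DiracField D M N → DiracField D M N}
    (hP : Represents G.ip G.action P) : P = G.dirac := by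
  funext ψ₂
  refine G.vol.injective ?_
  have hd : DegM D (G.Q * cst T G.γ * (P ψ₂).colS T - G.Q * cst T G.γ * (G.dirac ψ₂).colS T) :=
    (G.vol.deg.mul (degM_colS _)).sub (G.vol.deg.mul (degM_colS _))
  have hd' : DegM (0 + D) (cst T G.γ₀ * (G.Q * cst T G.γ * (P ψ₂).colS T -
    G.Q * cst T G.γ * (G.dirac ψ₂).colS T)) := (degM_cst _).mul hd
  rw [zero_add] at hd'
  -- Nothing is known about the support of `P ψ₂`, so compactness is supplied by the test field
  -- alone, with the whole space as the other support.
  have h0 := eq_zero_of_pairing hO hd' fun ψ hψ => by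
    have h1 : G.ip ψ (P ψ₂) = G.ip ψ (G.dirac ψ₂) :=
      (hP ψ ψ₂ hψ).trans (G.represents_dirac hO ψ ψ₂ hψ).symm
    rw [G.ip_eq hO hψ.overlap_univ (suppM_colS ψ) (suppM_univ _),
      G.ip_eq hO hψ.overlap_univ (suppM_colS ψ) (suppM_univ _)] at h1
    have h2 := smul_right_injective (PowerSeries ℂ) G.a_ne_zero h1
    have hc : ∀ A : Matrix (Fin N) Unit (FormSeries T), ((ψ.colS T)ᴴ * A).trace ∈ cpt T :=
      fun A => sum_mem fun i _ =>
        SuppM.mul_cpt hψ.overlap_univ (suppM_colS ψ).conjTranspose (suppM_univ A) i i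
    rw [Matrix.mul_sub, Matrix.mul_sub, Matrix.trace_sub, J_sub (hc _) (hc _)]
    exact sub_eq_zero.2 h2
  -- `γ₀` is its own inverse, so the two sides of the operator equation agree.
  have h1 := congrArg (cst T G.γ₀ * ·) h0
  simp only [← Matrix.mul_assoc, cst_mul, G.γ₀_sq, cst_one, Matrix.one_mul, Matrix.mul_zero] at h1
  exact sub_eq_zero.1 (by simpa only [Matrix.mul_assoc] using h1)

lemma cst_γ₀_sq : cst T G.γ₀ * cst T G.γ₀ = 1 := by rw [cst_mul, G.γ₀_sq, cst_one]

lemma cst_γ_γ₀ : cst T G.γ * cst T G.γ₀ = -(cst T G.γ₀ * cst T G.γ) := by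
  rw [cst_mul, cst_mul, G.γ_γ₀, cst_neg]

/-- Conjugation reverses the product, and restoring the order moves `γ` past `γ₀`, with a sign, and
past `Q`, without one. For `W` below a second sign arises, because an odd power of the vielbein
anticommutes with `γ`. -/
lemma star_Qγ : (cst T G.γ₀ * (G.Q * cst T G.γ))ᴴ = -(cst T G.γ₀ * (G.Q * cst T G.γ)) := by
  rw [Matrix.conjTranspose_mul, Matrix.conjTranspose_mul, cst_conjTranspose, cst_conjTranspose,
    G.γ₀_star, G.γ_star, G.star_Q, Matrix.mul_assoc, Matrix.mul_assoc, Matrix.mul_assoc,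
    G.cst_γ₀_sq, Matrix.mul_one, ← Matrix.mul_assoc, G.cst_γ_γ₀, G.Q_γ, Matrix.neg_mul,
    Matrix.mul_assoc]

lemma star_Wγ : (cst T G.γ₀ * (G.W * cst T G.γ))ᴴ = cst T G.γ₀ * (G.W * cst T G.γ) := by
  rw [Matrix.conjTranspose_mul, Matrix.conjTranspose_mul, cst_conjTranspose, cst_conjTranspose,
    G.γ₀_star, G.γ_star, G.star_W, Matrix.mul_assoc, Matrix.mul_assoc, Matrix.mul_assoc,
    G.cst_γ₀_sq, Matrix.mul_one, ← Matrix.mul_assoc, G.cst_γ_γ₀, G.W_γ, Matrix.neg_mul,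
    Matrix.mul_neg, Matrix.mul_assoc]

lemma map_conj_J (x : FormSeries T) : (J x).map (starRingEnd ℂ) = G.ε • J (star x) := by
  rw [J_star G.star_vol, smul_smul, G.ε_sq, one_smul]

lemma map_conj_smul (c : ℂ) (f : PowerSeries ℂ) :
    (c • f).map (starRingEnd ℂ) = conj c • f.map (starRingEnd ℂ) := by
  ext n
  simp

/-- The three signs, from conjugating `a`, from the volume form and from the antihermitian `γ₀Qγ`,
cancel. -/
lemma ip_conj (hO : OrientedAtlas D M) {C C' : SuppSeq M} (h : C.Overlap C')
    {ψ φ : DiracField D M N} (hψ : SuppM C (ψ.colS T)) (hφ : SuppM C' (φ.colS T)) :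
    (G.ip ψ φ).map (starRingEnd ℂ) = G.ip φ ψ := by
  rw [G.ip_eq hO h hψ hφ, G.ip_eq hO h.symm hφ hψ, map_conj_smul, G.map_conj_J, smul_smul, G.conj_a,
    ← Matrix.trace_conjTranspose, neg_smul, ← smul_neg, ← J_neg, ← Matrix.trace_neg]
  congr 3
  rw [← Matrix.mul_assoc (cst T G.γ₀) _ (φ.colS T), ← Matrix.mul_assoc (cst T G.γ₀) _ (ψ.colS T),
    Matrix.conjTranspose_mul, Matrix.conjTranspose_mul, Matrix.conjTranspose_conjTranspose,
    G.star_Qγ, Matrix.mul_assoc, Matrix.neg_mul, Matrix.mul_neg, neg_neg]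

/-- The reality of `Ω` turns the adjoint of `dψ - Ωψ` into the covariant derivative of the Dirac
adjoint, with `Ω` acting from the right and the opposite sign. -/
lemma nabla_star (ψ : DiracField D M N) : (G.nabla ψ)ᴴ * cst T G.γ₀ =
    (ψ.colS T)ᴴ.map d * cst T G.γ₀ + (ψ.colS T)ᴴ * (cst T G.γ₀ * G.Om) := by
  rw [nabla, Matrix.conjTranspose_sub, map_d_conjTranspose_colS, Matrix.conjTranspose_mul,
    G.star_Om, Matrix.mul_neg, sub_neg_eq_add, Matrix.add_mul, Matrix.mul_assoc _ _ (cst T G.γ₀),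
    Matrix.mul_assoc _ _ (cst T G.γ₀), G.cst_γ₀_sq, Matrix.mul_one]

/-- The integration by parts of the Dirac action. It is here that vanishing torsion enters, through
`dW = ΩW + WΩ`. -/
lemma action_conj (hO : OrientedAtlas D M) {ψ₁ ψ₂ : DiracField D M N}
    (h : ψ₁.supp.Overlap ψ₂.supp) :
    (G.action ψ₂ ψ₁).map (starRingEnd ℂ) = G.action ψ₁ ψ₂ := by
  rw [G.action_eq hO h, G.action_eq hO h.symm, map_neg, map_conj_smul, G.map_conj_J, smul_smul,
    G.conj_b, ← Matrix.trace_conjTranspose]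
  congr 2
  set u := ψ₁.colS T with hu
  set w := ψ₂.colS T with hw
  set K := cst T G.γ₀ * (G.W * cst T G.γ) with hK
  have hdegK : DegM (0 + (G.degW + 0)) K := (degM_cst _).mul (G.deg_W.mul (degM_cst _))
  have hdK : K.map d = cst T G.γ₀ * ((G.Om * G.W + G.W * G.Om) * cst T G.γ) := by
    rw [hK, map_d_mul (degM_cst _), map_d_cst, Matrix.zero_mul, zero_add, pow_zero, one_smul,
      map_d_mul_cst, G.d_W]
  have hcpt : (uᴴ * (K * w)).trace ∈ cpt T := sum_mem fun i _ =>
    SuppM.mul_cpt h (suppM_colS ψ₁).conjTranspose ((suppM_colS ψ₂).mul_left K) i i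
  have hcpt' : (uᴴ * (K * G.nabla ψ₂)).trace ∈ cpt T := sum_mem fun i _ =>
    SuppM.mul_cpt h (suppM_colS ψ₁).conjTranspose ((G.suppM_nabla ψ₂).mul_left K) i i
  have h1 : (wᴴ * (cst T G.γ₀ * (G.W * cst T G.γ * G.nabla ψ₁)))ᴴ = (G.nabla ψ₁)ᴴ * (K * w) := by
    rw [← Matrix.mul_assoc (cst T G.γ₀), Matrix.conjTranspose_mul, Matrix.conjTranspose_mul,
      Matrix.conjTranspose_conjTranspose, G.star_Wγ, Matrix.mul_assoc]
  -- The two integrands differ by an exact form. In `d(u† K w)` the term `ΩW` of `dW` completes the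
  -- covariant derivative of `u†`; the term `WΩ` completes that of `w`, using that `Ω` commutes with
  -- `γ` and that `K` has odd degree.
  have h2 : (G.nabla ψ₁)ᴴ * (K * w) = (uᴴ * (K * w)).map d + uᴴ * (K * G.nabla ψ₂) := by
    have e1 : (G.nabla ψ₁)ᴴ * (K * w) = uᴴ.map d * (K * w) +
        uᴴ * (cst T G.γ₀ * (G.Om * G.W * cst T G.γ) * w) := by
      rw [hK, Matrix.mul_assoc (cst T G.γ₀), ← Matrix.mul_assoc _ (cst T G.γ₀), G.nabla_star,
        Matrix.add_mul]
      simp only [Matrix.mul_assoc]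
      rfl
    have e2 : (uᴴ * (K * w)).map d = uᴴ.map d * (K * w) +
        uᴴ * (K.map d * w - K * w.map d) := by
      rw [map_d_mul (degM_colS ψ₁).conjTranspose, pow_zero, one_smul, map_d_mul hdegK, zero_add,
        add_zero, G.odd_degW.neg_one_pow, neg_one_smul, sub_eq_add_neg]
    have e3 : K * (G.Om * w) = cst T G.γ₀ * (G.W * G.Om * cst T G.γ) * w := by
      rw [hK, Matrix.mul_assoc G.W, G.Om_γ]
      simp only [Matrix.mul_assoc]
    have e4 : ∀ x y z : Matrix (Fin N) Unit (FormSeries T), x + y - z + (z - y) = x :=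
      fun x y z => by rw [sub_add_sub_cancel, add_sub_cancel_right]
    rw [e1, e2, nabla, ← hw, Matrix.mul_sub K, e3, hdK, Matrix.add_mul, Matrix.mul_add,
      Matrix.add_mul, add_assoc, ← Matrix.mul_add, e4]
  have hd : d (uᴴ * (K * w)).trace ∈ cpt T := fun n => by
    obtain ⟨C, hC, hC'⟩ := hcpt n
    exact ⟨C, hC, VanishOff.dForm hC.isClosed hC'⟩
  rw [h1, h2, Matrix.trace_add, trace_map_d, J_add hd hcpt', J_d hO hcpt, zero_add, hK]
  simp only [Matrix.mul_assoc]

/-- With `S` the action: `⟨ψ₁, Dψ₂⟩ = S(ψ₁, ψ₂)` is the conjugate of `S(ψ₂, ψ₁) = ⟨ψ₂, Dψ₁⟩`, and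
the inner product is hermitian. -/
theorem formallySelfAdjoint_dirac (hO : OrientedAtlas D M) :
    FormallySelfAdjoint G.ip G.dirac := fun ψ₁ ψ₂ h => by
  have h' := h.supp
  rw [G.ip_dirac hO h', ← G.ip_conj hO h'.symm (suppM_colS ψ₂) (G.suppM_dirac ψ₁),
    G.ip_dirac hO h'.symm, G.action_conj hO h']

theorem existsUnique_dirac (hO : OrientedAtlas D M) :
    (∃! P, Represents G.ip G.action P) ∧
      ∀ P, Represents G.ip G.action P → FormallySelfAdjoint G.ip P :=
  ⟨⟨G.dirac, G.represents_dirac hO, fun _ hP => G.eq_dirac hO hP⟩, fun P hP => by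
    rw [G.eq_dirac hO hP]
    exact G.formallySelfAdjoint_dirac hO⟩

end DiracGeom

end

end DiracOperator

/-! ### Matrices of one-forms -/

section Tensors

/-- The matrix `x g` for a ring element `x` and a complex matrix `g`. -/
def tn {R k l : Type*} [Ring R] [Algebra ℂ R] (x : R) (g : Matrix k l ℂ) : Matrix k l R :=
  g.map (· • x)

lemma tn_mul_tn {R k l m : Type*} [Ring R] [Algebra ℂ R] [Fintype l] (x y : R) (g : Matrix k l ℂ)
    (h : Matrix l m ℂ) : tn x g * tn y h = tn (x * y) (g * h) := by
  ext i j
  simp only [tn, Matrix.mul_apply, Matrix.map_apply, smul_mul_smul_comm, Finset.sum_smul]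

lemma tn_neg {R k l : Type*} [Ring R] [Algebra ℂ R] (x : R) (g : Matrix k l ℂ) :
    tn x (-g) = -tn x g := by
  ext i j
  simp [tn]

lemma tn_neg_left {R k l : Type*} [Ring R] [Algebra ℂ R] (x : R) (g : Matrix k l ℂ) :
    tn (-x) g = -tn x g := by
  ext i j
  simp [tn]

lemma tn_zero_left {R k l : Type*} [Ring R] [Algebra ℂ R] (g : Matrix k l ℂ) :
    tn (0 : R) g = 0 := by
  ext i j
  simp [tn]

/-- The binomial expansion stops after the term linear in `x`. -/
lemma add_pow_of_sq_eq_zero {R : Type*} [Ring R] {x y : R} (h : Commute x y) (hx : x * x = 0)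
    (n : ℕ) : (y + x) ^ (n + 1) = y ^ (n + 1) + (n + 1 : ℕ) • (y ^ n * x) := by
  induction n with
  | zero => simp
  | succ n ih =>
    rw [pow_succ, ih, add_mul, mul_add, mul_add, smul_mul_assoc, smul_mul_assoc, mul_assoc (y ^ n) x x,
      hx, mul_zero, smul_zero, add_zero, mul_assoc (y ^ n), h.eq, ← mul_assoc, ← pow_succ,
      ← pow_succ, succ_nsmul' _ (n + 1), add_assoc]

variable {D : ℕ} {M : Type*} [TopologicalSpace M] [ChartedSpace (Eucl D) M]
  [IsManifold (𝓡 D) ∞ M]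

/-- Smooth one-forms as smooth forms. -/
def oneS (ξ : OneForm D M) (h : SmoothOneForm ξ) : SForm D M := ⟨oneForm ξ, smoothForm_oneForm h⟩

lemma oneS_sq (ξ : OneForm D M) (h : SmoothOneForm ξ) : oneS ξ h * oneS ξ h = 0 :=
  Subtype.ext (funext fun p => ExteriorAlgebra.ι_sq_zero (ξ p))

lemma oneS_mul_comm (ξ ζ : OneForm D M) (h : SmoothOneForm ξ) (h' : SmoothOneForm ζ) :
    oneS ξ h * oneS ζ h' = -(oneS ζ h' * oneS ξ h) :=
  Subtype.ext (funext fun p =>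
    eq_neg_of_add_eq_zero_left (ExteriorAlgebra.ι_add_mul_swap (ξ p) (ζ p)))

lemma tn_oneS_sq {k : Type*} [Fintype k] (ξ : OneForm D M) (h : SmoothOneForm ξ)
    (g : Matrix k k ℂ) : tn (oneS ξ h) g * tn (oneS ξ h) g = 0 := by
  rw [tn_mul_tn, oneS_sq, tn_zero_left]

/-- The sign from exchanging two one-forms cancels the sign from exchanging two anticommuting gamma
matrices. -/
lemma commute_tn_oneS {k : Type*} [Fintype k] (ξ ζ : OneForm D M) (h : SmoothOneForm ξ)
    (h' : SmoothOneForm ζ) {g g' : Matrix k k ℂ} (hg : g * g' = -(g' * g)) :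
    Commute (tn (oneS ξ h) g) (tn (oneS ζ h') g') := by
  rw [Commute, SemiconjBy, tn_mul_tn, tn_mul_tn, oneS_mul_comm, hg, tn_neg, tn_neg_left, neg_neg]

variable {T : AbelianTwist D M}

open FormSeries

lemma cst_eq_tn {k l : Type*} (g : Matrix k l ℂ) : cst T g = tn 1 g := by
  ext1 i j
  exact Algebra.algebraMap_eq_smul_one (A := FormSeries T) (g i j)

lemma tn_mul_cst {k l m : Type*} [Fintype l] (x : FormSeries T) (g : Matrix k l ℂ)
    (h : Matrix l m ℂ) : tn x g * cst T h = tn x (g * h) := by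
  rw [cst_eq_tn, tn_mul_tn, mul_one]

lemma cst_mul_tn {k l m : Type*} [Fintype l] (x : FormSeries T) (g : Matrix k l ℂ)
    (h : Matrix l m ℂ) : cst T g * tn x h = tn x (g * h) := by
  rw [cst_eq_tn, tn_mul_tn, one_mul]

variable (T) in
/-- Power series of smooth one-forms. -/
def ser (ξ : FOneForm D M) (h : ∀ n, SmoothOneForm (ξ n)) : FormSeries T :=
  FormSeries.mk fun n => oneS (ξ n) (h n)

lemma scalS_oneS (t : ℂ) (ξ : OneForm D M) (h : SmoothOneForm ξ) :
    scalS t (oneS ξ h) = t • oneS ξ h :=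
  Subtype.ext (funext fun p => scal_ι t (ξ p))

lemma isDeg_ser (ξ : FOneForm D M) (h : ∀ n, SmoothOneForm (ξ n)) : IsDeg 1 (ser T ξ h) :=
  fun t => FormSeries.ext fun n => by
    rw [coeff_scal, map_smul, pow_one]
    exact scalS_oneS t (ξ n) (h n)

lemma degM_tn_ser {k l : Type*} (ξ : FOneForm D M) (h : ∀ n, SmoothOneForm (ξ n))
    (g : Matrix k l ℂ) : DegM 1 (tn (ser T ξ h) g) := fun i j => (isDeg_ser ξ h).smul (g i j)

lemma DegM.sum {k l ι : Type*} {s : Finset ι} {n : ℕ} {A : ι → Matrix k l (FormSeries T)}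
    (hA : ∀ a ∈ s, DegM n (A a)) : DegM n (∑ a ∈ s, A a) := fun i j => by
  rw [Matrix.sum_apply]
  exact IsDeg.sum fun a ha => hA a ha i j

/-- The matrix `A` of power series represents the matrix `W` of one-forms. -/
def Rep {k l : Type*} (A : Matrix k l (FormSeries T)) (W : Matrix k l (FOneForm D M)) : Prop :=
  valM A = toForm W

section Rep

variable {k l m : Type*} {A B : Matrix k l (FormSeries T)} {W X : Matrix k l (FOneForm D M)}

lemma Rep.apply (h : Rep A W) (i : k) (j : l) (n : ℕ) : (coeff n (A i j)).1 = oneForm (W i j n) :=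
  congrFun (congrFun (congrFun h i) j) n

lemma Rep.of_apply (h : ∀ i j n p, (coeff n (A i j)).1 p = ExteriorAlgebra.ι ℂ (W i j n p)) :
    Rep A W :=
  Matrix.ext fun i j => funext fun n => funext fun p => h i j n p

lemma Rep.add (h : Rep A W) (h' : Rep B X) : Rep (A + B) (W + X) :=
  Rep.of_apply fun i j n p => by
    rw [Matrix.add_apply, map_add]
    change (coeff n (A i j)).1 p + (coeff n (B i j)).1 p = _
    rw [h.apply, h'.apply]
    exact (map_add (ExteriorAlgebra.ι ℂ) (W i j n p) (X i j n p)).symm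

lemma Rep.neg (h : Rep A W) : Rep (-A) (-W) :=
  Rep.of_apply fun i j n p => by
    rw [Matrix.neg_apply, map_neg]
    change -(coeff n (A i j)).1 p = _
    rw [h.apply]
    exact (map_neg (ExteriorAlgebra.ι ℂ) (W i j n p)).symm

lemma Rep.zero : Rep (0 : Matrix k l (FormSeries T)) 0 :=
  Rep.of_apply fun _ _ _ p => (map_zero (ExteriorAlgebra.ι ℂ (M := Cov D p))).symm

lemma Rep.sum {ι : Type*} {s : Finset ι} {A : ι → Matrix k l (FormSeries T)}
    {W : ι → Matrix k l (FOneForm D M)} (h : ∀ a ∈ s, Rep (A a) (W a)) :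
    Rep (∑ a ∈ s, A a) (∑ a ∈ s, W a) := by
  classical
  induction s using Finset.induction_on with
  | empty => exact Rep.zero
  | insert a s ha ih =>
    rw [Finset.sum_insert ha, Finset.sum_insert ha]
    exact (h a (Finset.mem_insert_self a s)).add
      (ih fun b hb => h b (Finset.mem_insert_of_mem hb))

lemma Rep.tens (ξ : FOneForm D M) (h : ∀ n, SmoothOneForm (ξ n)) (g : Matrix k l ℂ) :
    Rep (tn (ser T ξ h) g) (tens ξ g) :=
  Rep.of_apply fun i j n p => (map_smul (ExteriorAlgebra.ι ℂ) (g i j) (ξ n p)).symm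

lemma Rep.dagger (h : Rep A W) : Rep Aᴴ (dagger W) :=
  Rep.of_apply fun i j n p => by
    have h1 := congrFun (starF_oneForm (W j i n)) p
    rw [← h.apply] at h1
    exact h1

lemma Rep.cmulL [Fintype k] (h : Rep A W) (g : Matrix m k ℂ) : Rep (cst T g * A) (cmulL g W) := by
  rw [Rep, valM_cst_mul, h]
  refine Matrix.ext fun i j => funext fun n => funext fun p => ?_
  change (∑ s, g i s • toForm W s j) n p = ExteriorAlgebra.ι ℂ ((∑ s, g i s • W s j) n p)
  rw [Finset.sum_apply, Finset.sum_apply, Finset.sum_apply, Finset.sum_apply, map_sum]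
  exact Finset.sum_congr rfl fun s _ =>
    (map_smul (ExteriorAlgebra.ι ℂ) (g i s) (W s j n p)).symm

lemma Rep.cmulR [Fintype l] (h : Rep A W) (g : Matrix l m ℂ) : Rep (A * cst T g) (cmulR W g) := by
  rw [Rep, valM_mul_cst, h]
  refine Matrix.ext fun i j => funext fun n => funext fun p => ?_
  change (∑ s, g s j • toForm W i s) n p = ExteriorAlgebra.ι ℂ ((∑ s, g s j • W i s) n p)
  rw [Finset.sum_apply, Finset.sum_apply, Finset.sum_apply, Finset.sum_apply, map_sum]
  exact Finset.sum_congr rfl fun s _ =>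
    (map_smul (ExteriorAlgebra.ι ℂ) (g s j) (W i s n p)).symm

lemma Rep.unique (h : Rep A W) (h' : Rep B W) : A = B := valM_injective (h.trans h'.symm)

end Rep

lemma map_d_eq_of_torsion {N : ℕ} {V Om : Matrix (Fin N) (Fin N) (FormSeries T)}
    {V' Om' : Matrix (Fin N) (Fin N) (FOneForm D M)} (hV : Rep V V') (hOm : Rep Om Om')
    (h : starTorsion T V' Om' = 0) : V.map d = Om * V + V * Om := by
  rw [← sub_eq_zero]
  refine valM_injective ?_
  rw [valM_sub, valM_add, valM_mul, valM_mul, valM_d, hV, hOm]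
  exact h

/-- In the graded Leibniz rule the connection terms between neighbouring factors cancel, which
leaves one at each end. For an odd power both have a plus sign; for `V ∧⋆ V` the last one has a
minus. -/
lemma map_d_cube {N : ℕ} {V Om : Matrix (Fin N) (Fin N) (FormSeries T)} (hV : DegM 1 V)
    (h : V.map d = Om * V + V * Om) : (V * V * V).map d = Om * (V * V * V) + V * V * V * Om := by
  have h2 : (V * V).map d = Om * V * V - V * V * Om := by
    rw [map_d_mul hV, h, pow_one, neg_one_smul, Matrix.add_mul, Matrix.mul_add,
      ← Matrix.mul_assoc V Om, ← Matrix.mul_assoc V V]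
    abel
  rw [map_d_mul (hV.mul hV), h2, h, neg_one_sq, one_smul, Matrix.sub_mul, Matrix.mul_add]
  simp only [Matrix.mul_assoc]
  abel

variable (T) in
/-- The classical limit. -/
def lim : FormSeries T →+* SForm D M where
  toFun := coeff 0
  map_zero' := map_zero _
  map_one' := rfl
  map_add' := map_add _
  map_mul' a b := by simp [coeff_mul, TwistData.term_zero]

lemma lim_tn_ser {k l : Type*} (ξ : FOneForm D M) (h : ∀ n, SmoothOneForm (ξ n))
    (g : Matrix k l ℂ) : (tn (ser T ξ h) g).map (lim T) = tn (oneS (ξ 0) (h 0)) g := rfl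

lemma lim_tn_one {k l : Type*} (g : Matrix k l ℂ) : (cst T g).map (lim T) = tn 1 g := by
  rw [cst_eq_tn]
  rfl

lemma star_mul_of_star {N : ℕ} {A B g : Matrix (Fin N) (Fin N) (FormSeries T)}
    (hA : Aᴴ = g * A * g) (hB : Bᴴ = g * B * g) (hg : g * g = 1) (hAB : A * B = B * A) :
    (A * B)ᴴ = g * (A * B) * g := by
  rw [Matrix.conjTranspose_mul, hA, hB, hAB]
  simp only [Matrix.mul_assoc]
  rw [← Matrix.mul_assoc g g, hg, Matrix.one_mul]

/-- The product of independent one-forms does not vanish. -/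
lemma ιMulti_ne_zero (p : M) {ξ : Fin D → Cov D p} (h : LinearIndependent ℂ ξ) :
    ExteriorAlgebra.ιMulti ℂ D ξ ≠ 0 := by
  have hcard : Fintype.card (Fin D) = Module.finrank ℂ (Cov D p) :=
    (Module.finrank_eq_card_basis (dx D)).symm
  have : Module.Finite ℂ (Cov D p) := Module.Finite.of_basis (dx D)
  -- By dimension count the independent covectors form a basis, and their product is the top element
  -- of the induced basis of the exterior algebra.
  let b := Module.Basis.mk h (h.span_eq_top_of_card_eq_finrank' hcard).ge
  have hb : b.ExteriorAlgebra Finset.univ = ExteriorAlgebra.ιMulti ℂ D ξ := by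
    rw [ExteriorAlgebra.basis_apply_ofCard b (n := D) (by simp)]
    suffices h : ∀ f : Fin D ↪o Fin D, (f : Fin D → Fin D) = id by
      rw [ExteriorAlgebra.ιMulti_family, h, Function.comp_id, Module.Basis.coe_mk]
    intro f
    rw [← StrictMono.range_inj f.strictMono strictMono_id]
    rw [Set.range_id, (Finite.injective_iff_surjective.1 f.injective).range_eq]
  rw [← hb]
  exact b.ExteriorAlgebra.ne_zero _

end Tensors

open FormSeries

/-! ### Dimension 2 -/

section DimTwo

lemma gamma2_mul_gamma3 (a : Fin 2) : gamma2 a * gamma3 = -(gamma3 * gamma2 a) := by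
  fin_cases a <;> ext i j <;> fin_cases i <;> fin_cases j <;> simp [gamma2, gamma3]

lemma gamma2_zero_sq : gamma2 0 * gamma2 0 = 1 := by
  ext i j; fin_cases i <;> fin_cases j <;> simp [gamma2]

lemma gamma2_zero_star : (gamma2 0)ᴴ = gamma2 0 := by
  ext i j; fin_cases i <;> fin_cases j <;> simp [gamma2]

lemma gamma3_star : gamma3ᴴ = gamma3 := by
  ext i j; fin_cases i <;> fin_cases j <;> simp [gamma2, gamma3]

lemma gamma3_sq : gamma3 * gamma3 = 1 := by
  ext i j; fin_cases i <;> fin_cases j <;> simp [gamma2, gamma3]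

lemma gamma2_anticomm : gamma2 1 * gamma2 0 = -(gamma2 0 * gamma2 1) := by
  ext i j; fin_cases i <;> fin_cases j <;> simp [gamma2]

variable {M : Type*} [TopologicalSpace M] [ChartedSpace (Eucl 2) M] [IsManifold (𝓡 2) ∞ M]
  (T : AbelianTwist 2 M) (g : Cartan2 M)

/-- The vielbein as a matrix of power series. -/
def Cartan2.VS : Matrix (Fin 2) (Fin 2) (FormSeries T) :=
  ∑ a, tn (ser T (g.e a) (g.smooth_e a)) (gamma2 a)

/-- The connection as a matrix of power series. -/
def Cartan2.OmS : Matrix (Fin 2) (Fin 2) (FormSeries T) :=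
  tn (ser T g.w g.smooth_w) gamma3 + tn (ser T g.wt g.smooth_wt) 1

lemma Cartan2.rep_VS : Rep (g.VS T) g.V := Rep.sum fun a _ => Rep.tens _ (g.smooth_e a) _

lemma Cartan2.rep_OmS : Rep (g.OmS T) g.Om :=
  (Rep.tens _ g.smooth_w _).add (Rep.tens _ g.smooth_wt _)

lemma Cartan2.degM_VS : DegM 1 (g.VS T) := DegM.sum fun a _ => degM_tn_ser _ (g.smooth_e a) _

lemma Cartan2.degM_OmS : DegM 1 (g.OmS T) :=
  (degM_tn_ser _ g.smooth_w _).add (degM_tn_ser _ g.smooth_wt _)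

lemma Cartan2.VS_γ : g.VS T * cst T gamma3 = -(cst T gamma3 * g.VS T) := by
  simp only [VS, Finset.sum_mul, Finset.mul_sum, tn_mul_cst, cst_mul_tn, gamma2_mul_gamma3, tn_neg,
    Finset.sum_neg_distrib]

lemma Cartan2.OmS_γ : g.OmS T * cst T gamma3 = cst T gamma3 * g.OmS T := by
  simp only [OmS, Matrix.add_mul, Matrix.mul_add, tn_mul_cst, cst_mul_tn, Matrix.one_mul,
    Matrix.mul_one]

lemma Cartan2.star_VS : (g.VS T)ᴴ = cst T (gamma2 0) * g.VS T * cst T (gamma2 0) := by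
  rw [Matrix.mul_assoc]
  have h := (g.rep_VS T).dagger
  rw [g.real_V] at h
  exact h.unique (((g.rep_VS T).cmulR _).cmulL _)

lemma Cartan2.star_OmS : (g.OmS T)ᴴ = -(cst T (gamma2 0) * g.OmS T * cst T (gamma2 0)) := by
  rw [Matrix.mul_assoc]
  have h := (g.rep_OmS T).dagger
  rw [g.real_Om] at h
  exact h.unique (((g.rep_OmS T).cmulR _).cmulL _).neg

/-- The classical volume form. -/
def Cartan2.vol : SForm 2 M :=
  (2 : ℂ) • (oneS (g.e 0 0) (g.smooth_e 0 0) * oneS (g.e 1 0) (g.smooth_e 1 0))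

lemma Cartan2.vol_ne_zero (p : M) : g.vol.1 p ≠ 0 := by
  have h := ιMulti_ne_zero p (g.nondeg p)
  have h1 : g.vol.1 p = (2 : ℂ) • ExteriorAlgebra.ιMulti ℂ 2 (fun a => g.e a 0 p) := by
    rw [ExteriorAlgebra.ιMulti_apply]
    simp only [List.ofFn_succ, List.ofFn_zero, List.prod_cons, List.prod_nil, mul_one]
    rfl
  rw [h1]
  exact smul_ne_zero two_ne_zero h

/-- The two summands of the classical vielbein commute and square to zero, so the square is twice
their product. Its matrix part is `γ₀γ₁ = γ₃`, and `γ₃² = 1`. -/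
lemma Cartan2.lim_VS_sq : (g.VS T * g.VS T * cst T gamma3).map (lim T) = tn g.vol 1 := by
  have h1 : (g.VS T).map (lim T) = tn (oneS (g.e 0 0) (g.smooth_e 0 0)) (gamma2 0) +
      tn (oneS (g.e 1 0) (g.smooth_e 1 0)) (gamma2 1) := by
    rw [VS, Fin.sum_univ_two]
    exact Matrix.ext fun i j => map_add (lim T) _ _
  rw [Matrix.map_mul, Matrix.map_mul, h1, lim_tn_one, ← pow_two, add_pow_of_sq_eq_zero
    (commute_tn_oneS _ _ _ _ gamma2_anticomm) (tn_oneS_sq _ _ _) 1, pow_two, tn_oneS_sq, zero_add,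
    pow_one, tn_mul_tn, smul_mul_assoc, tn_mul_tn, mul_one]
  change _ • tn _ (gamma3 * gamma3) = _
  rw [gamma3_sq]
  ext1 i j
  simp only [tn, vol, Matrix.smul_apply, Matrix.map_apply]
  rw [smul_comm _ (2 : ℂ), ← Nat.cast_smul_eq_nsmul ℂ]
  norm_num

/-- The data of the Dirac operator in dimension 2. -/
def Cartan2.geom (h : starTorsion T g.V g.Om = 0) : DiracGeom T 2 where
  Q := g.VS T * g.VS T
  W := g.VS T
  Om := g.OmS T
  γ₀ := gamma2 0
  γ := gamma3
  -- The prefactors of `innerProd2` and `action2`, and the sign of reversing two covectors.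
  a := 1
  b := 2 * Complex.I
  ε := -1
  v := g.vol
  degW := 1
  odd_degW := odd_one
  degW_succ := rfl
  deg_W := g.degM_VS T
  deg_Om := g.degM_OmS T
  d_W := map_d_eq_of_torsion (g.rep_VS T) (g.rep_OmS T) h
  W_γ := g.VS_γ T
  Q_γ := by
    rw [Matrix.mul_assoc, g.VS_γ, Matrix.mul_neg, ← Matrix.mul_assoc, g.VS_γ, Matrix.neg_mul, neg_neg,
      Matrix.mul_assoc]
  Om_γ := g.OmS_γ T
  γ₀_sq := gamma2_zero_sq
  γ₀_star := gamma2_zero_star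
  γ_star := gamma3_star
  γ_γ₀ := by rw [gamma2_mul_gamma3, neg_neg]
  star_W := g.star_VS T
  star_Q := star_mul_of_star (g.star_VS T) (g.star_VS T)
    (by rw [cst_mul, gamma2_zero_sq, cst_one]) rfl
  star_Om := g.star_OmS T
  ε_sq := by norm_num
  star_vol := extStar_dxS_two
  conj_a := by simp
  conj_b := by rw [map_mul, Complex.conj_I, map_ofNat]; ring
  a_ne_zero := one_ne_zero
  vol :=
    have hd : DegM 2 (g.VS T * g.VS T * cst T gamma3) :=
      ((g.degM_VS T).mul (g.degM_VS T)).mul_cst _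
    have h0 : ∀ i j, coeff 0 ((g.VS T * g.VS T * cst T gamma3) i j) =
        (1 : Matrix (Fin 2) (Fin 2) ℂ) i j • g.vol := fun i j =>
      congrFun (congrFun (g.lim_VS_sq T) i) j
    { deg := hd
      coeff_zero := h0
      isTop := by
        have h1 := IsDeg.isTop (hd 0 0) 0
        rwa [h0, Matrix.one_apply_eq, one_smul] at h1
      ne_zero := g.vol_ne_zero }

variable [T2Space M] [SigmaCompactSpace M]

lemma Cartan2.innerProd2_eq (h : starTorsion T g.V g.Om = 0) :
    innerProd2 T g = (g.geom T h).ip := by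
  funext ψ₁ ψ₂
  rw [innerProd2, ← g.rep_VS T, ← valM_colS (T := T), ← valM_colS_bar (T := T), ← valM_mul,
    ← valM_mul, ← valM_mul, ← valM_mul_cst, intTr_valM, DiracGeom.ip]
  simp only [geom, one_smul, Matrix.mul_assoc]

lemma Cartan2.action2_eq (h : starTorsion T g.V g.Om = 0) :
    action2 T g = (g.geom T h).action := by
  funext ψ₁ ψ₂
  rw [action2, covD, ← g.rep_VS T, ← g.rep_OmS T, ← valM_colS (T := T), ← valM_colS_bar (T := T),
    ← valM_mul, ← valM_d, ← valM_sub, ← valM_mul, ← valM_mul, ← valM_mul_cst, intTr_valM,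
    DiracGeom.action, DiracGeom.nabla]
  simp only [geom, Matrix.mul_assoc]

end DimTwo

/-! ### Dimension 4 -/

section DimFour

/-! ### Gamma matrix algebra in dimension 4 -/

namespace Gamma4

variable (G : Gamma4)

lemma anticomm {a b : Fin 4} (h : a ≠ b) : G.γ a * G.γ b = -(G.γ b * G.γ a) := by
  have := G.clifford a b
  rw [eta4, Matrix.diagonal_apply_ne _ h, mul_zero, zero_smul] at this
  exact eq_neg_of_add_eq_zero_left this

lemma sq_eq (a : Fin 4) : G.γ a * G.γ a = eta4 a a • (1 : Matrix (Fin 4) (Fin 4) ℂ) := by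
  have := G.clifford a a
  rw [← two_smul ℂ, mul_smul] at this
  exact smul_right_injective _ (two_ne_zero (α := ℂ)) this

lemma sq_zero : G.γ 0 * G.γ 0 = 1 := by rw [sq_eq]; simp [eta4]

lemma sq_one : G.γ 1 * G.γ 1 = -1 := by rw [sq_eq]; simp [eta4]

lemma sq_two : G.γ 2 * G.γ 2 = -1 := by rw [sq_eq]; simp [eta4]

lemma sq_three : G.γ 3 * G.γ 3 = -1 := by rw [sq_eq]; simp [eta4]

/-- The product of the four gamma matrices. -/
def prod : Matrix (Fin 4) (Fin 4) ℂ := G.γ 0 * (G.γ 1 * (G.γ 2 * G.γ 3))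

lemma γ5_eq : G.γ5 = Complex.I • G.prod := by
  rw [γ5, prod, mul_assoc, mul_assoc]

lemma left_anticomm {a b : Fin 4} (h : a ≠ b) (X : Matrix (Fin 4) (Fin 4) ℂ) :
    G.γ a * (G.γ b * X) = -(G.γ b * (G.γ a * X)) := by
  rw [← mul_assoc, G.anticomm h, neg_mul, mul_assoc]

lemma left_sq_zero (X : Matrix (Fin 4) (Fin 4) ℂ) : G.γ 0 * (G.γ 0 * X) = X := by
  rw [← mul_assoc, G.sq_zero, one_mul]

lemma left_sq_one (X : Matrix (Fin 4) (Fin 4) ℂ) : G.γ 1 * (G.γ 1 * X) = -X := by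
  rw [← mul_assoc, G.sq_one, neg_one_mul]

lemma left_sq_two (X : Matrix (Fin 4) (Fin 4) ℂ) : G.γ 2 * (G.γ 2 * X) = -X := by
  rw [← mul_assoc, G.sq_two, neg_one_mul]

/-- All identities follow by normal ordering: anticommutation sorts the indices increasingly and
equal neighbours contract. The `left_` variants do the same inside right-nested products, so the
simplification terminates with both sides in the same form. -/
lemma relations : (G.prod * G.γ 0 = -(G.γ 0 * G.prod) ∧ G.prod * G.γ 1 = -(G.γ 1 * G.prod) ∧
    G.prod * G.γ 2 = -(G.γ 2 * G.prod) ∧ G.prod * G.γ 3 = -(G.γ 3 * G.prod)) ∧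
    G.prod * G.prod = -1 ∧ G.prodᴴ = -G.prod := by
  have h10 := G.anticomm (a := 1) (b := 0) (by decide)
  have h20 := G.anticomm (a := 2) (b := 0) (by decide)
  have h30 := G.anticomm (a := 3) (b := 0) (by decide)
  have h31 := G.anticomm (a := 3) (b := 1) (by decide)
  have h32 := G.anticomm (a := 3) (b := 2) (by decide)
  have k10 := G.left_anticomm (a := 1) (b := 0) (by decide)
  have k20 := G.left_anticomm (a := 2) (b := 0) (by decide)
  have k21 := G.left_anticomm (a := 2) (b := 1) (by decide)
  have k30 := G.left_anticomm (a := 3) (b := 0) (by decide)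
  have k31 := G.left_anticomm (a := 3) (b := 1) (by decide)
  have k32 := G.left_anticomm (a := 3) (b := 2) (by decide)
  refine ⟨⟨?_, ?_, ?_, ?_⟩, ?_, ?_⟩ <;>
  simp only [prod, Matrix.conjTranspose_mul, G.herm, mul_assoc, h10, h20, h30, h31,
    h32, k10, k20, k21, k30, k31, k32, sq_zero, sq_one, sq_two, sq_three, left_sq_zero,
    left_sq_one, left_sq_two, mul_neg, neg_mul, neg_neg, mul_one, one_mul]

lemma prod_mul_γ (a : Fin 4) : G.prod * G.γ a = -(G.γ a * G.prod) := by
  obtain ⟨⟨h0, h1, h2, h3⟩, -⟩ := G.relations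
  fin_cases a
  exacts [h0, h1, h2, h3]

lemma γ5_mul_γ (a : Fin 4) : G.γ5 * G.γ a = -(G.γ a * G.γ5) := by
  rw [γ5_eq, Matrix.mul_smul, Matrix.smul_mul, prod_mul_γ, smul_neg]

lemma γ_mul_γ5 (a : Fin 4) : G.γ a * G.γ5 = -(G.γ5 * G.γ a) := by
  rw [γ5_mul_γ, neg_neg]

lemma γ5_star : G.γ5ᴴ = G.γ5 := by
  rw [γ5_eq, Matrix.conjTranspose_smul, G.relations.2.2, RCLike.star_def, Complex.conj_I,
    smul_neg, neg_smul, neg_neg]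

lemma prod_mul_γ5 : G.prod * G.γ5 = -(Complex.I • (1 : Matrix (Fin 4) (Fin 4) ℂ)) := by
  rw [γ5_eq, Matrix.mul_smul, G.relations.2.1, smul_neg]

lemma γ0_star : (G.γ 0)ᴴ = G.γ 0 := by rw [G.herm, G.sq_zero, one_mul]

lemma γ2_mul_γ5 (a b : Fin 4) : G.γ2 a b * G.γ5 = G.γ5 * G.γ2 a b := by
  have h : ∀ a b, G.γ a * G.γ b * G.γ5 = G.γ5 * (G.γ a * G.γ b) := fun a b => by
    rw [mul_assoc, γ_mul_γ5, mul_neg, ← mul_assoc, γ_mul_γ5, neg_mul, neg_neg, mul_assoc]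
  rw [γ2, Matrix.smul_mul, Matrix.mul_smul, sub_mul, mul_sub, h, h]

end Gamma4

/-- With commuting elements of square zero, only `xyzw` survives in the multinomial expansion, with
coefficient `4! = 24`. -/
lemma sum_pow_four {R : Type*} [Ring R] {x y z w : R} (hyx : Commute y x) (hzx : Commute z x)
    (hzy : Commute z y) (hwx : Commute w x) (hwy : Commute w y) (hwz : Commute w z)
    (hx : x * x = 0) (hy : y * y = 0) (hz : z * z = 0) (hw : w * w = 0) :
    (x + y + z + w) ^ 4 = 24 • (x * y * z * w) := by
  have h2 : (x + y) ^ 2 = 2 • (x * y) := by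
    rw [add_pow_of_sq_eq_zero hyx hy 1, pow_two, hx, zero_add, pow_one]
  have h3 : (x + y) ^ 3 = 0 := by
    rw [add_pow_of_sq_eq_zero hyx hy 2, pow_succ, pow_two, hx]
    simp
  have h4 : (x + y + z) ^ 3 = 6 • (x * y * z) := by
    rw [add_pow_of_sq_eq_zero (hzx.add_right hzy) hz 2, h3, h2, zero_add, smul_mul_assoc, smul_smul]
    norm_num
  have h5 : (x + y + z) ^ 4 = 0 := by
    rw [add_pow_of_sq_eq_zero (hzx.add_right hzy) hz 3, pow_succ, h3]
    simp
  rw [add_pow_of_sq_eq_zero ((hwx.add_right hwy).add_right hwz) hw 3, h5, h4, zero_add,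
    smul_mul_assoc, smul_smul]
  norm_num

variable {M : Type*} [TopologicalSpace M] [ChartedSpace (Eucl 4) M] [IsManifold (𝓡 4) ∞ M]
  (T : AbelianTwist 4 M) {G : Gamma4} (g : Cartan4 M G)

namespace Cartan4

/-- The vielbein as a matrix of power series. -/
def VS : Matrix (Fin 4) (Fin 4) (FormSeries T) :=
  ∑ a, (tn (ser T (g.e a) (g.smooth_e a)) (G.γ a) +
    tn (ser T (g.et a) (g.smooth_et a)) (G.γ a * G.γ5))

/-- The connection as a matrix of power series. -/
def OmS : Matrix (Fin 4) (Fin 4) (FormSeries T) :=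
  ∑ a, ∑ b, tn (ser T (g.wL a b) (g.smooth_wL a b)) ((1 / 4 : ℂ) • G.γ2 a b)
    + tn (ser T g.w g.smooth_w) (Complex.I • (1 : Matrix (Fin 4) (Fin 4) ℂ))
    + tn (ser T g.wt g.smooth_wt) G.γ5

lemma rep_VS : Rep (g.VS T) (g.V G) := Rep.sum fun a _ =>
  (Rep.tens _ (g.smooth_e a) _).add (Rep.tens _ (g.smooth_et a) _)

lemma rep_OmS : Rep (g.OmS T) (g.Om G) :=
  ((Rep.sum fun a _ => Rep.sum fun b _ => Rep.tens _ (g.smooth_wL a b) _).add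
    (Rep.tens _ g.smooth_w _)).add (Rep.tens _ g.smooth_wt _)

lemma degM_VS : DegM 1 (g.VS T) := DegM.sum fun a _ =>
  (degM_tn_ser _ (g.smooth_e a) _).add (degM_tn_ser _ (g.smooth_et a) _)

lemma degM_OmS : DegM 1 (g.OmS T) :=
  ((DegM.sum fun a _ => DegM.sum fun b _ => degM_tn_ser _ (g.smooth_wL a b) _).add
    (degM_tn_ser _ g.smooth_w _)).add (degM_tn_ser _ g.smooth_wt _)

lemma VS_γ : g.VS T * cst T G.γ5 = -(cst T G.γ5 * g.VS T) := by
  have h : ∀ a, G.γ a * G.γ5 * G.γ5 = -(G.γ5 * (G.γ a * G.γ5)) := fun a => by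
    rw [G.γ_mul_γ5, neg_mul, mul_assoc, G.γ_mul_γ5, mul_neg]
  simp only [VS, Finset.sum_mul, Finset.mul_sum, Matrix.add_mul, Matrix.mul_add, tn_mul_cst,
    cst_mul_tn, h, tn_neg]
  simp only [G.γ_mul_γ5, tn_neg, ← neg_add, Finset.sum_neg_distrib]

lemma OmS_γ : g.OmS T * cst T G.γ5 = cst T G.γ5 * g.OmS T := by
  simp only [OmS, Finset.sum_mul, Finset.mul_sum, Matrix.add_mul, Matrix.mul_add, tn_mul_cst,
    cst_mul_tn, Matrix.smul_mul, Matrix.mul_smul, Matrix.one_mul, Matrix.mul_one, G.γ2_mul_γ5]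

lemma star_VS : (g.VS T)ᴴ = cst T (G.γ 0) * g.VS T * cst T (G.γ 0) := by
  rw [Matrix.mul_assoc]
  have h := (g.rep_VS T).dagger
  rw [g.real_V] at h
  exact h.unique (((g.rep_VS T).cmulR _).cmulL _)

lemma star_OmS : (g.OmS T)ᴴ = -(cst T (G.γ 0) * g.OmS T * cst T (G.γ 0)) := by
  rw [Matrix.mul_assoc]
  have h := (g.rep_OmS T).dagger
  rw [g.real_Om] at h
  exact h.unique (((g.rep_OmS T).cmulR _).cmulL _).neg

lemma VS_sq_γ : g.VS T * g.VS T * cst T G.γ5 = cst T G.γ5 * (g.VS T * g.VS T) := by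
  rw [Matrix.mul_assoc, g.VS_γ, Matrix.mul_neg, ← Matrix.mul_assoc, g.VS_γ, Matrix.neg_mul, neg_neg,
    Matrix.mul_assoc]

lemma cst_γ0_sq : cst T (G.γ 0) * cst T (G.γ 0) = 1 := by rw [cst_mul, G.sq_zero, cst_one]

lemma star_VS_sq : (g.VS T * g.VS T)ᴴ = cst T (G.γ 0) * (g.VS T * g.VS T) * cst T (G.γ 0) :=
  star_mul_of_star (g.star_VS T) (g.star_VS T) (cst_γ0_sq T) rfl

/-- The classical limit of the vielbein. -/
def eS (a : Fin 4) : SForm 4 M := oneS (g.e a 0) (g.smooth_e a 0)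

/-- The classical volume form. -/
def vol : SForm 4 M := (-(24 * Complex.I)) • (g.eS 0 * g.eS 1 * g.eS 2 * g.eS 3)

lemma vol_ne_zero (p : M) : g.vol.1 p ≠ 0 := by
  have h := ιMulti_ne_zero p (g.nondeg p)
  have h1 : g.vol.1 p = (-(24 * Complex.I)) •
      ExteriorAlgebra.ιMulti ℂ 4 (fun a => g.e a 0 p) := by
    rw [ExteriorAlgebra.ιMulti_apply]
    simp only [List.ofFn_succ, List.ofFn_zero, List.prod_cons, List.prod_nil, mul_one, ← mul_assoc]
    rfl
  rw [h1]
  exact smul_ne_zero (neg_ne_zero.2 (mul_ne_zero (by norm_num) Complex.I_ne_zero)) h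

/-- The `γ_a γ₅` part of the vielbein is of positive order in `λ`. -/
lemma lim_VS : (g.VS T).map (lim T) = ∑ a, tn (g.eS a) (G.γ a) := by
  have h0 : ∀ a, tn (oneS (g.et a 0) (g.smooth_et a 0)) (G.γ a * G.γ5) = 0 := fun a => by
    have : oneS (g.et a 0) (g.smooth_et a 0) = 0 := Subtype.ext (funext fun p => by
      change ExteriorAlgebra.ι ℂ (g.et a 0 p) = 0
      rw [g.lim_et]
      exact map_zero (ExteriorAlgebra.ι ℂ (M := Cov 4 p)))
    rw [this, tn_zero_left]
  have h1 : ∀ A : Fin 4 → Matrix (Fin 4) (Fin 4) (FormSeries T),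
      (∑ a, A a).map (lim T) = ∑ a, (A a).map (lim T) := fun A =>
    map_sum (lim T).mapMatrix A Finset.univ
  rw [VS, h1]
  refine Finset.sum_congr rfl fun a _ => ?_
  rw [Matrix.map_add _ (map_add (lim T)), lim_tn_ser, lim_tn_ser, h0, add_zero]
  rfl

/-- The four summands of the classical vielbein commute and have square zero, which gives the `24`;
the matrices contribute `γ₀γ₁γ₂γ₃γ₅ = -i`. -/
lemma lim_VS_pow : (g.VS T * g.VS T * g.VS T * g.VS T * cst T G.γ5).map (lim T) =
    tn g.vol 1 := by
  have hc : ∀ a b, a ≠ b → Commute (tn (g.eS a) (G.γ a)) (tn (g.eS b) (G.γ b)) := fun a b h =>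
    commute_tn_oneS _ _ _ _ (G.anticomm h)
  have hs : ∀ a, tn (g.eS a) (G.γ a) * tn (g.eS a) (G.γ a) = 0 := fun a => tn_oneS_sq _ _ _
  have h4 : ∀ X : Matrix (Fin 4) (Fin 4) (SForm 4 M), X * X * X * X = X ^ 4 := fun X => by
    simp only [pow_succ, pow_zero, one_mul]
  rw [Matrix.map_mul, Matrix.map_mul, Matrix.map_mul, Matrix.map_mul, lim_tn_one, h4, lim_VS,
    Fin.sum_univ_four, sum_pow_four (hc 1 0 (by decide)) (hc 2 0 (by decide)) (hc 2 1 (by decide))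
    (hc 3 0 (by decide)) (hc 3 1 (by decide)) (hc 3 2 (by decide)) (hs 0) (hs 1) (hs 2) (hs 3),
    tn_mul_tn, tn_mul_tn, tn_mul_tn, smul_mul_assoc, tn_mul_tn, mul_one]
  have h5 : G.γ 0 * G.γ 1 * G.γ 2 * G.γ 3 * G.γ5 =
      -(Complex.I • (1 : Matrix (Fin 4) (Fin 4) ℂ)) := by
    rw [← G.prod_mul_γ5, Gamma4.prod, mul_assoc (G.γ 0), mul_assoc (G.γ 0), mul_assoc (G.γ 1)]
  rw [h5]
  ext1 i j
  simp only [tn, vol, Matrix.smul_apply, Matrix.map_apply, Matrix.neg_apply]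
  rw [← Nat.cast_smul_eq_nsmul ℂ, smul_smul, smul_smul]
  congr 1
  simp only [smul_eq_mul]
  push_cast
  ring

/-- The data of the Dirac operator in dimension 4. -/
def geom (h : starTorsion T (g.V G) (g.Om G) = 0) : DiracGeom T 4 where
  Q := g.VS T * g.VS T * g.VS T * g.VS T
  W := g.VS T * g.VS T * g.VS T
  Om := g.OmS T
  γ₀ := G.γ 0
  γ := G.γ5
  -- The prefactors of `innerProd4` and `action4`; reversing four covectors is an even permutation,
  -- so `ε = 1`.
  a := Complex.I
  b := -4
  ε := 1
  v := g.vol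
  degW := 3
  odd_degW := by decide
  degW_succ := rfl
  deg_W := ((g.degM_VS T).mul (g.degM_VS T)).mul (g.degM_VS T)
  deg_Om := g.degM_OmS T
  d_W := map_d_cube (g.degM_VS T) (map_d_eq_of_torsion (g.rep_VS T) (g.rep_OmS T) h)
  W_γ := by
    rw [Matrix.mul_assoc _ _ (cst T G.γ5), g.VS_γ, Matrix.mul_neg, ← Matrix.mul_assoc, g.VS_sq_γ]
    simp only [Matrix.mul_assoc]
  Q_γ := by
    rw [Matrix.mul_assoc (g.VS T * g.VS T), Matrix.mul_assoc _ _ (cst T G.γ5), g.VS_sq_γ,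
      ← Matrix.mul_assoc, g.VS_sq_γ]
    simp only [Matrix.mul_assoc]
  Om_γ := g.OmS_γ T
  γ₀_sq := G.sq_zero
  γ₀_star := G.γ0_star
  γ_star := G.γ5_star
  γ_γ₀ := G.γ5_mul_γ 0
  star_W := star_mul_of_star (g.star_VS_sq T) (g.star_VS T) (cst_γ0_sq T) (Matrix.mul_assoc ..)
  star_Q := by
    rw [Matrix.mul_assoc (g.VS T * g.VS T)]
    exact star_mul_of_star (g.star_VS_sq T) (g.star_VS_sq T) (cst_γ0_sq T) rfl
  star_Om := g.star_OmS T
  ε_sq := by norm_num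
  star_vol := extStar_dxS_four
  conj_a := by simp
  conj_b := by rw [map_neg, map_ofNat, mul_one]
  a_ne_zero := Complex.I_ne_zero
  vol :=
    have hd : DegM 4 (g.VS T * g.VS T * g.VS T * g.VS T * cst T G.γ5) :=
      ((((g.degM_VS T).mul (g.degM_VS T)).mul (g.degM_VS T)).mul (g.degM_VS T)).mul_cst _
    have h0 : ∀ i j, coeff 0 ((g.VS T * g.VS T * g.VS T * g.VS T * cst T G.γ5) i j) =
        (1 : Matrix (Fin 4) (Fin 4) ℂ) i j • g.vol := fun i j =>
      congrFun (congrFun (g.lim_VS_pow T) i) j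
    { deg := hd
      coeff_zero := h0
      isTop := by
        have h1 := IsDeg.isTop (hd 0 0) 0
        rwa [h0, Matrix.one_apply_eq, one_smul] at h1
      ne_zero := g.vol_ne_zero }

variable [T2Space M] [SigmaCompactSpace M]

lemma innerProd4_eq (h : starTorsion T (g.V G) (g.Om G) = 0) :
    innerProd4 T g = (g.geom T h).ip := by
  funext ψ₁ ψ₂
  rw [innerProd4, ← g.rep_VS T, ← valM_colS (T := T), ← valM_colS_bar (T := T), ← valM_mul,
    ← valM_mul, ← valM_mul, ← valM_mul, ← valM_mul, ← valM_mul_cst, intTr_valM, DiracGeom.ip]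
  simp only [geom, Matrix.mul_assoc]

lemma action4_eq (h : starTorsion T (g.V G) (g.Om G) = 0) :
    action4 T g = (g.geom T h).action := by
  funext ψ₁ ψ₂
  rw [action4, covD, ← g.rep_VS T, ← g.rep_OmS T, ← valM_colS (T := T), ← valM_colS_bar (T := T),
    ← valM_mul, ← valM_d, ← valM_sub, ← valM_mul, ← valM_mul, ← valM_mul, ← valM_mul,
    ← valM_mul_cst, intTr_valM, DiracGeom.action, DiracGeom.nabla]
  simp only [geom, Matrix.mul_assoc]

end Cartan4

end DimFour

end TwistedDirac

end

theorem mainTheorem2 :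
    (∀ (M : Type*) [TopologicalSpace M] [ChartedSpace (Eucl 2) M] [IsManifold (𝓡 2) ∞ M]
      [T2Space M] [SigmaCompactSpace M],
      OrientedAtlas 2 M → ∀ (T : AbelianTwist 2 M) (g : Cartan2 M),
        starTorsion T g.V g.Om = 0 →
          (∃! P, IsACDirac2 T g P) ∧
            ∀ P, IsACDirac2 T g P → FormallySelfAdjoint (innerProd2 T g) P) ∧
    (∀ (M : Type*) [TopologicalSpace M] [ChartedSpace (Eucl 4) M] [IsManifold (𝓡 4) ∞ M]
      [T2Space M] [SigmaCompactSpace M],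
      OrientedAtlas 4 M → ∀ (G : Gamma4) (T : AbelianTwist 4 M) (g : Cartan4 M G),
        starTorsion T (g.V G) (g.Om G) = 0 →
          (∃! P, IsACDirac4 T g P) ∧
            ∀ P, IsACDirac4 T g P → FormallySelfAdjoint (innerProd4 T g) P) := by
  refine ⟨?_, ?_⟩
  · intro M _ _ _ _ _ hO T g h
    have h1 := (g.geom T h).existsUnique_dirac hO
    rw [← g.innerProd2_eq T h, ← g.action2_eq T h] at h1
    exact h1
  · intro M _ _ _ _ _ hO G T g h
    have h1 := (g.geom T h).existsUnique_dirac hO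
    rw [← g.innerProd4_eq T h, ← g.action4_eq T h] at h1
    exact h1
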